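/- Let $p$ be an odd prime, $n\ge 0$, and let $H_n = E(x_1,\dots,x_n)\otimes P[y_1,\dots,y_n] \cong H^*(B(\mathbb Z/p)^n;\mathbb F_p)$ be the tensor product of the exterior and the polynomial algebra over $\mathbb F_p$, graded by $|x_i|=1$, $|y_i|=2$. The group $GL_n=GL_n(\mathbb F_p)$ acts on $H_n$ by algebra automorphisms, by the same linear substitutions of the $x_i$ and of the $y_i$. The mod $p$ Steenrod algebra $\mathcal A$, generated by the Bockstein $\beta$ and the reduced powers $P^k$, acts on $H_n$ by the Cartan formula, $\beta$ being a graded derivation, with $\beta x_i=y_i$, $\beta y_i=0$, $P^0=1$, $P^kx_i=0$ for $k\ge1$, $P^1y_i=y_i^p$, $P^ky_i=0$ for $k\ge 2$; this action commutes with $GL_n$. Let $D_n=H_n^{GL_n}$ be the extended Dickson algebra, a graded $\mathcal A$-module, let $D_n^k$ be its part of degree $k$, and let $\overline{D_n}=\bigoplus_{k>0}D_n^k$ be its augmentation ideal. Then $D_n$ is atomic as a module over the Steenrod algebra, in the following sense. Let $f:D_n\to D_n$ be a degree-preserving $\mathcal A$-linear map, let $r$ be the least positive degree with $D_n^r\ne0$,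 and suppose that $f$ is nonzero on $D_n^r$ (for instance, an isomorphism of $D_n^r$). Then $f$ restricts to an isomorphism $D_n^k\to D_n^k$ for every $k>0$, hence to an isomorphism of $\overline{D_n}$; and $f$ is an isomorphism of $D_n$ if and only if $f(1)\neq0$. -/

import Mathlib

open scoped TensorProduct

noncomputable section

namespace ExtendedDickson

/-- The exterior algebra `E(x₁,…,xₙ)` over `𝔽_p`; `xᵢ` is `ι` of the `i`-th standard vector. -/
abbrev E (p n : ℕ) : Type := ExteriorAlgebra (ZMod p) (Fin n → ZMod p)

/-- The polynomial algebra `P[y₁,…,yₙ]` over `𝔽_p`. -/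
abbrev P (p n : ℕ) : Type := MvPolynomial (Fin n) (ZMod p)

/-- `H^*(BVⁿ; 𝔽_p) = E(x₁,…,xₙ) ⊗ P[y₁,…,yₙ]` (`p` odd).  As the `yᵢ` have even degree, the graded
tensor product of algebras is the ordinary one. -/
def H (p n : ℕ) : Type := E p n ⊗[ZMod p] P p n

instance (p n : ℕ) : Ring (H p n) := inferInstanceAs (Ring (E p n ⊗[ZMod p] P p n))

instance (p n : ℕ) : Algebra (ZMod p) (H p n) :=
  inferInstanceAs (Algebra (ZMod p) (E p n ⊗[ZMod p] P p n))

/-- The element `e ⊗ f` of `E ⊗ P`. -/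
def tensor {p n : ℕ} (e : E p n) (f : P p n) : H p n := e ⊗ₜ[ZMod p] f

/-- The linear map `e ⊗ f ↦ a e ⊗ b f`. -/
def tensorMap {p n : ℕ} (a : E p n →ₗ[ZMod p] E p n) (b : P p n →ₗ[ZMod p] P p n) :
    Module.End (ZMod p) (H p n) :=
  TensorProduct.map a b

/-- The degree `k` part of `E ⊗ P`, where `|xᵢ| = 1` and `|yᵢ| = 2`. -/
def degreePart (p n k : ℕ) : Submodule (ZMod p) (H p n) :=
  Submodule.span (ZMod p)
    {z | ∃ (i j : ℕ) (e : E p n) (f : P p n), i + 2 * j = k ∧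
      e ∈ (⋀[ZMod p]^i (Fin n → ZMod p)) ∧ f.IsHomogeneous j ∧ z = tensor e f}

/-! ### The action of the general linear group -/

/-- The substitution `yⱼ ↦ ∑ᵢ gᵢⱼ yᵢ` of a matrix `g` in the polynomial algebra. -/
def polyAct {p n : ℕ} (g : Matrix (Fin n) (Fin n) (ZMod p)) : P p n →ₐ[ZMod p] P p n :=
  MvPolynomial.aeval fun j => ∑ i, g i j • MvPolynomial.X i

/-- The algebra endomorphism `xⱼ ↦ ∑ᵢ gᵢⱼ xᵢ`, `yⱼ ↦ ∑ᵢ gᵢⱼ yᵢ` of `E ⊗ P`. -/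
def act {p n : ℕ} (g : Matrix (Fin n) (Fin n) (ZMod p)) : H p n →ₐ[ZMod p] H p n :=
  Algebra.TensorProduct.map (ExteriorAlgebra.map (Matrix.mulVecLin g)) (polyAct g)

/-- The extended Dickson algebra `(E ⊗ P)^{GLₙ}`. -/
def dicksonSubalgebra (p n : ℕ) : Subalgebra (ZMod p) (H p n) :=
  ⨅ g : GL (Fin n) (ZMod p),
    AlgHom.equalizer (act (g : Matrix (Fin n) (Fin n) (ZMod p))) (AlgHom.id (ZMod p) (H p n))

/-! ### The Steenrod operations -/

/-- The total reduced power on the polynomial algebra: the algebra map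
`∑ₖ Pᵏ Tᵏ : P[y] → P[y][T]` with `yⱼ ↦ yⱼ + yⱼᵖ T`. -/
def totalPower (p n : ℕ) : P p n →ₐ[ZMod p] Polynomial (P p n) :=
  MvPolynomial.aeval fun j =>
    Polynomial.C (MvPolynomial.X j) + Polynomial.C (MvPolynomial.X j ^ p) * Polynomial.X

/-- The reduced power `Pᵏ` on the polynomial algebra. -/
def polyPower (p n k : ℕ) : P p n →ₗ[ZMod p] P p n :=
  ((Polynomial.lcoeff (P p n) k).restrictScalars (ZMod p)) ∘ₗ (totalPower p n).toLinearMap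

/-- The reduced power `Pᵏ` on `E ⊗ P`.  As `P⁰ xᵢ = xᵢ` and `Pᵏ xᵢ = 0` for `k > 0`, the Cartan
formula gives `Pᵏ (e ⊗ f) = e ⊗ Pᵏ f`. -/
def power (p n k : ℕ) : Module.End (ZMod p) (H p n) :=
  tensorMap LinearMap.id (polyPower p n k)

/-- The antiderivation `∂/∂xᵢ` of `E(x₁,…,xₙ)`: contraction with the `i`-th coordinate form. -/
def partialX {p n : ℕ} (i : Fin n) : E p n →ₗ[ZMod p] E p n :=
  CliffordAlgebra.contractLeft (Q := (0 : QuadraticForm (ZMod p) (Fin n → ZMod p)))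
    (LinearMap.proj i)

/-- The Bockstein on `E ⊗ P`: the derivation (with `β (a b) = (β a) b + (-1)^|a| a (β b)`) such that
`β xᵢ = yᵢ` and `β yᵢ = 0`, that is, `β = ∑ᵢ ∂/∂xᵢ ⊗ yᵢ`. -/
def bockstein (p n : ℕ) : Module.End (ZMod p) (H p n) :=
  ∑ i : Fin n, tensorMap (partialX i) (LinearMap.mulLeft (ZMod p) (MvPolynomial.X i))

/-- The mod `p` Steenrod algebra (`p` odd), as the algebra of natural operations on the cohomology
of elementary abelian `p`-groups that is generated by the Bockstein and the reduced powers.  (The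
Steenrod algebra acts faithfully on the family of all `H^*(BVᵐ; 𝔽_p)`.) -/
def steenrodSubalgebra (p : ℕ) : Subalgebra (ZMod p) ((m : ℕ) → Module.End (ZMod p) (H p m)) :=
  Algebra.adjoin (ZMod p)
    (insert (fun m => bockstein p m) (Set.range fun k : ℕ => fun m => power p m k))

/-- The mod `p` Steenrod algebra, as a ring. -/
def SteenrodAlgebra (p : ℕ) : Type := steenrodSubalgebra p

instance (p : ℕ) : Ring (SteenrodAlgebra p) := inferInstanceAs (Ring (steenrodSubalgebra p))

instance (p : ℕ) : Algebra (ZMod p) (SteenrodAlgebra p) :=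
  inferInstanceAs (Algebra (ZMod p) (steenrodSubalgebra p))

/-- The action of the Steenrod algebra on `E ⊗ P`. -/
def steenrodAct (p n : ℕ) : SteenrodAlgebra p →ₐ[ZMod p] Module.End (ZMod p) (H p n) :=
  (Pi.evalAlgHom (ZMod p) (fun m => Module.End (ZMod p) (H p m)) n).comp (steenrodSubalgebra p).val

/-- `E ⊗ P` is a module over the Steenrod algebra. -/
instance (p n : ℕ) : Module (SteenrodAlgebra p) (H p n) :=
  Module.compHom (H p n) (steenrodAct p n).toRingHom

theorem smul_eq_steenrodAct {p n : ℕ} (a : SteenrodAlgebra p) (z : H p n) :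
    a • z = steenrodAct p n a z := rfl

/-! ### The operations on elements `e ⊗ f` -/

theorem tensor_induction {p n : ℕ} {C : H p n → Prop} (zero : C 0)
    (tensor : ∀ e f, C (tensor e f)) (add : ∀ a b, C a → C b → C (a + b)) (z : H p n) : C z :=
  TensorProduct.induction_on z zero tensor add

theorem act_tensor {p n : ℕ} (g : Matrix (Fin n) (Fin n) (ZMod p)) (e : E p n) (f : P p n) :
    act g (tensor e f) = tensor (ExteriorAlgebra.map (Matrix.mulVecLin g) e) (polyAct g f) := rfl

theorem power_tensor {p n : ℕ} (k : ℕ) (e : E p n) (f : P p n) :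
    power p n k (tensor e f) = tensor e (polyPower p n k f) := rfl

theorem bockstein_tensor {p n : ℕ} (e : E p n) (f : P p n) :
    bockstein p n (tensor e f) =
      ∑ i : Fin n, tensor (partialX i e) (MvPolynomial.X i * f) := by
  rw [bockstein, LinearMap.sum_apply]
  rfl

theorem tensor_sum_left {p n : ℕ} {ι : Type} (s : Finset ι) (e : ι → E p n) (f : P p n) :
    tensor (∑ i ∈ s, e i) f = ∑ i ∈ s, tensor (e i) f :=
  TensorProduct.sum_tmul s e f

theorem tensor_sum_right {p n : ℕ} {ι : Type} (s : Finset ι) (e : E p n) (f : ι → P p n) :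
    tensor e (∑ i ∈ s, f i) = ∑ i ∈ s, tensor e (f i) :=
  TensorProduct.tmul_sum e s f

theorem tensor_smul_comm {p n : ℕ} (c : ZMod p) (e : E p n) (f : P p n) :
    tensor (c • e) f = tensor e (c • f) :=
  TensorProduct.smul_tmul c e f

/-! ### The Steenrod operations commute with the general linear group -/

theorem polyPower_polyAct {p n : ℕ} [Fact p.Prime] (g : Matrix (Fin n) (Fin n) (ZMod p)) (k : ℕ)
    (f : P p n) : polyPower p n k (polyAct g f) = polyAct g (polyPower p n k f) := by
  have h : (totalPower p n).comp (polyAct g) =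
      (Polynomial.mapAlgHom (polyAct g)).comp (totalPower p n) := by
    apply MvPolynomial.algHom_ext
    intro j
    simp only [AlgHom.comp_apply, polyAct, totalPower, MvPolynomial.aeval_X, map_sum, map_smul,
      map_add, map_mul, Polynomial.coe_mapAlgHom, Polynomial.map_C, Polynomial.map_X,
      RingHom.coe_coe, map_pow, smul_add, Finset.sum_add_distrib]
    congr 1
    · exact Finset.sum_congr rfl fun i _ => Polynomial.smul_C _ _
    · rw [sum_pow_char, Finset.sum_mul]
      refine Finset.sum_congr rfl fun i _ => ?_
      have hc : (g i j • (MvPolynomial.X i : P p n)) ^ p = g i j • MvPolynomial.X i ^ p := by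
        rw [smul_pow, ZMod.pow_card]
      rw [← smul_mul_assoc, ← Polynomial.C_pow, Polynomial.smul_C, ← hc, Polynomial.C_pow]
  have h' := congrArg (fun q => Polynomial.coeff q k) (DFunLike.congr_fun h f)
  simpa [polyPower] using h'

theorem power_act {p n : ℕ} [Fact p.Prime] (g : Matrix (Fin n) (Fin n) (ZMod p)) (k : ℕ)
    (z : H p n) : power p n k (act g z) = act g (power p n k z) := by
  induction z using tensor_induction with
  | zero => simp only [map_zero]
  | tensor e f => simp only [power_tensor, act_tensor, polyPower_polyAct]
  | add a b ha hb => simp only [map_add, ha, hb]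

theorem contractLeft_map {p n : ℕ} (g : Matrix (Fin n) (Fin n) (ZMod p))
    (d : Module.Dual (ZMod p) (Fin n → ZMod p)) (e : E p n) :
    CliffordAlgebra.contractLeft d (ExteriorAlgebra.map (Matrix.mulVecLin g) e) =
      ExteriorAlgebra.map (Matrix.mulVecLin g)
        (CliffordAlgebra.contractLeft (d ∘ₗ Matrix.mulVecLin g) e) := by
  induction e using CliffordAlgebra.left_induction with
  | algebraMap r =>
    rw [AlgHom.commutes, CliffordAlgebra.contractLeft_algebraMap,
      CliffordAlgebra.contractLeft_algebraMap, map_zero]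
  | add a b ha hb => simp only [map_add, ha, hb]
  | ι_mul a v ha =>
    have hv : ExteriorAlgebra.map (Matrix.mulVecLin g) (CliffordAlgebra.ι 0 v) =
        CliffordAlgebra.ι 0 (Matrix.mulVecLin g v) := ExteriorAlgebra.map_apply_ι _ _
    rw [map_mul, hv, CliffordAlgebra.contractLeft_ι_mul, CliffordAlgebra.contractLeft_ι_mul,
      map_sub, map_smul, map_mul, hv, ha]
    rfl

theorem partialX_map {p n : ℕ} (g : Matrix (Fin n) (Fin n) (ZMod p)) (i : Fin n) (e : E p n) :
    partialX i (ExteriorAlgebra.map (Matrix.mulVecLin g) e) =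
      ∑ j, g i j • ExteriorAlgebra.map (Matrix.mulVecLin g) (partialX j e) := by
  have h : (LinearMap.proj i : Module.Dual (ZMod p) (Fin n → ZMod p)) ∘ₗ Matrix.mulVecLin g =
      ∑ j, g i j • (LinearMap.proj j : Module.Dual (ZMod p) (Fin n → ZMod p)) := by
    refine LinearMap.ext fun v => ?_
    simp [Matrix.mulVec, dotProduct]
  rw [partialX, contractLeft_map, h, map_sum, LinearMap.sum_apply, map_sum]
  refine Finset.sum_congr rfl fun j _ => ?_
  rw [map_smul, LinearMap.smul_apply, map_smul]
  rfl

theorem bockstein_act {p n : ℕ} (g : Matrix (Fin n) (Fin n) (ZMod p))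
    (z : H p n) : bockstein p n (act g z) = act g (bockstein p n z) := by
  induction z using tensor_induction with
  | zero => simp only [map_zero]
  | tensor e f =>
    have hX : ∀ j, polyAct g (MvPolynomial.X j) = ∑ i, g i j • (MvPolynomial.X i : P p n) :=
      fun j => MvPolynomial.aeval_X _ _
    simp only [act_tensor, bockstein_tensor, map_sum, map_mul, hX, partialX_map, tensor_sum_left,
      Finset.sum_mul, tensor_sum_right, tensor_smul_comm, smul_mul_assoc]
    exact Finset.sum_comm
  | add a b ha hb => simp only [map_add, ha, hb]

theorem mem_dicksonSubalgebra {p n : ℕ} {z : H p n} :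
    z ∈ dicksonSubalgebra p n ↔
      ∀ g : GL (Fin n) (ZMod p), act (g : Matrix (Fin n) (Fin n) (ZMod p)) z = z := by
  simp [dicksonSubalgebra, Algebra.mem_iInf, AlgHom.mem_equalizer]

theorem smul_act {p n : ℕ} [Fact p.Prime] (g : Matrix (Fin n) (Fin n) (ZMod p))
    (a : SteenrodAlgebra p) (z : H p n) : a • act g z = act g (a • z) := by
  obtain ⟨a, ha⟩ := a
  change a n (act g z) = act g (a n z)
  induction ha using Algebra.adjoin_induction generalizing z with
  | mem x hx =>
    rcases hx with rfl | ⟨k, rfl⟩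
    · exact bockstein_act g z
    · exact power_act g k z
  | algebraMap r => simp [Pi.algebraMap_apply, Module.algebraMap_end_apply]
  | add x y _ _ hx hy => simp [hx, hy]
  | mul x y _ _ hx hy => simp [hx, hy]

/-! ### The extended Dickson algebra as a graded module over the Steenrod algebra -/

/-- The extended Dickson algebra `Dₙ = (E ⊗ P)^{GLₙ}` as a module over the Steenrod algebra. -/
def D (p n : ℕ) [Fact p.Prime] : Submodule (SteenrodAlgebra p) (H p n) where
  carrier := dicksonSubalgebra p n
  add_mem' := (dicksonSubalgebra p n).add_mem
  zero_mem' := (dicksonSubalgebra p n).zero_mem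
  smul_mem' a z hz := by
    refine mem_dicksonSubalgebra.2 fun g => ?_
    rw [← smul_act, mem_dicksonSubalgebra.1 hz g]

/-- The unit of `Dₙ`. -/
instance (p n : ℕ) [Fact p.Prime] : One (D p n) := ⟨⟨1, (dicksonSubalgebra p n).one_mem⟩⟩

/-- The degree `k` part of `Dₙ`. -/
def DDegree (p n k : ℕ) [Fact p.Prime] : AddSubgroup (D p n) :=
  (degreePart p n k).toAddSubgroup.comap (D p n).subtype.toAddMonoidHom

/-- The augmentation ideal of `Dₙ`: the sum of the parts of positive degree. -/
def DAugmentation (p n : ℕ) [Fact p.Prime] : AddSubgroup (D p n) :=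
  ⨆ k : ℕ, ⨆ _ : 0 < k, DDegree p n k

end ExtendedDickson

end

open scoped TensorProduct

noncomputable section

namespace ExtendedDickson

variable {p n : ℕ}

/-! ### Coefficients of elements of `E ⊗ P` with respect to the exterior variables -/

/-! The argument compares eigenspaces of `f`. For `c` in `𝔽_p` the invariants on which `f` is
multiplication by `c` are stable under the Steenrod operations (`smul_mem_eigenSubmodule`). The
bottom degree of `D` is one-dimensional (`exists_eq_smul_of_mem_degreePart`), so a bottom class is
an eigenvector, with eigenvalue `c ≠ 0` by assumption. A kernel element of positive degree is an
eigenvector with eigenvalue `0`. If two stable spaces of invariants with nonzero elements of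
positive degree always share a nonzero element, the two eigenvalues agree (`eigenvalue_unique`),
which is absurd. Hence `f` is injective in positive degrees, and bijective there because each degree
is finite. Degree `0` consists of the multiples of `1`.

The common elements are the powers `det (yₐ ^ p ^ gⱼ) ^ (p - 1)` with distinct large `gⱼ`. First,
the Milnor primitives lead from any nonzero element of positive degree to a nonzero polynomial
(`exists_polynomial_mem`): they lower the exterior length, and an element that they all kill is a
polynomial, since the Moore matrix has nonzero determinant.

The core is `exists_mooreMatrix_det_pow_mem`. Let `h` be an invariant homogeneous polynomial of
positive degree in a space `N` stable under the reduced powers, and let `ℓ` be a functional that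
vanishes on `N`. Composites of total powers are additive substitutions, so `ℓ`, with scalars
extended, kills `h` after `yₐ ↦ ∑ⱼ αⱼ uⱼₐ`, where `uⱼₐ = ∑ₛ (tⱼ yₐ) ^ p ^ s` and the `tⱼ` are new
variables. On matrices `W` over `𝔽_p` the function `det W ^ (p - 1)`, the indicator of
invertibility, is a linear combination of functions `h (α W)` (`exists_sum_eq_det_pow`). As
polynomials in the entries the two sides differ by a combination of the `Xⱼₐ ^ p - Xⱼₐ`. After
substituting `uⱼₐ`, these telescope to `(tⱼ yₐ) ^ p ^ (B + 1) - tⱼ yₐ`, and neither term contributes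
to the coefficient at `∏ⱼ tⱼ ^ ((p - 1) p ^ gⱼ)` when the `gⱼ` are large. There `det (uⱼₐ) ^ (p -
1)` has the coefficient `ℓ (det (yₐ ^ p ^ gⱼ) ^ (p - 1))`, which therefore vanishes.

For the bottom degree, invariance forces the coefficient at a nonempty set of exterior variables to
be divisible by the `(p - 2)`-nd power of every linear form, with an extra factor for each missing
variable. Polynomial invariants of positive degree start higher. What remains is the class `x₁ ⋯ xₙ`
times the `(p - 2)`-nd power of the Moore determinant. -/

theorem tensor_sub_left (e e' : E p n) (f : P p n) :
    tensor (e - e') f = tensor e f - tensor e' f := TensorProduct.sub_tmul _ _ _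

theorem tensor_neg_left (e : E p n) (f : P p n) :
    tensor (-e) f = -tensor e f := TensorProduct.neg_tmul _ _

theorem tensor_smul_left (c : ZMod p) (e : E p n) (f : P p n) :
    tensor (c • e) f = c • tensor e f := rfl

theorem tensor_smul_right (c : ZMod p) (e : E p n) (f : P p n) :
    tensor e (c • f) = c • tensor e f := TensorProduct.tmul_smul _ _ _

theorem tensor_zero_left (f : P p n) : tensor (0 : E p n) f = 0 := TensorProduct.zero_tmul _ _

theorem tensor_zero_right (e : E p n) : tensor e (0 : P p n) = 0 := TensorProduct.tmul_zero _ _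

theorem tensor_add_right (e : E p n) (f f' : P p n) :
    tensor e (f + f') = tensor e f + tensor e f' := TensorProduct.tmul_add _ _ _

theorem tensor_ext {M : Type*} [AddCommMonoid M] [Module (ZMod p) M]
    {a b : H p n →ₗ[ZMod p] M} (h : ∀ e f, a (tensor e f) = b (tensor e f)) : a = b := by
  refine LinearMap.ext fun z => ?_
  induction z using tensor_induction with
  | zero => simp only [map_zero]
  | tensor e f => exact h e f
  | add x y hx hy => simp only [map_add, hx, hy]

/-- The antiderivation `∂/∂xᵢ` of `E ⊗ P`. -/
def pderivX (i : Fin n) : Module.End (ZMod p) (H p n) := tensorMap (partialX i) LinearMap.id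

/-- Multiplication by a polynomial on `E ⊗ P`. -/
def polyMul (q : P p n) : Module.End (ZMod p) (H p n) :=
  tensorMap LinearMap.id (LinearMap.mulLeft (ZMod p) q)

/-- The iterated derivative of `E ⊗ P` with respect to a list of exterior variables. -/
def pderivList : List (Fin n) → Module.End (ZMod p) (H p n)
  | [] => 1
  | s :: S => pderivX s * pderivList S

/-- The projection of `E ⊗ P` onto `P` that sends the exterior variables to `0`. -/
def polyPart : H p n →ₗ[ZMod p] P p n :=
  (TensorProduct.lid (ZMod p) (P p n)).toLinearMap ∘ₗ
    TensorProduct.map (ExteriorAlgebra.algebraMapInv (R := ZMod p) (M := Fin n → ZMod p)).toLinearMap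
      LinearMap.id

/-- The coefficient at the product of a list of exterior variables, up to sign. -/
def coeffX (S : List (Fin n)) : H p n →ₗ[ZMod p] P p n := polyPart ∘ₗ pderivList S

theorem pderivX_tensor (i : Fin n) (e : E p n) (f : P p n) :
    pderivX i (tensor e f) = tensor (partialX i e) f := rfl

theorem polyMul_tensor (q : P p n) (e : E p n) (f : P p n) :
    polyMul q (tensor e f) = tensor e (q * f) := rfl

theorem polyPart_tensor (e : E p n) (f : P p n) :
    polyPart (tensor e f) = ExteriorAlgebra.algebraMapInv e • f := rfl

theorem pderivList_cons (s : Fin n) (S : List (Fin n)) (z : H p n) :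
    pderivList (s :: S) z = pderivX s (pderivList S z) := rfl

theorem pderivX_pderivX (i : Fin n) (z : H p n) : pderivX i (pderivX i z) = 0 := by
  have : (pderivX i : Module.End (ZMod p) (H p n)) * pderivX i = 0 := by
    refine tensor_ext fun e f => ?_
    change tensor (partialX i (partialX i e)) f = 0
    rw [partialX, CliffordAlgebra.contractLeft_contractLeft, tensor_zero_left]
  exact LinearMap.congr_fun this z

theorem pderivX_comm (i j : Fin n) (z : H p n) :
    pderivX i (pderivX j z) = -pderivX j (pderivX i z) := by
  have : (pderivX i : Module.End (ZMod p) (H p n)) * pderivX j = -(pderivX j * pderivX i) := by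
    refine tensor_ext fun e f => ?_
    change tensor (partialX i (partialX j e)) f = -tensor (partialX j (partialX i e)) f
    rw [partialX, partialX, CliffordAlgebra.contractLeft_comm, tensor_neg_left]
  exact LinearMap.congr_fun this z

theorem pderivX_polyMul (i : Fin n) (q : P p n) (z : H p n) :
    pderivX i (polyMul q z) = polyMul q (pderivX i z) := by
  have : (pderivX i : Module.End (ZMod p) (H p n)) * polyMul q = polyMul q * pderivX i :=
    tensor_ext fun e f => rfl
  exact LinearMap.congr_fun this z

theorem pderivList_polyMul (S : List (Fin n)) (q : P p n) (z : H p n) :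
    pderivList S (polyMul q z) = polyMul q (pderivList S z) := by
  induction S with
  | nil => rfl
  | cons s S ih => rw [pderivList_cons, ih, pderivX_polyMul, pderivList_cons]

theorem polyPart_polyMul (q : P p n) (z : H p n) : polyPart (polyMul q z) = q * polyPart z := by
  have : (polyPart : H p n →ₗ[ZMod p] P p n) ∘ₗ polyMul q =
      LinearMap.mulLeft (ZMod p) q ∘ₗ polyPart := by
    refine tensor_ext fun e f => ?_
    simp only [LinearMap.comp_apply, polyMul_tensor, polyPart_tensor, LinearMap.mulLeft_apply,
      mul_smul_comm]
  exact LinearMap.congr_fun this z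

theorem coeffX_polyMul (S : List (Fin n)) (q : P p n) (z : H p n) :
    coeffX S (polyMul q z) = q * coeffX S z := by
  simp only [coeffX, LinearMap.comp_apply, pderivList_polyMul, polyPart_polyMul]

theorem polyMul_mul (q q' : P p n) (z : H p n) : polyMul (q * q') z = polyMul q (polyMul q' z) := by
  have : (polyMul (q * q') : Module.End (ZMod p) (H p n)) = polyMul q * polyMul q' := by
    refine tensor_ext fun e f => ?_
    change tensor _ _ = tensor _ _
    simp only [LinearMap.mulLeft_apply, mul_assoc]
    rfl
  exact LinearMap.congr_fun this z

theorem polyMul_sum {ι : Type} (s : Finset ι) (q : ι → P p n) (z : H p n) :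
    polyMul (∑ i ∈ s, q i) z = ∑ i ∈ s, polyMul (q i) z := by
  have : (polyMul (∑ i ∈ s, q i) : Module.End (ZMod p) (H p n)) = ∑ i ∈ s, polyMul (q i) := by
    refine tensor_ext fun e f => ?_
    simp only [LinearMap.sum_apply, polyMul_tensor, Finset.sum_mul, tensor_sum_right]
  rw [this, LinearMap.sum_apply]

theorem polyMul_zero (z : H p n) : polyMul 0 z = 0 := by
  simpa using polyMul_sum (∅ : Finset ℕ) (fun _ => (0 : P p n)) z

/-- Setting `xᵢ = 0` is `e ↦ e - xᵢ ∂e/∂xᵢ`. -/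
theorem map_update_zero_eq (i : Fin n) (e : E p n) :
    ExteriorAlgebra.map (LinearMap.id - LinearMap.single (ZMod p) (fun _ => ZMod p) i ∘ₗ
        LinearMap.proj i) e =
      e - ExteriorAlgebra.ι (ZMod p) (Pi.single i 1) * partialX i e := by
  induction e using CliffordAlgebra.left_induction with
  | algebraMap r =>
    rw [AlgHom.commutes, partialX, CliffordAlgebra.contractLeft_algebraMap, mul_zero, sub_zero]
  | add a b ha hb => simp only [map_add, ha, hb, mul_add]; abel
  | ι_mul a v ha =>
    have h1 : ExteriorAlgebra.map (LinearMap.id - LinearMap.single (ZMod p) (fun _ => ZMod p) i ∘ₗ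
        LinearMap.proj i) (CliffordAlgebra.ι 0 v) =
        ExteriorAlgebra.ι (ZMod p) v - v i • ExteriorAlgebra.ι (ZMod p) (Pi.single i 1) := by
      refine (ExteriorAlgebra.map_apply_ι _ _).trans ?_
      rw [← map_smul, ← map_sub]
      congr 1
      ext j
      by_cases hj : j = i
      · subst hj; simp
      · simp [hj]
    have h2 : (CliffordAlgebra.ι 0 v : E p n) = ExteriorAlgebra.ι (ZMod p) v := rfl
    have h3 := ExteriorAlgebra.ι_add_mul_swap (R := ZMod p) v (Pi.single i (1 : ZMod p))
    have h4 := ExteriorAlgebra.ι_sq_zero (R := ZMod p) (Pi.single i (1 : ZMod p) : Fin n → ZMod p)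
    rw [map_mul, h1, ha, partialX, CliffordAlgebra.contractLeft_ι_mul, h2]
    change _ = _ - _ * (v i • a - _)
    set x := ExteriorAlgebra.ι (ZMod p) (Pi.single i (1 : ZMod p) : Fin n → ZMod p)
    set y := ExteriorAlgebra.ι (ZMod p) v
    set d := (CliffordAlgebra.contractLeft (Q := (0 : QuadraticForm (ZMod p) (Fin n → ZMod p)))
      (LinearMap.proj i)) a
    change (y - v i • x) * (a - x * d) = y * a - x * (v i • a - y * d)
    have h5 : x * y = - (y * x) := by rw [eq_neg_iff_add_eq_zero, add_comm]; exact h3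
    simp only [sub_mul, mul_sub, smul_mul_assoc, mul_smul_comm, ← mul_assoc, h4, h5, zero_mul,
      smul_zero, neg_mul]
    abel

/-- An element of `E ⊗ P` all of whose derivatives with respect to the exterior variables vanish
is a polynomial. -/
theorem eq_tensor_one_polyPart (z : H p n) (h : ∀ i, pderivX i z = 0) :
    z = tensor 1 (polyPart z) := by
  classical
  let κ : Fin n → (Fin n → ZMod p) →ₗ[ZMod p] (Fin n → ZMod p) := fun i =>
    LinearMap.id - LinearMap.single (ZMod p) (fun _ => ZMod p) i ∘ₗ LinearMap.proj i
  have hκ : ∀ i v j, κ i v j = if j = i then 0 else v j := by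
    intro i v j
    by_cases hj : j = i
    · subst hj; simp [κ]
    · simp [κ, hj]
  -- Setting `xᵢ = 0` is `e ↦ e - xᵢ ∂e/∂xᵢ`, so it fixes `z`. Doing this for all `i` in turn sends
  -- every exterior variable to `0`.
  have hfix : ∀ i, tensorMap (ExteriorAlgebra.map (κ i)).toLinearMap LinearMap.id z = z := by
    intro i
    have : tensorMap (ExteriorAlgebra.map (κ i)).toLinearMap LinearMap.id =
        1 - tensorMap (LinearMap.mulLeft (ZMod p) (ExteriorAlgebra.ι (ZMod p) (Pi.single i 1)))
          LinearMap.id * (pderivX i : Module.End (ZMod p) (H p n)) := by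
      refine tensor_ext fun e f => ?_
      change tensor (ExteriorAlgebra.map (κ i) e) f = tensor e f - tensor (_ * _) f
      rw [map_update_zero_eq, tensor_sub_left]
    rw [this, LinearMap.sub_apply, Module.End.mul_apply, h i, map_zero, sub_zero]
    rfl
  have key : ∀ s : Finset (Fin n), ∃ κs : (Fin n → ZMod p) →ₗ[ZMod p] (Fin n → ZMod p),
      (∀ v j, κs v j = if j ∈ s then 0 else v j) ∧
      tensorMap (ExteriorAlgebra.map κs).toLinearMap LinearMap.id z = z := by
    intro s
    induction s using Finset.induction_on with
    | empty =>
      refine ⟨LinearMap.id, by simp, ?_⟩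
      rw [ExteriorAlgebra.map_id]
      exact LinearMap.congr_fun (TensorProduct.map_id) z
    | insert i s hi ih =>
      obtain ⟨κs, h1, h2⟩ := ih
      refine ⟨κs ∘ₗ κ i, fun v j => ?_, ?_⟩
      · rw [LinearMap.comp_apply, h1, hκ]
        by_cases hj : j = i <;> by_cases hj' : j ∈ s <;> simp [hj, hj']
      · have : tensorMap (ExteriorAlgebra.map (κs ∘ₗ κ i)).toLinearMap LinearMap.id =
            tensorMap (ExteriorAlgebra.map κs).toLinearMap LinearMap.id *
            (tensorMap (ExteriorAlgebra.map (κ i)).toLinearMap LinearMap.id :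
              Module.End (ZMod p) (H p n)) := by
          refine tensor_ext fun e f => ?_
          change tensor _ _ = tensor _ _
          rw [← ExteriorAlgebra.map_comp_map]
          rfl
        rw [this, Module.End.mul_apply, hfix i, h2]
  obtain ⟨κs, h1, h2⟩ := key Finset.univ
  have h0 : κs = 0 := by
    ext v j; simp [h1]
  rw [h0] at h2
  have : tensorMap (ExteriorAlgebra.map 0).toLinearMap LinearMap.id z =
      tensor 1 (polyPart z) := by
    let T : P p n →ₗ[ZMod p] H p n := TensorProduct.mk (ZMod p) (E p n) (P p n) 1
    have : tensorMap (ExteriorAlgebra.map 0).toLinearMap LinearMap.id =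
        T ∘ₗ (polyPart : H p n →ₗ[ZMod p] P p n) := by
      refine tensor_ext fun e f => ?_
      change tensor (ExteriorAlgebra.map 0 e) f = tensor 1 (polyPart (tensor e f))
      rw [polyPart_tensor, ← tensor_smul_comm]
      congr 1
      have hh : ExteriorAlgebra.map (0 : (Fin n → ZMod p) →ₗ[ZMod p] (Fin n → ZMod p)) =
          (Algebra.ofId (ZMod p) (E p n)).comp ExteriorAlgebra.algebraMapInv := by
        ext v
        simp [ExteriorAlgebra.algebraMapInv]
      rw [hh, ← Algebra.algebraMap_eq_smul_one]
      rfl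
    exact LinearMap.congr_fun this z
  rw [← this, h2]

theorem pderivX_pderivList_of_mem {k : Fin n} {S : List (Fin n)} (hk : k ∈ S) (z : H p n) :
    pderivX k (pderivList S z) = 0 := by
  induction S with
  | nil => simp at hk
  | cons s S ih =>
    rw [pderivList_cons]
    by_cases h : k = s
    · rw [h, pderivX_pderivX]
    · rw [pderivX_comm, ih ((List.mem_cons.1 hk).resolve_left h), map_zero, neg_zero]

theorem nodup_of_pderivList_ne_zero {S : List (Fin n)} {z : H p n} (h : pderivList S z ≠ 0) :
    S.Nodup := by
  induction S with
  | nil => exact List.nodup_nil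
  | cons s S ih =>
    refine List.nodup_cons.2 ⟨fun hs => h ?_, ih fun h0 => h ?_⟩
    · exact pderivX_pderivList_of_mem hs z
    · rw [pderivList_cons, h0, map_zero]

theorem nodup_of_coeffX_ne_zero {S : List (Fin n)} {z : H p n} (h : coeffX S z ≠ 0) :
    S.Nodup := by
  refine nodup_of_pderivList_ne_zero (z := z) fun h0 => h ?_
  rw [coeffX, LinearMap.comp_apply, h0, map_zero]

/-- Descending induction on the length of `S`: a list longer than `n` has a repetition, so its
derivative vanishes. If all longer derivatives vanish, the derivative along `S` is a polynomial, and
that polynomial is `coeffX S z`. -/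
theorem eq_zero_of_coeffX_eq_zero {z : H p n} (h : ∀ S, coeffX S z = 0) : z = 0 := by
  have key : ∀ m : ℕ, ∀ S : List (Fin n), n + 1 ≤ S.length + m → pderivList S z = 0 := by
    intro m
    induction m with
    | zero =>
      intro S hS
      by_contra h0
      have := (nodup_of_pderivList_ne_zero h0).length_le_card
      simp only [Fintype.card_fin] at this
      omega
    | succ m ih =>
      intro S hS
      have h1 := eq_tensor_one_polyPart (pderivList S z) fun i => by
        rw [← pderivList_cons]
        exact ih _ (by simp only [List.length_cons]; omega)
      have h2 : polyPart (pderivList S z) = 0 := h S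
      rw [h1, h2, tensor_zero_right]
  exact key (n + 1) [] (by simp)

theorem eq_of_coeffX_eq {z z' : H p n} (h : ∀ S, coeffX S z = coeffX S z') : z = z' :=
  sub_eq_zero.1 (eq_zero_of_coeffX_eq_zero fun S => by rw [map_sub, h S, sub_self])

theorem polyMul_eq_zero [Fact p.Prime] {q : P p n} (hq : q ≠ 0) {z : H p n}
    (h : polyMul q z = 0) : z = 0 := by
  refine eq_zero_of_coeffX_eq_zero fun S => ?_
  have := coeffX_polyMul S q z
  rw [h, map_zero, eq_comm, mul_eq_zero] at this
  exact this.resolve_left hq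

theorem pderivList_perm {S S' : List (Fin n)} (h : S.Perm S') (z : H p n) :
    pderivList S z = pderivList S' z ∨ pderivList S z = -pderivList S' z := by
  induction h with
  | nil => exact Or.inl rfl
  | cons s _ ih =>
    rw [pderivList_cons, pderivList_cons]
    rcases ih with h | h
    · exact Or.inl (by rw [h])
    · exact Or.inr (by rw [h, map_neg])
  | swap s t S => exact Or.inr (pderivX_comm _ _ _)
  | trans _ _ ih ih' =>
    rcases ih with h | h <;> rcases ih' with h' | h' <;> rw [h, h'] <;> simp

theorem coeffX_eq_zero_of_perm {S S' : List (Fin n)} (h : S.Perm S') {z : H p n}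
    (hz : coeffX S z = 0) : coeffX S' z = 0 := by
  rcases pderivList_perm h z with h | h
  · rw [coeffX, LinearMap.comp_apply, ← h]; exact hz
  · rw [coeffX, LinearMap.comp_apply, ← neg_eq_zero, ← map_neg, ← h]; exact hz

/-! ### Coefficients and the action of matrices -/

theorem pderivX_act (g : Matrix (Fin n) (Fin n) (ZMod p)) (i : Fin n) (z : H p n) :
    pderivX i (act g z) = ∑ j, g i j • act g (pderivX j z) := by
  induction z using tensor_induction with
  | zero => simp only [map_zero, smul_zero, Finset.sum_const_zero]
  | tensor e f =>
    simp only [act_tensor, pderivX_tensor, partialX_map, tensor_sum_left, tensor_smul_left]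
  | add a b ha hb => simp only [map_add, ha, hb, smul_add, Finset.sum_add_distrib]

theorem polyPart_act (g : Matrix (Fin n) (Fin n) (ZMod p)) (z : H p n) :
    polyPart (act g z) = polyAct g (polyPart z) := by
  induction z using tensor_induction with
  | zero => simp only [map_zero]
  | tensor e f =>
    have : (ExteriorAlgebra.algebraMapInv).comp (ExteriorAlgebra.map (Matrix.mulVecLin g)) =
        (ExteriorAlgebra.algebraMapInv : E p n →ₐ[ZMod p] ZMod p) := by
      ext v
      simp [ExteriorAlgebra.algebraMapInv]
    rw [act_tensor, polyPart_tensor, polyPart_tensor, map_smul, ← AlgHom.comp_apply, this]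
  | add a b ha hb => simp only [map_add, ha, hb]

/-! ### Coefficients and degrees -/

theorem exteriorPower_zero : (⋀[ZMod p]^0 (Fin n → ZMod p)) = 1 := pow_zero _

theorem exteriorPower_succ (k : ℕ) : (⋀[ZMod p]^(k + 1) (Fin n → ZMod p)) =
    LinearMap.range (ExteriorAlgebra.ι (ZMod p)) * ⋀[ZMod p]^k (Fin n → ZMod p) := pow_succ' _ _

theorem partialX_mem_exteriorPower (i : Fin n) (k : ℕ) {e : E p n}
    (he : e ∈ ⋀[ZMod p]^(k + 1) (Fin n → ZMod p)) :
    partialX i e ∈ ⋀[ZMod p]^k (Fin n → ZMod p) := by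
  induction k generalizing e with
  | zero =>
    rw [exteriorPower_succ, exteriorPower_zero, mul_one] at he
    obtain ⟨v, rfl⟩ := he
    rw [exteriorPower_zero]
    rw [Submodule.mem_one]
    exact ⟨v i, (CliffordAlgebra.contractLeft_ι (Q := 0) (LinearMap.proj i) v).symm⟩
  | succ k ih =>
    rw [exteriorPower_succ] at he
    refine Submodule.mul_induction_on he ?_ ?_
    · rintro _ ⟨v, rfl⟩ a ha
      have h := CliffordAlgebra.contractLeft_ι_mul (Q := (0 : QuadraticForm (ZMod p)
        (Fin n → ZMod p))) (d := LinearMap.proj i) v a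
      change partialX i (ExteriorAlgebra.ι (ZMod p) v * a) ∈ _
      have h' : partialX i (ExteriorAlgebra.ι (ZMod p) v * a) =
        v i • a - ExteriorAlgebra.ι (ZMod p) v * partialX i a := h
      rw [h']
      refine sub_mem (Submodule.smul_mem _ _ ha) ?_
      rw [exteriorPower_succ]
      exact Submodule.mul_mem_mul ⟨v, rfl⟩ (ih ha)
    · intro a b ha hb
      rw [map_add]
      exact add_mem ha hb

theorem partialX_exteriorPower_zero (i : Fin n) {e : E p n}
    (he : e ∈ ⋀[ZMod p]^0 (Fin n → ZMod p)) : partialX i e = 0 := by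
  rw [exteriorPower_zero] at he
  obtain ⟨r, rfl⟩ := Submodule.mem_one.1 he
  rw [partialX, CliffordAlgebra.contractLeft_algebraMap]

theorem algebraMapInv_exteriorPower_succ {k : ℕ} {e : E p n}
    (he : e ∈ ⋀[ZMod p]^(k + 1) (Fin n → ZMod p)) : ExteriorAlgebra.algebraMapInv e = 0 := by
  rw [exteriorPower_succ] at he
  refine Submodule.mul_induction_on he ?_ ?_
  · rintro _ ⟨v, rfl⟩ a _
    rw [map_mul]
    simp [ExteriorAlgebra.algebraMapInv]
  · intro a b ha hb
    rw [map_add, ha, hb, add_zero]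

/-- The space of polynomials of degree `j` with `m + 2 j = k`. -/
def coeffDegree (p n m k : ℕ) : Submodule (ZMod p) (P p n) :=
  Submodule.span (ZMod p) {f | ∃ j, m + 2 * j = k ∧ f.IsHomogeneous j}

theorem isHomogeneous_of_mem_coeffDegree {m k j : ℕ} (h : m + 2 * j = k) {f : P p n}
    (hf : f ∈ coeffDegree p n m k) : f.IsHomogeneous j := by
  rw [← MvPolynomial.mem_homogeneousSubmodule]
  refine Submodule.span_le.2 ?_ hf
  rintro f ⟨j', h', hf⟩
  obtain rfl : j = j' := by omega
  exact hf

theorem exists_of_mem_coeffDegree {m k : ℕ} {f : P p n}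
    (hf : f ∈ coeffDegree p n m k) (h0 : f ≠ 0) : ∃ j, m + 2 * j = k ∧ f.IsHomogeneous j := by
  by_cases h : ∃ j, m + 2 * j = k
  · obtain ⟨j, h⟩ := h
    exact ⟨j, h, isHomogeneous_of_mem_coeffDegree h hf⟩
  · refine absurd ?_ h0
    have : {f : P p n | ∃ j, m + 2 * j = k ∧ f.IsHomogeneous j} = ∅ := by
      ext f
      simp only [Set.mem_ofPred_eq, Set.mem_empty_iff_false, iff_false]
      rintro ⟨j, hj, _⟩
      exact h ⟨j, hj⟩
    rw [coeffDegree, this, Submodule.span_empty] at hf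
    exact hf

theorem degreePart_induction {k : ℕ} {N : Submodule (ZMod p) (H p n)}
    (h : ∀ (i j : ℕ) (e : E p n) (f : P p n), i + 2 * j = k →
      e ∈ (⋀[ZMod p]^i (Fin n → ZMod p)) → f.IsHomogeneous j → tensor e f ∈ N) :
    degreePart p n k ≤ N := by
  refine Submodule.span_le.2 ?_
  rintro _ ⟨i, j, e, f, hk, he, hf, rfl⟩
  exact h i j e f hk he hf

theorem tensor_mem_degreePart {i j k : ℕ} {e : E p n} {f : P p n} (hk : i + 2 * j = k)
    (he : e ∈ (⋀[ZMod p]^i (Fin n → ZMod p))) (hf : f.IsHomogeneous j) :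
    tensor e f ∈ degreePart p n k :=
  Submodule.subset_span ⟨i, j, e, f, hk, he, hf, rfl⟩

theorem pderivX_mem_degreePart (i : Fin n) {k : ℕ} {z : H p n}
    (hz : z ∈ degreePart p n (k + 1)) : pderivX i z ∈ degreePart p n k := by
  refine degreePart_induction (N := (degreePart p n k).comap (pderivX i)) ?_ hz
  intro i' j e f hk he hf
  rw [Submodule.mem_comap, pderivX_tensor]
  cases i' with
  | zero => rw [partialX_exteriorPower_zero i he, tensor_zero_left]; exact zero_mem _
  | succ i' => exact tensor_mem_degreePart (by omega) (partialX_mem_exteriorPower i i' he) hf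

theorem pderivX_degreePart_zero (i : Fin n) {z : H p n}
    (hz : z ∈ degreePart p n 0) : pderivX i z = 0 := by
  refine degreePart_induction (N := LinearMap.ker (pderivX i)) ?_ hz
  intro i' j e f hk he hf
  obtain rfl : i' = 0 := by omega
  rw [LinearMap.mem_ker, pderivX_tensor, partialX_exteriorPower_zero i he, tensor_zero_left]

theorem polyPart_mem_coeffDegree {k : ℕ} {z : H p n} (hz : z ∈ degreePart p n k) :
    polyPart z ∈ coeffDegree p n 0 k := by
  refine degreePart_induction (N := (coeffDegree p n 0 k).comap polyPart) ?_ hz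
  intro i' j e f hk he hf
  rw [Submodule.mem_comap, polyPart_tensor]
  cases i' with
  | zero => exact Submodule.smul_mem _ _ (Submodule.subset_span ⟨j, by omega, hf⟩)
  | succ i' => rw [algebraMapInv_exteriorPower_succ he, zero_smul]; exact zero_mem _

theorem pderivList_mem_degreePart (S : List (Fin n)) {k : ℕ} {z : H p n}
    (hz : z ∈ degreePart p n (S.length + k)) : pderivList S z ∈ degreePart p n k := by
  induction S generalizing k with
  | nil => rw [List.length_nil, zero_add] at hz; exact hz
  | cons s S ih =>
    exact pderivX_mem_degreePart s (ih (by rw [List.length_cons] at hz; rwa [add_comm k, ← add_assoc]))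

theorem pderivList_eq_zero_of_lt (S : List (Fin n)) {k : ℕ} (hk : k < S.length) {z : H p n}
    (hz : z ∈ degreePart p n k) : pderivList S z = 0 := by
  induction S with
  | nil => simp at hk
  | cons s S ih =>
    rw [pderivList_cons]
    rcases Nat.lt_succ_iff_lt_or_eq.1 hk with h | h
    · rw [ih h, map_zero]
    · exact pderivX_degreePart_zero s (pderivList_mem_degreePart S (k := 0) (by simpa [← h]))

theorem coeffX_mem_coeffDegree (S : List (Fin n)) {k : ℕ} {z : H p n}
    (hz : z ∈ degreePart p n k) : coeffX S z ∈ coeffDegree p n S.length k := by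
  rw [coeffX, LinearMap.comp_apply]
  rcases lt_or_ge k S.length with h | h
  · rw [pderivList_eq_zero_of_lt S h hz, map_zero]; exact zero_mem _
  · obtain ⟨m, rfl⟩ := Nat.exists_eq_add_of_le h
    have := polyPart_mem_coeffDegree (pderivList_mem_degreePart S hz)
    refine Submodule.span_mono ?_ this
    rintro f ⟨j, hj, hf⟩
    exact ⟨j, by omega, hf⟩

theorem exists_coeffX_ne_zero {k : ℕ} {z : H p n} (hz : z ∈ degreePart p n k) (h0 : z ≠ 0) :
    ∃ (S : List (Fin n)) (j : ℕ), S.Nodup ∧ S.length + 2 * j = k ∧ coeffX S z ≠ 0 ∧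
      (coeffX S z).IsHomogeneous j := by
  by_contra! h
  refine h0 (eq_zero_of_coeffX_eq_zero fun S => ?_)
  by_contra hS
  obtain ⟨j, hj, hh⟩ := exists_of_mem_coeffDegree (coeffX_mem_coeffDegree S hz) hS
  exact h S j (nodup_of_coeffX_ne_zero hS) hj hS hh

/-! ### The grading -/

theorem map_mem_exteriorPower (g : (Fin n → ZMod p) →ₗ[ZMod p] (Fin n → ZMod p)) {k : ℕ} {e : E p n}
    (he : e ∈ ⋀[ZMod p]^k (Fin n → ZMod p)) :
    ExteriorAlgebra.map g e ∈ ⋀[ZMod p]^k (Fin n → ZMod p) := by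
  induction k generalizing e with
  | zero =>
    rw [exteriorPower_zero] at he ⊢
    obtain ⟨r, rfl⟩ := Submodule.mem_one.1 he
    rw [AlgHom.commutes]
    exact Submodule.mem_one.2 ⟨r, rfl⟩
  | succ k ih =>
    rw [exteriorPower_succ] at he ⊢
    refine Submodule.mul_induction_on he ?_ ?_
    · rintro _ ⟨v, rfl⟩ a ha
      rw [map_mul, ExteriorAlgebra.map_apply_ι]
      exact Submodule.mul_mem_mul ⟨_, rfl⟩ (ih ha)
    · intro a b ha hb
      rw [map_add]
      exact add_mem ha hb

theorem polyAct_isHomogeneous (g : Matrix (Fin n) (Fin n) (ZMod p)) {f : P p n} {j : ℕ}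
    (hf : f.IsHomogeneous j) : (polyAct g f).IsHomogeneous j := by
  have := hf.aeval (fun j => ∑ i, g i j • (MvPolynomial.X i : P p n)) (n := 1) fun j =>
    MvPolynomial.IsHomogeneous.sum _ _ _ fun i _ => by
      rw [MvPolynomial.smul_eq_C_mul]
      exact (MvPolynomial.isHomogeneous_X _ _).C_mul _
  rwa [one_mul] at this

theorem act_mem_degreePart (g : Matrix (Fin n) (Fin n) (ZMod p)) {k : ℕ} {z : H p n}
    (hz : z ∈ degreePart p n k) : act g z ∈ degreePart p n k := by
  refine degreePart_induction (N := (degreePart p n k).comap (act g).toLinearMap) ?_ hz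
  intro i j e f hk he hf
  exact tensor_mem_degreePart hk (map_mem_exteriorPower _ he) (polyAct_isHomogeneous g hf)

theorem iSup_degreePart : ⨆ k, degreePart p n k = ⊤ := by
  refine eq_top_iff.2 fun z _ => ?_
  induction z using tensor_induction with
  | zero => exact zero_mem _
  | tensor e f =>
    have he : e ∈ ⨆ i : ℕ, ⋀[ZMod p]^i (Fin n → ZMod p) := by
      rw [(DirectSum.Decomposition.isInternal
        (fun i : ℕ => ⋀[ZMod p]^i (Fin n → ZMod p))).submodule_iSup_eq_top]
      trivial
    let T : E p n →ₗ[ZMod p] H p n := (TensorProduct.mk (ZMod p) (E p n) (P p n)).flip f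
    suffices h : ⨆ i : ℕ, ⋀[ZMod p]^i (Fin n → ZMod p) ≤ (⨆ k, degreePart p n k).comap T from h he
    refine iSup_le fun i e he => ?_
    change tensor e f ∈ ⨆ k, degreePart p n k
    rw [← MvPolynomial.sum_homogeneousComponent f, tensor_sum_right]
    refine sum_mem fun j _ => Submodule.mem_iSup_of_mem (i + 2 * j) ?_
    exact tensor_mem_degreePart rfl he (MvPolynomial.homogeneousComponent_isHomogeneous _ _)
  | add a b ha hb => exact add_mem (ha trivial) (hb trivial)

/-- The coefficient at `S` of an element of degree `k` is homogeneous of degree `(k - |S|) / 2`, so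
different `k` give different polynomial degrees and cannot cancel. -/
theorem eq_zero_of_sum_degreePart_eq_zero {s : Finset ℕ} {z : ℕ → H p n}
    (hz : ∀ k ∈ s, z k ∈ degreePart p n k) (h : ∑ k ∈ s, z k = 0) {k : ℕ} (hk : k ∈ s) :
    z k = 0 := by
  refine eq_zero_of_coeffX_eq_zero fun S => ?_
  by_contra hS
  obtain ⟨j, hj, hh⟩ := exists_of_mem_coeffDegree (coeffX_mem_coeffDegree S (hz k hk)) hS
  have h1 := congrArg (fun w => MvPolynomial.homogeneousComponent j (coeffX S w)) h
  simp only [map_sum, map_zero] at h1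
  rw [Finset.sum_eq_single k, MvPolynomial.homogeneousComponent_eq_self hh] at h1
  · exact hS h1
  · intro k' hk' hne
    by_cases h0 : coeffX S (z k') = 0
    · rw [h0, map_zero]
    · obtain ⟨j', hj', hh'⟩ := exists_of_mem_coeffDegree (coeffX_mem_coeffDegree S (hz k' hk')) h0
      rw [MvPolynomial.homogeneousComponent_of_mem hh', if_neg]
      omega
  · intro h
    exact absurd hk h

theorem exists_eq_sum_degreePart (z : H p n) :
    ∃ (s : Finset ℕ) (w : ℕ → H p n), (∀ k, w k ∈ degreePart p n k) ∧ z = ∑ k ∈ s, w k := by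
  have hz : z ∈ ⨆ k, degreePart p n k := by rw [iSup_degreePart]; trivial
  obtain ⟨w, hw, rfl⟩ := (Submodule.mem_iSup_iff_exists_finsupp _ _).1 hz
  exact ⟨w.support, w, hw, rfl⟩

theorem mem_D [Fact p.Prime] {z : H p n} : z ∈ D p n ↔
    ∀ g : GL (Fin n) (ZMod p), act (g : Matrix (Fin n) (Fin n) (ZMod p)) z = z :=
  mem_dicksonSubalgebra

theorem D_coe_sum [Fact p.Prime] (s : Finset ℕ) (w : ℕ → D p n) :
    ((∑ k ∈ s, w k : D p n) : H p n) = ∑ k ∈ s, (w k : H p n) :=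
  map_sum (D p n).subtype w s

/-- Substitutions preserve degrees and the degree parts are independent, so the homogeneous
components of an invariant are invariant. -/
theorem exists_eq_sum_DDegree [Fact p.Prime] (z : D p n) :
    ∃ (s : Finset ℕ) (w : ℕ → D p n), (∀ k, w k ∈ DDegree p n k) ∧ z = ∑ k ∈ s, w k := by
  classical
  obtain ⟨s, w, hw, hz⟩ := exists_eq_sum_degreePart (z : H p n)
  have hD : ∀ k ∈ s, w k ∈ D p n := by
    intro k hk
    refine mem_D.2 fun g => ?_
    have h := mem_D.1 z.2 g
    rw [hz, map_sum, ← sub_eq_zero, ← Finset.sum_sub_distrib] at h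
    exact sub_eq_zero.1 (eq_zero_of_sum_degreePart_eq_zero
      (fun k _ => sub_mem (act_mem_degreePart _ (hw k)) (hw k)) h hk)
  refine ⟨s, fun k => if hk : k ∈ s then ⟨w k, hD k hk⟩ else 0, fun k => ?_, ?_⟩
  · by_cases hk : k ∈ s
    · simp only [hk, dite_true]
      exact hw k
    · simp only [hk, dite_false]
      exact zero_mem _
  · refine Subtype.ext ?_
    rw [D_coe_sum, hz]
    refine Finset.sum_congr rfl fun k hk => ?_
    simp only [hk, dite_true]

theorem eq_zero_of_sum_DDegree_eq_zero [Fact p.Prime] {s : Finset ℕ} {z : ℕ → D p n}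
    (hz : ∀ k ∈ s, z k ∈ DDegree p n k) (h : ∑ k ∈ s, z k = 0) {k : ℕ} (hk : k ∈ s) :
    z k = 0 := by
  refine Subtype.ext (eq_zero_of_sum_degreePart_eq_zero (z := fun k => (z k : H p n)) hz ?_ hk)
  rw [← D_coe_sum, h]
  rfl

/-- The coefficients at the finitely many lists without repetition determine an element, and they
lie in a finite space of polynomials of bounded degree. -/
theorem degreePart_finite [Fact p.Prime] (k : ℕ) : (degreePart p n k : Set (H p n)).Finite := by
  have hfin : Finite (MvPolynomial.restrictTotalDegree (Fin n) (ZMod p) k) :=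
    Module.finite_of_finite (ZMod p)
  have hdeg : ∀ (S : List (Fin n)) (z : degreePart p n k),
      coeffX S (z : H p n) ∈ MvPolynomial.restrictTotalDegree (Fin n) (ZMod p) k := by
    intro S z
    rw [MvPolynomial.mem_restrictTotalDegree]
    by_cases h0 : coeffX S (z : H p n) = 0
    · rw [h0, MvPolynomial.totalDegree_zero]; exact Nat.zero_le _
    · obtain ⟨j, hj, hh⟩ := exists_of_mem_coeffDegree (coeffX_mem_coeffDegree S z.2) h0
      exact hh.totalDegree_le.trans (by omega)
  let Φ : degreePart p n k → ({S : List (Fin n) // S.Nodup} →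
      MvPolynomial.restrictTotalDegree (Fin n) (ZMod p) k) :=
    fun z S => ⟨coeffX S.1 (z : H p n), hdeg S.1 z⟩
  have hΦ : Function.Injective Φ := by
    intro z z' h
    refine Subtype.ext (eq_of_coeffX_eq fun S => ?_)
    by_cases hS : S.Nodup
    · exact congrArg Subtype.val (congrFun h ⟨S, hS⟩)
    · rw [not_not.1 (mt nodup_of_coeffX_ne_zero hS), not_not.1 (mt nodup_of_coeffX_ne_zero hS)]
  exact Set.finite_coe_iff.1 (Finite.of_injective Φ hΦ)

theorem DDegree_finite [Fact p.Prime] (k : ℕ) : (DDegree p n k : Set (D p n)).Finite :=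
  Set.Finite.preimage (f := fun z : D p n => (z : H p n)) Subtype.val_injective.injOn
    (degreePart_finite k)

theorem eq_smul_one_of_mem_degreePart_zero {z : H p n} (hz : z ∈ degreePart p n 0) :
    ∃ c : ZMod p, z = c • tensor 1 1 := by
  refine (Submodule.mem_span_singleton.1 (degreePart_induction
    (N := Submodule.span (ZMod p) {tensor 1 1}) ?_ hz)).imp fun _ => Eq.symm
  intro i j e f hk he hf
  obtain rfl : i = 0 := by omega
  obtain rfl : j = 0 := by omega
  rw [exteriorPower_zero] at he
  obtain ⟨r, rfl⟩ := Submodule.mem_one.1 he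
  have hf' := (MvPolynomial.totalDegree_eq_zero_iff_eq_C).1 (Nat.le_zero.1 hf.totalDegree_le)
  rw [hf', Algebra.algebraMap_eq_smul_one, tensor_smul_left,
    ← MvPolynomial.algebraMap_eq, Algebra.algebraMap_eq_smul_one, tensor_smul_right, smul_smul]
  exact Submodule.smul_mem _ _ (Submodule.mem_span_singleton_self _)

theorem tensor_one_injective : Function.Injective (tensor 1 : P p n → H p n) := by
  intro f f' h
  have := congrArg polyPart h
  simpa only [polyPart_tensor, map_one, one_smul] using this

/-! ### Moore determinants -/

/-- The matrix with entries `yⱼ ^ p ^ gᵢ`. -/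
def mooreMatrix (p : ℕ) {n : ℕ} (g : Fin n → ℕ) : Matrix (Fin n) (Fin n) (P p n) :=
  Matrix.of fun i j => MvPolynomial.X j ^ p ^ g i

/-- Distinct permutations contribute distinct monomials because the exponents `p ^ gᵢ` are distinct,
so the diagonal monomial has coefficient `1`. -/
theorem mooreMatrix_det_ne_zero [Fact p.Prime] {g : Fin n → ℕ} (hg : Function.Injective g) :
    (mooreMatrix p g).det ≠ 0 := by
  classical
  let m : (Fin n → ℕ) → (Fin n →₀ ℕ) := fun a => Finsupp.equivFunOnFinite.symm fun j => p ^ a j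
  have hm : ∀ σ : Equiv.Perm (Fin n), ∏ j, mooreMatrix p g (σ j) j =
      MvPolynomial.monomial (m (g ∘ σ)) 1 := by
    intro σ
    rw [MvPolynomial.monomial_eq, Finsupp.prod_fintype _ _ (by simp), map_one, one_mul]
    rfl
  intro h0
  have h1 := congrArg (MvPolynomial.coeff (m g)) h0
  rw [Matrix.det_apply, MvPolynomial.coeff_sum, Finset.sum_eq_single 1] at h1
  · rw [hm, Equiv.Perm.sign_one, one_smul, Equiv.Perm.coe_one, Function.comp_id,
      MvPolynomial.coeff_monomial, if_pos rfl] at h1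
    simp at h1
  · intro σ _ hσ
    rw [hm, Units.smul_def, MvPolynomial.coeff_smul, MvPolynomial.coeff_monomial, if_neg, smul_zero]
    intro h
    refine hσ (Equiv.ext fun j => hg ?_)
    have := DFunLike.congr_fun h j
    exact Nat.pow_right_injective (Fact.out : p.Prime).two_le this
  · simp

theorem mooreMatrix_det_isHomogeneous (g : Fin n → ℕ) :
    (mooreMatrix p g).det.IsHomogeneous (∑ i, p ^ g i) := by
  rw [Matrix.det_apply]
  refine MvPolynomial.IsHomogeneous.sum _ _ _ fun σ _ => ?_
  rw [Units.smul_def, ← Int.cast_smul_eq_zsmul (ZMod p), MvPolynomial.smul_eq_C_mul]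
  refine MvPolynomial.IsHomogeneous.C_mul ?_ _
  rw [← Equiv.sum_comp σ]
  refine MvPolynomial.IsHomogeneous.prod _ _ _ fun j _ => ?_
  exact MvPolynomial.isHomogeneous_X_pow _ _

/-! ### The Milnor primitives -/

theorem polyPower_zero (f : P p n) : polyPower p n 0 f = f := by
  have h : ((Polynomial.aeval (0 : P p n)).restrictScalars (ZMod p)).comp (totalPower p n) =
      AlgHom.id (ZMod p) (P p n) := by
    apply MvPolynomial.algHom_ext
    intro j
    simp [totalPower]
  have h' := DFunLike.congr_fun h f
  have h'' : Polynomial.eval 0 (totalPower p n f) = f := by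
    rw [← Polynomial.coe_aeval_eq_eval]; exact h'
  rw [← Polynomial.coeff_zero_eq_eval_zero] at h''
  exact h''

theorem totalPower_X_pow [Fact p.Prime] (j : Fin n) (i : ℕ) :
    totalPower p n (MvPolynomial.X j ^ p ^ i) = Polynomial.C (MvPolynomial.X j ^ p ^ i) +
      Polynomial.C (MvPolynomial.X j ^ p ^ (i + 1)) * Polynomial.X ^ p ^ i := by
  rw [map_pow, totalPower, MvPolynomial.aeval_X, add_pow_char_pow, mul_pow, ← Polynomial.C_pow,
    ← Polynomial.C_pow, ← pow_mul, pow_succ' p i]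

theorem polyPower_X_pow_mul [Fact p.Prime] (j : Fin n) (i : ℕ) (f : P p n) :
    polyPower p n (p ^ i) (MvPolynomial.X j ^ p ^ i * f) =
      MvPolynomial.X j ^ p ^ i * polyPower p n (p ^ i) f + MvPolynomial.X j ^ p ^ (i + 1) * f := by
  have h0 := polyPower_zero f
  simp only [polyPower, LinearMap.comp_apply, AlgHom.toLinearMap_apply,
    LinearMap.restrictScalars_apply, Polynomial.lcoeff_apply] at h0 ⊢
  rw [map_mul, totalPower_X_pow, add_mul, Polynomial.coeff_add, Polynomial.coeff_C_mul, mul_assoc,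
    Polynomial.coeff_C_mul, mul_comm (Polynomial.X ^ _), Polynomial.coeff_mul_X_pow', if_pos le_rfl,
    Nat.sub_self, h0]

/-- The Milnor primitive `Qᵢ`: the antiderivation with `xⱼ ↦ yⱼ ^ p ^ i` and `yⱼ ↦ 0`. -/
def milnor (p n i : ℕ) : Module.End (ZMod p) (H p n) :=
  ∑ j : Fin n, polyMul (MvPolynomial.X j ^ p ^ i) * pderivX j

theorem milnor_apply (i : ℕ) (z : H p n) :
    milnor p n i z = ∑ j : Fin n, polyMul (MvPolynomial.X j ^ p ^ i) (pderivX j z) := by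
  rw [milnor, LinearMap.sum_apply]
  rfl

theorem milnor_zero : milnor p n 0 = bockstein p n := by
  refine tensor_ext fun e f => ?_
  rw [milnor_apply, bockstein_tensor]
  refine Finset.sum_congr rfl fun j _ => ?_
  rw [pderivX_tensor, polyMul_tensor, pow_zero, pow_one]

/-- Milnor's recursion `Qᵢ₊₁ = [P^{pⁱ}, Qᵢ]`. The total power of `yⱼ ^ p ^ i` has only the terms in
`T⁰` and `T ^ p ^ i`, so moving `P^{pⁱ}` past multiplication by `yⱼ ^ p ^ i` leaves the single
correction `yⱼ ^ p ^ (i + 1)`. It follows that spaces stable under the Steenrod operations are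
stable under all `Qᵢ`. -/
theorem milnor_succ [Fact p.Prime] (i : ℕ) : milnor p n (i + 1) =
    power p n (p ^ i) * milnor p n i - milnor p n i * power p n (p ^ i) := by
  refine tensor_ext fun e f => ?_
  rw [LinearMap.sub_apply, Module.End.mul_apply, Module.End.mul_apply, power_tensor]
  simp only [milnor_apply, map_sum, pderivX_tensor, polyMul_tensor, power_tensor,
    polyPower_X_pow_mul, tensor_add_right, Finset.sum_add_distrib]
  abel

theorem polyMul_mem_degreePart {q : P p n} {d k : ℕ} (hq : q.IsHomogeneous d) {z : H p n}
    (hz : z ∈ degreePart p n k) : polyMul q z ∈ degreePart p n (k + 2 * d) := by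
  refine degreePart_induction (N := (degreePart p n (k + 2 * d)).comap (polyMul q)) ?_ hz
  intro i j e f hk he hf
  exact tensor_mem_degreePart (j := d + j) (by omega) he (hq.mul hf)

theorem milnor_mem_degreePart (i : ℕ) {k : ℕ} {z : H p n} (hz : z ∈ degreePart p n (k + 1)) :
    milnor p n i z ∈ degreePart p n (k + 2 * p ^ i) := by
  rw [milnor_apply]
  exact sum_mem fun j _ => polyMul_mem_degreePart (MvPolynomial.isHomogeneous_X_pow _ _)
    (pderivX_mem_degreePart j hz)

/-- Cramer's rule: `Q₀, …, Qₙ₋₁` are obtained from the `∂/∂xⱼ` by the Moore matrix, and the adjugate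
inverts this up to the determinant. -/
theorem polyMul_det_pderivX (z : H p n) (k : Fin n) :
    polyMul (mooreMatrix p fun i : Fin n => (i : ℕ)).det (pderivX k z) =
      ∑ i : Fin n, polyMul ((mooreMatrix p fun i : Fin n => (i : ℕ)).adjugate k i)
        (milnor p n i z) := by
  set M := mooreMatrix p fun i : Fin n => (i : ℕ)
  simp only [milnor_apply, map_sum, ← polyMul_mul]
  rw [Finset.sum_comm]
  have : ∀ j, ∑ i : Fin n, polyMul (M.adjugate k i * MvPolynomial.X j ^ p ^ (i : ℕ)) (pderivX j z) =
      if k = j then polyMul M.det (pderivX k z) else 0 := by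
    intro j
    rw [← polyMul_sum]
    have h : ∑ i, M.adjugate k i * MvPolynomial.X j ^ p ^ (i : ℕ) = (M.adjugate * M) k j := by
      rw [Matrix.mul_apply]; rfl
    rw [h, Matrix.adjugate_mul, Matrix.smul_apply, Matrix.one_apply]
    split_ifs with hkj
    · rw [smul_eq_mul, mul_one, hkj]
    · rw [smul_zero, polyMul_zero]
  simp only [this, Finset.sum_ite_eq, Finset.mem_univ, if_true]

theorem pderivX_eq_zero_of_milnor [Fact p.Prime] {z : H p n} (h : ∀ i, milnor p n i z = 0)
    (k : Fin n) : pderivX k z = 0 := by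
  refine polyMul_eq_zero (mooreMatrix_det_ne_zero (p := p) Fin.val_injective) ?_
  rw [polyMul_det_pderivX]
  simp only [h, map_zero, Finset.sum_const_zero]

theorem pderivList_append (S : List (Fin n)) (j : Fin n) (z : H p n) :
    pderivList (S ++ [j]) z = pderivList S (pderivX j z) := by
  induction S with
  | nil => rfl
  | cons s S ih => rw [List.cons_append, pderivList_cons, ih, pderivList_cons]

/-- A subspace of `E ⊗ P` that is stable under the Steenrod operations and contains a nonzero
homogeneous element of positive degree contains a nonzero homogeneous polynomial of positive
degree. -/
theorem exists_polynomial_mem [Fact p.Prime] {N : Submodule (ZMod p) (H p n)}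
    (hβ : ∀ z ∈ N, bockstein p n z ∈ N) (hP : ∀ k, ∀ z ∈ N, power p n k z ∈ N)
    {k : ℕ} (hk : 0 < k) {z : H p n} (hz : z ∈ degreePart p n k) (hzN : z ∈ N) (h0 : z ≠ 0) :
    ∃ (h : P p n) (j : ℕ), tensor 1 h ∈ N ∧ h ≠ 0 ∧ h.IsHomogeneous j ∧ 0 < j := by
  have hQ : ∀ i, ∀ z ∈ N, milnor p n i z ∈ N := by
    intro i
    induction i with
    | zero => rw [milnor_zero]; exact hβ
    | succ i ih =>
      intro z hz
      rw [milnor_succ]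
      exact sub_mem (hP _ _ (ih z hz)) (ih _ (hP _ z hz))
  -- Induction on `m`, where all derivatives of length `m` vanish. Each `Qᵢ` lowers this bound by
  -- one and keeps the degree positive, since it changes the degree by `2 p ^ i - 1`. If every `Qᵢ`
  -- kills `z`, then `z` is already a polynomial.
  have key : ∀ m : ℕ, ∀ (k : ℕ) (z : H p n), 0 < k → z ∈ degreePart p n k → z ∈ N → z ≠ 0 →
      (∀ S : List (Fin n), S.length = m → pderivList S z = 0) →
      ∃ (h : P p n) (j : ℕ), tensor 1 h ∈ N ∧ h ≠ 0 ∧ h.IsHomogeneous j ∧ 0 < j := by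
    intro m
    induction m with
    | zero =>
      intro k z _ _ _ h0 hS
      exact absurd (hS [] rfl) h0
    | succ m ih =>
      intro k z hk hz hzN h0 hS
      obtain ⟨k, rfl⟩ := Nat.exists_eq_succ_of_ne_zero hk.ne'
      by_cases h : ∃ i, milnor p n i z ≠ 0
      · obtain ⟨i, hi⟩ := h
        refine ih _ _ ?_ (milnor_mem_degreePart i hz) (hQ i z hzN) hi fun S hS' => ?_
        · have := Nat.pow_pos (n := i) (Fact.out : p.Prime).pos
          omega
        · rw [milnor_apply, map_sum]
          refine Finset.sum_eq_zero fun j _ => ?_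
          rw [pderivList_polyMul, ← pderivList_append, hS _ (by simp [hS']), map_zero]
      · push Not at h
        have h1 := eq_tensor_one_polyPart z (pderivX_eq_zero_of_milnor h)
        have h2 : polyPart z ≠ 0 := fun h => h0 (by rw [h1, h, tensor_zero_right])
        obtain ⟨j, hj, hh⟩ := exists_of_mem_coeffDegree (polyPart_mem_coeffDegree hz) h2
        exact ⟨polyPart z, j, h1 ▸ hzN, h2, hh, by omega⟩
  exact key (k + 1) k z hk hz hzN h0 fun S hS => pderivList_eq_zero_of_lt S (by omega) hz

/-! ### Additive substitutions -/

/-- The extension of a linear functional on `P` to polynomials over an algebra `A`. -/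
def extFunctional (ℓ : P p n →ₗ[ZMod p] ZMod p) (A : Type*) [CommRing A] [Algebra (ZMod p) A] :
    MvPolynomial (Fin n) A →ₗ[A] A :=
  (MvPolynomial.basisMonomials (Fin n) A).constr A fun m =>
    algebraMap (ZMod p) A (ℓ (MvPolynomial.monomial m 1))

section

variable (ℓ : P p n →ₗ[ZMod p] ZMod p) (A : Type*) [CommRing A] [Algebra (ZMod p) A]

theorem extFunctional_monomial (m : Fin n →₀ ℕ) (a : A) :
    extFunctional ℓ A (MvPolynomial.monomial m a) =
      a * algebraMap (ZMod p) A (ℓ (MvPolynomial.monomial m 1)) := by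
  have h := (MvPolynomial.basisMonomials (Fin n) A).constr_basis A (fun m =>
    algebraMap (ZMod p) A (ℓ (MvPolynomial.monomial m 1))) m
  rw [MvPolynomial.coe_basisMonomials] at h
  have h1 : MvPolynomial.monomial m a = a • (MvPolynomial.monomial m (1 : A)) := by
    rw [MvPolynomial.smul_monomial, smul_eq_mul, mul_one]
  rw [h1, map_smul, smul_eq_mul, extFunctional]
  exact congrArg _ h

theorem extFunctional_map (q : P p n) :
    extFunctional ℓ A (MvPolynomial.map (algebraMap (ZMod p) A) q) =
      algebraMap (ZMod p) A (ℓ q) := by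
  induction q using MvPolynomial.induction_on' with
  | monomial m a =>
    rw [MvPolynomial.map_monomial, extFunctional_monomial,
      ← map_mul, ← smul_eq_mul, ← map_smul, MvPolynomial.smul_monomial, smul_eq_mul, mul_one]
  | add f g hf hg => rw [map_add, map_add, map_add, map_add, hf, hg]

/-- This allows the variables `tⱼ` to be specialised to points before or after applying the
functional. -/
theorem extFunctional_naturality {A B : Type*} [CommRing A] [Algebra (ZMod p) A] [CommRing B]
    [Algebra (ZMod p) B] (φ : A →+* B) (q : MvPolynomial (Fin n) A) :
    extFunctional ℓ B (MvPolynomial.map φ q) = φ (extFunctional ℓ A q) := by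
  have hφ : ∀ c : ZMod p, φ (algebraMap (ZMod p) A c) = algebraMap (ZMod p) B c := fun c =>
    RingHom.congr_fun (RingHom.ext_zmod (φ.comp (algebraMap (ZMod p) A)) (algebraMap (ZMod p) B)) c
  induction q using MvPolynomial.induction_on' with
  | monomial m a =>
    rw [MvPolynomial.map_monomial, extFunctional_monomial,
      extFunctional_monomial, map_mul, hφ]
  | add f g hf hg => rw [map_add, map_add, map_add, map_add, hf, hg]

variable {A}

/-- The substitution `yⱼ ↦ ∑ₛ rₛ yⱼ ^ p ^ s`, where `s ≤ B`. -/
def addSubst (p n : ℕ) {A : Type*} [CommRing A] [Algebra (ZMod p) A] (B : ℕ) (r : ℕ → A) :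
    P p n →ₐ[ZMod p] MvPolynomial (Fin n) A :=
  MvPolynomial.aeval fun j =>
    ∑ s ∈ Finset.range (B + 1), MvPolynomial.C (r s) * MvPolynomial.X j ^ p ^ s

theorem addSubst_congr {B : ℕ} {r r' : ℕ → A} (h : ∀ s ≤ B, r s = r' s) :
    addSubst p n B r = addSubst p n B r' := by
  unfold addSubst
  congr 1
  funext j
  refine Finset.sum_congr rfl fun s hs => ?_
  rw [h s (Nat.lt_succ_iff.1 (Finset.mem_range.1 hs))]

theorem addSubst_zero {r : ℕ → A} (h : r 0 = 1) (z : P p n) :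
    addSubst p n 0 r z = MvPolynomial.map (algebraMap (ZMod p) A) z := by
  have : (addSubst p n 0 r : P p n →+* MvPolynomial (Fin n) A) =
      MvPolynomial.map (algebraMap (ZMod p) A) := by
    refine MvPolynomial.ringHom_ext' (RingHom.ext_zmod _ _) fun j => ?_
    simp [addSubst, h]
  exact RingHom.congr_fun this z

theorem map_addSubst {A' : Type*} [CommRing A'] [Algebra (ZMod p) A'] (φ : A →+* A') (B : ℕ)
    (r : ℕ → A) (z : P p n) :
    MvPolynomial.map φ (addSubst p n B r z) = addSubst p n B (fun s => φ (r s)) z := by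
  have : (MvPolynomial.map φ).comp (addSubst p n B r : P p n →+* MvPolynomial (Fin n) A) =
      addSubst p n B fun s => φ (r s) := by
    refine MvPolynomial.ringHom_ext' (RingHom.ext_zmod _ _) fun j => ?_
    simp [addSubst]
  exact RingHom.congr_fun this z

/-- Substituting into `yⱼ + T yⱼ ^ p` gives an additive substitution again, because the `p`-th power
is additive: the coefficient of `yⱼ ^ p ^ s` becomes `rₛ + T rₛ₋₁ ^ p`. The vanishing of `r (B + 1)`
makes the truncation at `B` harmless. -/
theorem eval₂_totalPower [Fact p.Prime] [CharP A p] (B : ℕ) {r : ℕ → A} (h : r (B + 1) = 0)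
    (T : A) (z : P p n) :
    Polynomial.eval₂ (addSubst p n B r : P p n →+* MvPolynomial (Fin n) A) (MvPolynomial.C T)
      (totalPower p n z) =
    addSubst p n (B + 1) (fun s => r s + if s = 0 then 0 else T * r (s - 1) ^ p) z := by
  have : (Polynomial.eval₂RingHom (addSubst p n B r : P p n →+* MvPolynomial (Fin n) A)
      (MvPolynomial.C T)).comp (totalPower p n : P p n →+* Polynomial (P p n)) =
      (addSubst p n (B + 1) (fun s => r s + if s = 0 then 0 else T * r (s - 1) ^ p) :
        P p n →+* MvPolynomial (Fin n) A) := by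
    refine MvPolynomial.ringHom_ext' (RingHom.ext_zmod _ _) fun j => ?_
    have hj : addSubst p n B r (MvPolynomial.X j) = ∑ s ∈ Finset.range (B + 1),
      MvPolynomial.C (r s) * MvPolynomial.X j ^ p ^ s := by simp [addSubst]
    have h1 : (totalPower p n (MvPolynomial.X j)) = Polynomial.C (MvPolynomial.X j) +
        Polynomial.C (MvPolynomial.X j ^ p) * Polynomial.X := by simp [totalPower]
    rw [RingHom.comp_apply]
    change Polynomial.eval₂ _ _ (totalPower p n (MvPolynomial.X j)) =
      addSubst p n (B + 1) _ (MvPolynomial.X j)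
    rw [h1, Polynomial.eval₂_add, Polynomial.eval₂_mul, Polynomial.eval₂_C, Polynomial.eval₂_C,
      Polynomial.eval₂_X, map_pow]
    change addSubst p n B r (MvPolynomial.X j) + addSubst p n B r (MvPolynomial.X j) ^ p * _ = _
    rw [hj, sum_pow_char, addSubst, MvPolynomial.aeval_X]
    simp only [map_add, add_mul, Finset.sum_add_distrib]
    congr 1
    · rw [Finset.sum_range_succ _ (B + 1), h, map_zero, zero_mul, add_zero]
    · rw [Finset.sum_range_succ' _ (B + 1), if_pos rfl, map_zero, zero_mul, add_zero,
        Finset.sum_mul]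
      refine Finset.sum_congr rfl fun s _ => ?_
      rw [if_neg (Nat.succ_ne_zero s), Nat.add_sub_cancel, mul_pow, ← pow_mul, ← pow_succ,
        map_mul, map_pow]
      ring
  exact RingHom.congr_fun this z

end

/-! ### Functionals that vanish on a space stable under the reduced powers -/

section

variable {ℓ : P p n →ₗ[ZMod p] ZMod p} {N : Submodule (ZMod p) (P p n)}

/-- A functional that vanishes on a space of polynomials stable under the reduced powers vanishes
on the additive substitutions with leading coefficient `1` of its elements. -/
theorem extFunctional_addSubst_eq_zero_of_one [Fact p.Prime] {K : Type*} [Field K] [IsAlgClosed K]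
    [Algebra (ZMod p) K] (hN : ∀ k, ∀ z ∈ N, polyPower p n k z ∈ N) (hℓ : ∀ z ∈ N, ℓ z = 0)
    (B : ℕ) {r : ℕ → K} (hr : r 0 = 1) {z : P p n} (hz : z ∈ N) :
    extFunctional ℓ K (addSubst p n B r z) = 0 := by
  have : CharP K p := charP_of_injective_algebraMap (algebraMap (ZMod p) K).injective p
  have hp : p ≠ 0 := (Fact.out : p.Prime).ne_zero
  induction B generalizing r z with
  | zero => rw [addSubst_zero hr, extFunctional_map, hℓ z hz, map_zero]
  | succ B ih =>
    -- The `q s` solve `rₛ = qₛ + T qₛ₋₁ ^ p` with `q₀ = 1` and `T` an indeterminate. At a root `T`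
    -- of `q (B + 1)` the substitution `r` is a total power followed by a substitution with one term
    -- fewer, to which the induction applies.
    let q : ℕ → Polynomial K := fun s =>
      Nat.rec 1 (fun s q => Polynomial.C (r (s + 1)) - Polynomial.X * q ^ p) s
    have hq : ∀ s, q (s + 1) = Polynomial.C (r (s + 1)) - Polynomial.X * q s ^ p := fun s => rfl
    have hdeg : ∀ s, q s ≠ 0 → 0 < (q (s + 1)).natDegree := by
      intro s hs
      have h1 : 0 < (Polynomial.X * q s ^ p).natDegree := by
        rw [Polynomial.natDegree_X_mul (pow_ne_zero _ hs)]
        exact Nat.succ_pos _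
      rw [hq, Polynomial.natDegree_sub, Polynomial.natDegree_sub_C]
      exact h1
    have hne : ∀ s, q s ≠ 0 := by
      intro s
      induction s with
      | zero => exact one_ne_zero
      | succ s ih' =>
        intro h0
        have := hdeg s ih'
        rw [h0, Polynomial.natDegree_zero] at this
        exact lt_irrefl _ this
    obtain ⟨T, hT⟩ := IsAlgClosed.exists_root (q (B + 1))
      (Polynomial.degree_ne_of_natDegree_ne (hdeg B (hne B)).ne')
    let r' : ℕ → K := fun s => (q s).eval T
    have hr' : r' 0 = 1 := Polynomial.eval_one
    have hrr : addSubst p n (B + 1) r =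
        addSubst p n (B + 1) (fun s => r' s + if s = 0 then 0 else T * r' (s - 1) ^ p) := by
      refine addSubst_congr fun s _ => ?_
      cases s with
      | zero => rw [if_pos rfl, add_zero, hr', hr]
      | succ s =>
        rw [if_neg (Nat.succ_ne_zero s), Nat.add_sub_cancel]
        simp only [r', hq, Polynomial.eval_sub, Polynomial.eval_C, Polynomial.eval_mul,
          Polynomial.eval_X, Polynomial.eval_pow]
        ring
    -- The expansion in powers of `T` has as coefficients the substitutions in the elements `Pᵏ z`
    -- of `N`.
    rw [hrr, ← eval₂_totalPower B (r := r') hT T z, Polynomial.eval₂_eq_sum_range, map_sum]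
    refine Finset.sum_eq_zero fun k _ => ?_
    rw [← map_pow, mul_comm, ← MvPolynomial.smul_eq_C_mul, map_smul]
    have h := ih hr' (hN k z hz)
    change T ^ k • extFunctional ℓ K (addSubst p n B r' (polyPower p n k z)) = 0
    rw [h, smul_zero]

theorem aeval_smul_of_isHomogeneous {A : Type*} [CommRing A] [Algebra (ZMod p) A] {z : P p n}
    {d : ℕ} (hz : z.IsHomogeneous d) (c : A) (v : Fin n → A) :
    MvPolynomial.aeval (fun j => c * v j) z = c ^ d * MvPolynomial.aeval v z := by
  rw [MvPolynomial.aeval_def, MvPolynomial.aeval_def, MvPolynomial.eval₂_eq, MvPolynomial.eval₂_eq,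
    Finset.mul_sum]
  refine Finset.sum_congr rfl fun m hm => ?_
  have hd : ∑ i ∈ m.support, m i = d := by
    have := hz.degree_eq_sum_deg_support hm
    rw [this]
  simp only [mul_pow, Finset.prod_mul_distrib, Finset.prod_pow_eq_pow_sum, hd]
  ring

/-- Homogeneity of `z` allows the scalar `r 0` to be factored out, which reduces to the leading
coefficient `1`. -/
theorem extFunctional_addSubst_eq_zero [Fact p.Prime] {K : Type*} [Field K] [IsAlgClosed K]
    [Algebra (ZMod p) K] (hN : ∀ k, ∀ z ∈ N, polyPower p n k z ∈ N) (hℓ : ∀ z ∈ N, ℓ z = 0)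
    (B : ℕ) {r : ℕ → K} (hr : r 0 ≠ 0) {z : P p n} (hz : z ∈ N) {d : ℕ} (hd : z.IsHomogeneous d) :
    extFunctional ℓ K (addSubst p n B r z) = 0 := by
  have h := extFunctional_addSubst_eq_zero_of_one hN hℓ B (r := fun s => (r 0)⁻¹ * r s)
    (inv_mul_cancel₀ hr) hz
  have h1 : addSubst p n B r z =
      MvPolynomial.C (r 0) ^ d * addSubst p n B (fun s => (r 0)⁻¹ * r s) z := by
    rw [addSubst, addSubst, ← aeval_smul_of_isHomogeneous hd]
    congr 2
    funext j
    rw [Finset.mul_sum]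
    refine Finset.sum_congr rfl fun s _ => ?_
    rw [← mul_assoc, ← map_mul, mul_inv_cancel_left₀ hr]
  rw [h1, ← map_pow, ← MvPolynomial.smul_eq_C_mul, map_smul, h, smul_zero]

/-- A functional that vanishes on a space of polynomials stable under the reduced powers vanishes
on the substitution `yₐ ↦ ∑ⱼ αⱼ ∑ₛ (tⱼ yₐ) ^ p ^ s` in its homogeneous elements. -/
theorem extFunctional_addSubst_linear_eq_zero [Fact p.Prime] {K : Type*} [Field K] [IsAlgClosed K]
    [Algebra (ZMod p) K] (hN : ∀ k, ∀ z ∈ N, polyPower p n k z ∈ N) (hℓ : ∀ z ∈ N, ℓ z = 0)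
    (B : ℕ) (α : Fin n → K) {z : P p n} (hz : z ∈ N) {d : ℕ} (hd : z.IsHomogeneous d)
    (hd0 : 0 < d) :
    extFunctional ℓ (MvPolynomial (Fin n) K) (addSubst p n B
      (fun s => ∑ j, MvPolynomial.C (α j) * MvPolynomial.X j ^ p ^ s) z) = 0 := by
  set r : ℕ → MvPolynomial (Fin n) K :=
    fun s => ∑ j, MvPolynomial.C (α j) * MvPolynomial.X j ^ p ^ s with hr
  by_cases hα : α = 0
  · have : addSubst p n B r z = 0 := by
      have h0 : ∀ s, r s = 0 := by intro s; simp [hr, hα]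
      rw [addSubst]
      have := aeval_smul_of_isHomogeneous hd (0 : MvPolynomial (Fin n) (MvPolynomial (Fin n) K)) 0
      rw [zero_pow hd0.ne', zero_mul] at this
      rw [← this]
      congr 2
      funext j
      simp [h0]
    rw [this, map_zero]
  · have hr0 : r 0 ≠ 0 := by
      obtain ⟨j, hj⟩ := Function.ne_iff.1 hα
      intro h
      refine hj ?_
      have := congrArg (MvPolynomial.coeff (Finsupp.single j 1)) h
      simpa [hr, MvPolynomial.coeff_sum, MvPolynomial.coeff_C_mul, MvPolynomial.coeff_X,
        Finsupp.single_left_inj] using this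
    -- The factor `r 0` handles the points `t` at which the leading coefficient vanishes; elsewhere
    -- the result over `K` applies. A polynomial that vanishes at all points over the infinite field
    -- `K` is zero, and `r 0 = ∑ⱼ αⱼ tⱼ` is not zero, so it can be cancelled.
    have : extFunctional ℓ (MvPolynomial (Fin n) K) (addSubst p n B r z) * r 0 = 0 := by
      refine MvPolynomial.funext fun t => ?_
      rw [map_mul, map_zero]
      by_cases ht : MvPolynomial.eval t (r 0) = 0
      · rw [ht, mul_zero]
      · rw [← extFunctional_naturality, map_addSubst,
          extFunctional_addSubst_eq_zero hN hℓ B ht hz hd, zero_mul]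
    exact (mul_eq_zero.1 this).resolve_right hr0

end

/-! ### The indicator function of the surjective maps -/

/-- Two surjective linear maps with the same source and target differ by an automorphism. -/
theorem exists_equiv_comp_eq {F V X : Type*} [Field F] [AddCommGroup V] [Module F V]
    [FiniteDimensional F V] [AddCommGroup X] [Module F X] {u w : V →ₗ[F] X}
    (hu : Function.Surjective u) (hw : Function.Surjective w) :
    ∃ g : V ≃ₗ[F] V, w = u ∘ₗ g.toLinearMap := by
  have split : ∀ v : V →ₗ[F] X, Function.Surjective v →
      ∃ e : V ≃ₗ[F] X × LinearMap.ker v, ∀ x, (e x).1 = v x := by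
    intro v hv
    obtain ⟨C, hC⟩ := Submodule.exists_isCompl (LinearMap.ker v)
    refine ⟨LinearMap.equivProdOfSurjectiveOfIsCompl v
      ((LinearMap.ker v).projectionOnto C hC) (LinearMap.range_eq_top.2 hv)
      (by simp) (by simpa using hC), fun x => rfl⟩
  obtain ⟨eu, heu⟩ := split u hu
  obtain ⟨ew, hew⟩ := split w hw
  have hker : Module.finrank F (LinearMap.ker w) = Module.finrank F (LinearMap.ker u) := by
    have h1 := LinearMap.finrank_range_add_finrank_ker u
    have h2 := LinearMap.finrank_range_add_finrank_ker w
    rw [LinearMap.range_eq_top.2 hu] at h1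
    rw [LinearMap.range_eq_top.2 hw] at h2
    omega
  let κ : LinearMap.ker w ≃ₗ[F] LinearMap.ker u := LinearEquiv.ofFinrankEq _ _ hker
  refine ⟨(ew.trans ((LinearEquiv.refl F X).prodCongr κ)).trans eu.symm, LinearMap.ext fun x => ?_⟩
  rw [LinearMap.comp_apply, ← heu]
  simp [hew]

/-! ### Values of an invariant polynomial on linear maps -/

section

variable {K : Type*} [Field K] [Algebra (ZMod p) K]

/-- The value of a polynomial at the images of the standard basis vectors. -/
def evalLin (h : P p n) (φ : (Fin n → ZMod p) →ₗ[ZMod p] K) : K :=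
  MvPolynomial.aeval (fun a => φ (Pi.single a 1)) h

/-- Precomposing `φ` with `g` has the effect of substituting the matrix of `g` in `h`. -/
theorem evalLin_comp_equiv {h : P p n}
    (hinv : ∀ g : GL (Fin n) (ZMod p), polyAct (g : Matrix (Fin n) (Fin n) (ZMod p)) h = h)
    (φ : (Fin n → ZMod p) →ₗ[ZMod p] K) (g : (Fin n → ZMod p) ≃ₗ[ZMod p] (Fin n → ZMod p)) :
    evalLin h (φ ∘ₗ g.toLinearMap) = evalLin h φ := by
  let G : GL (Fin n) (ZMod p) := ⟨LinearMap.toMatrix' g.toLinearMap,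
    LinearMap.toMatrix' g.symm.toLinearMap, by rw [← LinearMap.toMatrix'_comp]; simp,
    by rw [← LinearMap.toMatrix'_comp]; simp⟩
  have h1 : evalLin (polyAct (G : Matrix (Fin n) (Fin n) (ZMod p)) h) φ =
      evalLin h (φ ∘ₗ g.toLinearMap) := by
    rw [evalLin, evalLin, polyAct, ← AlgHom.comp_apply, MvPolynomial.comp_aeval]
    congr 2
    funext j
    rw [map_sum, LinearMap.comp_apply]
    conv_rhs => rw [LinearMap.pi_apply_eq_sum_univ φ]
    refine Finset.sum_congr rfl fun i _ => ?_
    have e1 : (fun k => if i = k then (1 : ZMod p) else 0) = Pi.single i 1 := by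
      funext k
      simp [Pi.single_apply, eq_comm]
    have e2 : (G : Matrix (Fin n) (Fin n) (ZMod p)) i j = g (Pi.single j 1) i := by
      simp [G, LinearMap.toMatrix'_apply]
    rw [map_smul, MvPolynomial.aeval_X, e1, e2]
    rfl
  rw [← h1, hinv]

open Classical in
/-- The indicator function of the surjective maps to `𝔽_p ^ j` is a linear combination of the
functions `w ↦ h (α ∘ w)`. -/
def IsIndicatorCombination (K : Type*) [Field K] [Algebra (ZMod p) K] (h : P p n) (j : ℕ) : Prop :=
  ∃ (ι : Type) (_ : Fintype ι) (c : ι → K) (α : ι → (Fin j → ZMod p) →ₗ[ZMod p] K),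
    ∀ w : (Fin n → ZMod p) →ₗ[ZMod p] (Fin j → ZMod p),
      ∑ l, c l * evalLin h (α l ∘ₗ w) = if Function.Surjective w then 1 else 0

/-- Take `j` to be the least rank of a map `φ` with `h (φ) ≠ 0`, and let `α` be an isomorphism from
`𝔽_p ^ j` onto the range of `φ`. If `w` is surjective, then `α ∘ w` and `φ` have the same range, so
they differ by an automorphism and `h` takes the same value on them. Otherwise `α ∘ w` has smaller
rank and `h` vanishes there. One term with coefficient `h (φ)⁻¹` suffices. The rank is positive
because `h` has positive degree. -/
theorem exists_isIndicatorCombination [Fact p.Prime] [Infinite K] {h : P p n} {d : ℕ}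
    (hd : h.IsHomogeneous d) (hd0 : 0 < d) (h0 : h ≠ 0)
    (hinv : ∀ g : GL (Fin n) (ZMod p), polyAct (g : Matrix (Fin n) (Fin n) (ZMod p)) h = h) :
    ∃ j, 0 < j ∧ j ≤ n ∧ IsIndicatorCombination K h j := by
  classical
  have hex : ∃ j, ∃ φ : (Fin n → ZMod p) →ₗ[ZMod p] K,
      Module.finrank (ZMod p) (LinearMap.range φ) = j ∧ evalLin h φ ≠ 0 := by
    obtain ⟨a, ha⟩ : ∃ a : Fin n → K, MvPolynomial.aeval a h ≠ 0 := by
      by_contra! hc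
      have h1 : MvPolynomial.map (algebraMap (ZMod p) K) h = 0 :=
        MvPolynomial.funext fun a => by
          rw [map_zero, MvPolynomial.eval_map, ← MvPolynomial.aeval_def, hc a]
      exact h0 (MvPolynomial.map_injective _ (algebraMap (ZMod p) K).injective
        (by rw [h1, map_zero]))
    refine ⟨_, (Pi.basisFun (ZMod p) (Fin n)).constr (ZMod p) a, rfl, ?_⟩
    rw [evalLin]
    convert ha using 4 with b
    rw [← Pi.basisFun_apply, Module.Basis.constr_basis]
  let j := Nat.find hex
  obtain ⟨φ, hφ, hφ0⟩ := Nat.find_spec hex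
  have hmin : ∀ ψ : (Fin n → ZMod p) →ₗ[ZMod p] K,
      Module.finrank (ZMod p) (LinearMap.range ψ) < j → evalLin h ψ = 0 := by
    intro ψ hψ
    by_contra hc
    exact Nat.find_min hex hψ ⟨ψ, rfl, hc⟩
  have hj0 : 0 < j := by
    rw [Nat.pos_iff_ne_zero]
    intro hj
    rw [show Nat.find hex = 0 from hj, Submodule.finrank_eq_zero, LinearMap.range_eq_bot] at hφ
    refine hφ0 ?_
    have := aeval_smul_of_isHomogeneous hd (0 : K) 0
    rw [zero_pow hd0.ne', zero_mul] at this
    rw [hφ, evalLin, ← this]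
    congr 2
    funext a
    simp
  have hjn : j ≤ n := by
    have := LinearMap.finrank_range_le φ
    rw [hφ, Module.finrank_fin_fun] at this
    exact this
  let e : (Fin j → ZMod p) ≃ₗ[ZMod p] LinearMap.range φ :=
    LinearEquiv.ofFinrankEq _ _ (by rw [hφ, Module.finrank_fin_fun])
  refine ⟨j, hj0, hjn, Unit, inferInstance, fun _ => (evalLin h φ)⁻¹,
    fun _ => (LinearMap.range φ).subtype ∘ₗ e.toLinearMap, fun w => ?_⟩
  rw [Fintype.sum_unique]
  split_ifs with hw
  · obtain ⟨g, hg⟩ := exists_equiv_comp_eq (u := φ.rangeRestrict) (w := e.toLinearMap ∘ₗ w)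
      φ.surjective_rangeRestrict (e.surjective.comp hw)
    rw [LinearMap.comp_assoc, hg, ← LinearMap.comp_assoc, evalLin_comp_equiv hinv]
    exact inv_mul_cancel₀ hφ0
  · refine mul_eq_zero_of_right _ (hmin _ ?_)
    rw [LinearMap.comp_assoc, LinearMap.range_comp, Submodule.finrank_map_subtype_eq,
      LinearMap.range_comp]
    refine (Submodule.finrank_map_le _ _).trans_lt ?_
    have := Submodule.finrank_lt (mt LinearMap.range_eq_top.1 hw)
    rwa [Module.finrank_fin_fun] at this

theorem exists_surjective_ker_eq_span [Fact p.Prime] {j : ℕ} {v : Fin (j + 1) → ZMod p}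
    (hv : v ≠ 0) : ∃ π : (Fin (j + 1) → ZMod p) →ₗ[ZMod p] (Fin j → ZMod p),
      Function.Surjective π ∧ LinearMap.ker π = Submodule.span (ZMod p) {v} := by
  have h1 := Submodule.finrank_quotient_add_finrank (Submodule.span (ZMod p) {v})
  rw [finrank_span_singleton hv, Module.finrank_fin_fun] at h1
  let e : ((Fin (j + 1) → ZMod p) ⧸ Submodule.span (ZMod p) {v}) ≃ₗ[ZMod p] (Fin j → ZMod p) :=
    LinearEquiv.ofFinrankEq _ _ (by rw [Module.finrank_fin_fun]; omega)
  refine ⟨e.toLinearMap ∘ₗ (Submodule.span (ZMod p) {v}).mkQ,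
    e.surjective.comp (Submodule.mkQ_surjective _), ?_⟩
  rw [LinearMap.ker_comp, LinearEquiv.ker, ← LinearMap.ker, Submodule.ker_mkQ]

theorem surjective_comp_iff_of_ker {F V X Y : Type*} [Field F] [AddCommGroup V] [Module F V]
    [AddCommGroup X] [Module F X] [AddCommGroup Y] [Module F Y] {w : V →ₗ[F] Y} {π : Y →ₗ[F] X}
    (hπ : Function.Surjective π) :
    Function.Surjective (π ∘ₗ w) ↔ LinearMap.range w ⊔ LinearMap.ker π = ⊤ := by
  rw [← LinearMap.range_eq_top, LinearMap.range_comp,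
    LinearMap.map_eq_top_iff (LinearMap.range_eq_top.2 hπ)]

/-- Sum the indicators of `π_v ∘ w`, with sign `-1`, over all nonzero `v`, where `π_v` is the
quotient by the line of `v`. If `w` is surjective, this is `-(p ^ (j + 1) - 1) = 1` in `K`. If the
range of `w` is a hyperplane, the composite is surjective exactly for `v` outside it, which happens
`p ^ (j + 1) - p ^ j` times; this is `0` in `K` because `j > 0`. For smaller ranges no composite is
surjective. -/
theorem IsIndicatorCombination.succ [Fact p.Prime] {h : P p n} {j : ℕ} (hj : 0 < j)
    (H : IsIndicatorCombination K h j) : IsIndicatorCombination K h (j + 1) := by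
  classical
  obtain ⟨ι, _, c, α, H⟩ := H
  choose π hπ hker using fun v : {v : Fin (j + 1) → ZMod p // v ≠ 0} =>
    exists_surjective_ker_eq_span v.2
  have hpK : (p : K) = 0 := by
    rw [← map_natCast (algebraMap (ZMod p) K), ZMod.natCast_self, map_zero]
  have hcard : Fintype.card {v : Fin (j + 1) → ZMod p // v ≠ 0} = p ^ (j + 1) - 1 := by
    rw [Fintype.card_subtype_compl, Fintype.card_subtype_eq, Fintype.card_fun, ZMod.card,
      Fintype.card_fin]
  have hpos : ∀ m, 1 ≤ p ^ m := fun m => Nat.pow_pos (Fact.out : p.Prime).pos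
  refine ⟨{v : Fin (j + 1) → ZMod p // v ≠ 0} × ι, inferInstance, fun x => - c x.2,
    fun x => α x.2 ∘ₗ π x.1, fun w => ?_⟩
  rw [Fintype.sum_prod_type]
  simp only [neg_mul, Finset.sum_neg_distrib, LinearMap.comp_assoc, H]
  by_cases hw : Function.Surjective w
  · have hs : ∀ v, Function.Surjective (π v ∘ₗ w) := fun v => (hπ v).comp hw
    simp only [hs, if_true]
    rw [if_pos hw, Finset.sum_const,
      Finset.card_univ, hcard, nsmul_eq_mul, mul_one, Nat.cast_sub (hpos _), Nat.cast_pow, hpK,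
      zero_pow (Nat.succ_ne_zero j), Nat.cast_one, zero_sub, neg_neg]
  · rw [if_neg hw, neg_eq_zero]
    by_cases hex : ∃ v, Function.Surjective (π v ∘ₗ w)
    · obtain ⟨v₀, hv₀⟩ := hex
      have hne : LinearMap.range w ≠ ⊤ := mt LinearMap.range_eq_top.1 hw
      have hrank : Module.finrank (ZMod p) (LinearMap.range w) = j := by
        rw [surjective_comp_iff_of_ker (hπ v₀), hker] at hv₀
        have h1 := Submodule.finrank_add_le_finrank_add_finrank (LinearMap.range w)
          (Submodule.span (ZMod p) {(v₀ : Fin (j + 1) → ZMod p)})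
        rw [hv₀, finrank_top, Module.finrank_fin_fun, finrank_span_singleton v₀.2] at h1
        have h2 := Submodule.finrank_lt hne
        rw [Module.finrank_fin_fun] at h2
        omega
      have hiff : ∀ v, Function.Surjective (π v ∘ₗ w) ↔ (v : Fin (j + 1) → ZMod p) ∉
          LinearMap.range w := by
        intro v
        rw [surjective_comp_iff_of_ker (hπ v), hker]
        constructor
        · intro h hv
          refine hne ?_
          rwa [sup_eq_left.2 ((Submodule.span_singleton_le_iff_mem _ _).2 hv)] at h
        · intro hv
          refine Submodule.eq_top_of_finrank_eq (le_antisymm (Submodule.finrank_le _) ?_)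
          have hlt : LinearMap.range w < LinearMap.range w ⊔
              Submodule.span (ZMod p) {(v : Fin (j + 1) → ZMod p)} := by
            refine lt_of_le_of_ne le_sup_left fun h => hv ?_
            rw [h]
            exact Submodule.mem_sup_right (Submodule.mem_span_singleton_self _)
          have := Submodule.finrank_lt_finrank_of_lt hlt
          rw [Module.finrank_fin_fun]
          omega
      simp only [hiff]
      rw [Finset.sum_ite, Finset.sum_const_zero, add_zero, Finset.sum_const, nsmul_eq_mul, mul_one]
      have hc : (Finset.univ.filter fun v : {v : Fin (j + 1) → ZMod p // v ≠ 0} =>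
          (v : Fin (j + 1) → ZMod p) ∉ LinearMap.range w).card = p ^ (j + 1) - p ^ j := by
        have h1 : Fintype.card (LinearMap.range w) = p ^ j := by
          rw [Module.card_eq_pow_finrank (K := ZMod p), ZMod.card, hrank]
        have h2 := Fintype.card_subtype_compl (fun v : Fin (j + 1) → ZMod p =>
          v ∈ LinearMap.range w)
        rw [Fintype.card_fun, ZMod.card, Fintype.card_fin] at h2
        rw [← h1, ← Fintype.card_subtype]
        refine Eq.trans (Fintype.card_congr ⟨fun v => ⟨v.1.1, v.2⟩,
          fun v => ⟨⟨v.1, fun h => v.2 (by rw [h]; exact zero_mem _)⟩, v.2⟩,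
          fun v => rfl, fun v => rfl⟩) h2
      rw [hc, Nat.cast_sub (Nat.pow_le_pow_right (Fact.out : p.Prime).pos (Nat.le_succ j)),
        Nat.cast_pow, Nat.cast_pow, hpK, zero_pow hj.ne', zero_pow (Nat.succ_ne_zero j), sub_zero]
    · push Not at hex
      exact Finset.sum_eq_zero fun v _ => if_neg (hex v)

theorem isIndicatorCombination_self [Fact p.Prime] [Infinite K] {h : P p n} {d : ℕ}
    (hd : h.IsHomogeneous d) (hd0 : 0 < d) (h0 : h ≠ 0)
    (hinv : ∀ g : GL (Fin n) (ZMod p), polyAct (g : Matrix (Fin n) (Fin n) (ZMod p)) h = h) :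
    IsIndicatorCombination K h n := by
  obtain ⟨j, hj, hjn, H⟩ := exists_isIndicatorCombination (K := K) hd hd0 h0 hinv
  have key : ∀ m, IsIndicatorCombination K h (j + m) := by
    intro m
    induction m with
    | zero => exact H
    | succ m ih => exact ih.succ (hj.trans_le (Nat.le_add_right j m))
  obtain ⟨m, rfl⟩ := Nat.exists_eq_add_of_le hjn
  exact key m

/-- The function that is `1` at the invertible matrices over `𝔽_p` and `0` at the other ones is a
linear combination of the functions `W ↦ h (α W)`. -/
theorem exists_sum_eq_det_pow [Fact p.Prime] [Infinite K] {h : P p n} {d : ℕ}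
    (hd : h.IsHomogeneous d) (hd0 : 0 < d) (h0 : h ≠ 0)
    (hinv : ∀ g : GL (Fin n) (ZMod p), polyAct (g : Matrix (Fin n) (Fin n) (ZMod p)) h = h) :
    ∃ (ι : Type) (_ : Fintype ι) (c : ι → K) (α : ι → Fin n → K),
      ∀ W : Matrix (Fin n) (Fin n) (ZMod p),
        ∑ l, c l * MvPolynomial.aeval (fun a => ∑ j, α l j * algebraMap (ZMod p) K (W j a)) h =
          algebraMap (ZMod p) K (W.det ^ (p - 1)) := by
  classical
  obtain ⟨ι, hι, c, α, H⟩ := isIndicatorCombination_self (K := K) hd hd0 h0 hinv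
  refine ⟨ι, hι, c, fun l j => α l (Pi.single j 1), fun W => ?_⟩
  have h1 := H W.mulVecLin
  have h2 : ∀ l, evalLin h (α l ∘ₗ W.mulVecLin) = MvPolynomial.aeval
      (fun a => ∑ j, α l (Pi.single j 1) * algebraMap (ZMod p) K (W j a)) h := by
    intro l
    rw [evalLin]
    congr 2
    funext a
    rw [LinearMap.comp_apply, LinearMap.pi_apply_eq_sum_univ (α l)]
    refine Finset.sum_congr rfl fun j _ => ?_
    rw [Algebra.smul_def, mul_comm]
    congr 2
    · funext k
      simp [Pi.single_apply, eq_comm]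
    · simp
  simp only [h2] at h1
  rw [h1]
  have h3 : Function.Surjective W.mulVecLin ↔ W.det ≠ 0 := by
    rw [Matrix.coe_mulVecLin, Matrix.mulVec_surjective_iff_isUnit, Matrix.isUnit_iff_isUnit_det,
      isUnit_iff_ne_zero]
  by_cases hW : W.det = 0
  · rw [if_neg (by rw [h3, not_not]; exact hW), hW,
      zero_pow (Nat.sub_ne_zero_of_lt (Fact.out : p.Prime).one_lt), map_zero]
  · rw [if_pos (h3.2 hW), ZMod.pow_card_sub_one_eq_one hW, map_one]

end

/-! ### Sums of powers of `p` -/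

/-- Carrying in base `p`: if `c` of the summands are `1`, then `p` divides `1 + c`, and after
division by `p` these ones become `(1 + c) / p` ones. One of them plays the role of the leading `1`.
Since `p ≥ 2`, each division by `p` loses at least one summand. -/
theorem le_card_of_pow_dvd_one_add_sum (hp : 2 ≤ p) {G : ℕ} {s : Multiset ℕ}
    (h : p ^ G ∣ 1 + (s.map (p ^ ·)).sum) : G ≤ s.card := by
  induction G generalizing s with
  | zero => exact Nat.zero_le _
  | succ G ih =>
    set s' := s.filter (· ≠ 0) with hs'
    set c := (s.filter (· = 0)).card with hc
    have hsplit : s = s.filter (· = 0) + s' := (Multiset.filter_add_not (· = 0) s).symm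
    have hz : s.filter (· = 0) = Multiset.replicate c 0 :=
      Multiset.eq_replicate.2 ⟨rfl, fun x hx => (Multiset.mem_filter.1 hx).2⟩
    have hcard : s.card = c + s'.card := by
      conv_lhs => rw [hsplit]
      rw [Multiset.card_add]
    have hpred : (s'.map (p ^ ·)).sum = p * ((s'.map (· - 1)).map (p ^ ·)).sum := by
      rw [Multiset.map_map, ← Multiset.sum_map_mul_left]
      congr 1
      refine Multiset.map_congr rfl fun x hx => ?_
      have hx0 : x ≠ 0 := (Multiset.mem_filter.1 hx).2
      obtain ⟨y, rfl⟩ := Nat.exists_eq_succ_of_ne_zero hx0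
      simp [pow_succ']
    have hsum : (s.map (p ^ ·)).sum = c + p * ((s'.map (· - 1)).map (p ^ ·)).sum := by
      conv_lhs => rw [hsplit]
      rw [Multiset.map_add, Multiset.sum_add, hpred, hz, Multiset.map_replicate,
        Multiset.sum_replicate]
      simp
    rw [hsum] at h
    have h1 : p ∣ 1 + c := by
      have : p ∣ (1 + c) + p * ((s'.map (· - 1)).map (p ^ ·)).sum := by
        rw [add_assoc]
        exact (dvd_pow_self p (Nat.succ_ne_zero G)).trans h
      exact (Nat.dvd_add_left (dvd_mul_right _ _)).1 this
    obtain ⟨c', hc'⟩ := h1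
    have hc0 : c' ≠ 0 := by rintro rfl; omega
    obtain ⟨e, rfl⟩ := Nat.exists_eq_succ_of_ne_zero hc0
    have h2 : 1 + (c + p * ((s'.map (· - 1)).map (p ^ ·)).sum) =
        p * (1 + ((Multiset.replicate e 0 + s'.map (· - 1)).map (p ^ ·)).sum) := by
      rw [← add_assoc, hc', Multiset.map_add, Multiset.sum_add, Multiset.map_replicate,
        Multiset.sum_replicate]
      simp only [pow_zero, smul_eq_mul, mul_one, Nat.succ_eq_add_one]
      ring
    rw [h2, pow_succ'] at h
    have h3 := ih (Nat.dvd_of_mul_dvd_mul_left (by omega) h)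
    rw [Multiset.card_add, Multiset.card_replicate, Multiset.card_map] at h3
    have h4 : 2 * (e + 1) ≤ 1 + c := by
      rw [hc']
      exact Nat.mul_le_mul_right _ hp
    omega

/-- For `g > 0` the number of summands equal to `1` is divisible by `p` and less than `p`, so there
are none and everything can be divided by `p`. -/
theorem eq_of_sum_pow_eq (hp : 2 ≤ p) {g : ℕ} {x : Fin (p - 1) → ℕ}
    (h : ∑ k, p ^ x k = (p - 1) * p ^ g) (k : Fin (p - 1)) : x k = g := by
  induction g generalizing x with
  | zero =>
    have h1 : ∑ k : Fin (p - 1), 1 = ∑ k, p ^ x k := by simp [h]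
    have h2 := (Finset.sum_eq_sum_iff_of_le fun k _ => Nat.one_le_pow (x k) p (by omega)).1 h1 k
      (Finset.mem_univ k)
    by_contra h0
    exact absurd h2.symm (Nat.one_lt_pow h0 (by omega)).ne'
  | succ g ih =>
    have hpos : ∀ k, x k ≠ 0 := by
      have hsplit : ∑ k, p ^ x k = (Finset.univ.filter fun k => x k = 0).card +
          ∑ k with x k ≠ 0, p ^ x k := by
        rw [← Finset.sum_filter_add_sum_filter_not Finset.univ (fun k => x k = 0)]
        congr 1
        rw [Finset.card_eq_sum_ones]
        exact Finset.sum_congr rfl fun k hk => by rw [(Finset.mem_filter.1 hk).2, pow_zero]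
      have hdvd : p ∣ ∑ k with x k ≠ 0, p ^ x k :=
        Finset.dvd_sum fun k hk => dvd_pow_self p (Finset.mem_filter.1 hk).2
      have hdvd' : p ∣ (Finset.univ.filter fun k => x k = 0).card := by
        rw [← Nat.dvd_add_left hdvd, ← hsplit, h]
        exact Dvd.dvd.mul_left (dvd_pow_self p (Nat.succ_ne_zero g)) _
      have hlt : (Finset.univ.filter fun k => x k = 0).card < p := by
        refine (Finset.card_le_univ _).trans_lt ?_
        rw [Fintype.card_fin]
        omega
      have h0 := Nat.eq_zero_of_dvd_of_lt hdvd' hlt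
      intro k hk
      exact absurd (Finset.card_eq_zero.1 h0 ▸ Finset.mem_filter.2 ⟨Finset.mem_univ k, hk⟩)
        (Finset.notMem_empty k)
    have h1 : ∑ k, p ^ (x k - 1) = (p - 1) * p ^ g := by
      refine Nat.eq_of_mul_eq_mul_left (show 0 < p by omega) ?_
      rw [Finset.mul_sum, mul_left_comm, ← pow_succ', ← h]
      refine Finset.sum_congr rfl fun k _ => ?_
      rw [← pow_succ', Nat.sub_add_cancel (Nat.one_le_iff_ne_zero.2 (hpos k))]
    have h2 := ih h1
    have := hpos k
    omega

theorem prod_sub_algebraMap [Fact p.Prime] {A : Type*} [CommRing A] [Algebra (ZMod p) A] (t : A) :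
    ∏ a : ZMod p, (t - algebraMap (ZMod p) A a) = t ^ p - t := by
  have hp := (Fact.out : p.Prime)
  have h : ∏ a : ZMod p, (Polynomial.X - Polynomial.C a) =
      (Polynomial.X ^ p - Polynomial.X : Polynomial (ZMod p)) := by
    have hr := FiniteField.roots_X_pow_card_sub_X (ZMod p)
    rw [ZMod.card] at hr
    have h1 := Polynomial.prod_multiset_X_sub_C_of_monic_of_roots_card_eq
      (p := (Polynomial.X ^ p - Polynomial.X : Polynomial (ZMod p)))
      (Polynomial.monic_X_pow_sub (by rw [Polynomial.degree_X]; exact_mod_cast hp.one_lt))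
      (by rw [hr, FiniteField.X_pow_card_sub_X_natDegree_eq _ hp.one_lt]; simp)
    rw [hr] at h1
    exact h1
  have h2 := congrArg (Polynomial.aeval t) h
  simpa only [map_prod, map_sub, Polynomial.aeval_X, Polynomial.aeval_C, map_pow] using h2

/-! ### Polynomials in additive polynomials -/

section

variable (p n) (K : Type*) [Field K]

/-- The additive polynomial `∑ₛ (tⱼ yₐ) ^ p ^ s`, where `s ≤ B`. -/
def addPoly (B : ℕ) (j a : Fin n) : MvPolynomial (Fin n) (MvPolynomial (Fin n) K) :=
  ∑ s ∈ Finset.range (B + 1), MvPolynomial.C (MvPolynomial.X j ^ p ^ s) * MvPolynomial.X a ^ p ^ s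

/-- The span of the monomials in which the exponent of each `tⱼ` is a sum of at most `k` powers
of `p`. -/
def sumPowSpan (k : ℕ) : Submodule K (MvPolynomial (Fin n) (MvPolynomial (Fin n) K)) :=
  Submodule.span K {q | ∃ (b e : Fin n →₀ ℕ), q = MvPolynomial.monomial b (MvPolynomial.monomial e 1)
    ∧ ∀ j, ∃ s : Multiset ℕ, s.card ≤ k ∧ e j = (s.map (p ^ ·)).sum}

variable {p n K}

theorem sumPowSpan_mono {k k' : ℕ} (h : k ≤ k') : sumPowSpan p n K k ≤ sumPowSpan p n K k' := by
  refine Submodule.span_mono ?_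
  rintro q ⟨b, e, rfl, he⟩
  refine ⟨b, e, rfl, fun j => ?_⟩
  obtain ⟨s, hs, hs'⟩ := he j
  exact ⟨s, hs.trans h, hs'⟩

theorem mul_addPoly_mem_sumPowSpan {k : ℕ} {q : MvPolynomial (Fin n) (MvPolynomial (Fin n) K)}
    (hq : q ∈ sumPowSpan p n K k) (B : ℕ) (j a : Fin n) :
    q * addPoly p n K B j a ∈ sumPowSpan p n K (k + 1) := by
  refine Submodule.span_induction ?_ (by rw [zero_mul]; exact zero_mem _)
    (fun x y _ _ hx hy => by rw [add_mul]; exact add_mem hx hy)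
    (fun c x _ hx => by rw [smul_mul_assoc]; exact Submodule.smul_mem _ _ hx) hq
  rintro _ ⟨b, e, rfl, he⟩
  rw [addPoly, Finset.mul_sum]
  refine sum_mem fun s _ => Submodule.subset_span ⟨b + Finsupp.single a (p ^ s),
    e + Finsupp.single j (p ^ s), ?_, fun i => ?_⟩
  · rw [MvPolynomial.X_pow_eq_monomial, MvPolynomial.X_pow_eq_monomial,
      MvPolynomial.C_mul_monomial, MvPolynomial.monomial_mul, mul_one, MvPolynomial.monomial_mul,
      mul_one]
  · obtain ⟨m, hm, hm'⟩ := he i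
    by_cases hij : i = j
    · subst hij
      refine ⟨s ::ₘ m, by rw [Multiset.card_cons]; omega, ?_⟩
      rw [Multiset.map_cons, Multiset.sum_cons, Finsupp.add_apply, Finsupp.single_eq_same, hm',
        add_comm]
    · refine ⟨m, by omega, ?_⟩
      rw [Finsupp.add_apply, Finsupp.single_eq_of_ne hij, add_zero, hm']

/-- Each factor `addPoly` adds one power of `p` to one exponent, so the number of powers is bounded
by the degree of `q`. The bound must not depend on `B`, because `B` is chosen later, in terms of the
exponents `gⱼ`. -/
theorem exists_aeval_addPoly_mem_sumPowSpan (q : MvPolynomial (Fin n × Fin n) K) :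
    ∃ k, ∀ B, MvPolynomial.aeval (fun x => addPoly p n K B x.1 x.2) q ∈ sumPowSpan p n K k := by
  induction q using MvPolynomial.induction_on with
  | C c =>
    refine ⟨0, fun B => ?_⟩
    rw [MvPolynomial.aeval_C, Algebra.algebraMap_eq_smul_one]
    exact Submodule.smul_mem _ _ (Submodule.subset_span ⟨0, 0, rfl, fun j => ⟨0, le_rfl, rfl⟩⟩)
  | add f g hf hg =>
    obtain ⟨k, hk⟩ := hf
    obtain ⟨k', hk'⟩ := hg
    refine ⟨max k k', fun B => ?_⟩
    rw [map_add]
    exact add_mem (sumPowSpan_mono (le_max_left _ _) (hk B))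
      (sumPowSpan_mono (le_max_right _ _) (hk' B))
  | mul_X f x hf =>
    obtain ⟨k, hk⟩ := hf
    refine ⟨k + 1, fun B => ?_⟩
    rw [map_mul, MvPolynomial.aeval_X]
    exact mul_addPoly_mem_sumPowSpan (hk B) B _ _

variable [Algebra (ZMod p) K]

/-- The Frobenius shifts the summands by one, so the difference telescopes. -/
theorem addPoly_pow_sub [Fact p.Prime] (B : ℕ) (j a : Fin n) :
    addPoly p n K B j a ^ p - addPoly p n K B j a =
      MvPolynomial.C (MvPolynomial.X j ^ p ^ (B + 1)) * MvPolynomial.X a ^ p ^ (B + 1) -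
        MvPolynomial.C (MvPolynomial.X j ^ 1) * MvPolynomial.X a ^ 1 := by
  have : CharP K p := charP_of_injective_algebraMap (algebraMap (ZMod p) K).injective p
  have h : addPoly p n K B j a ^ p = ∑ s ∈ Finset.range (B + 1),
      MvPolynomial.C (MvPolynomial.X j ^ p ^ (s + 1)) * MvPolynomial.X a ^ p ^ (s + 1) := by
    rw [addPoly, sum_pow_char]
    refine Finset.sum_congr rfl fun s _ => ?_
    rw [mul_pow, ← map_pow, ← pow_mul, ← pow_mul, ← pow_succ]
  rw [h, addPoly, ← Finset.sum_sub_distrib, Finset.sum_range_sub fun s =>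
    (MvPolynomial.C (MvPolynomial.X j ^ p ^ s) * MvPolynomial.X a ^ p ^ s :
      MvPolynomial (Fin n) (MvPolynomial (Fin n) K)), pow_zero]

theorem extFunctional_C_mul_map (ℓ : P p n →ₗ[ZMod p] ZMod p) {A : Type*} [CommRing A]
    [Algebra (ZMod p) A] (c : A) (q : P p n) :
    extFunctional ℓ A (MvPolynomial.C c * MvPolynomial.map (algebraMap (ZMod p) A) q) =
      c * algebraMap (ZMod p) A (ℓ q) := by
  rw [← MvPolynomial.smul_eq_C_mul, map_smul, extFunctional_map, smul_eq_mul]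

/-- The exponents of `tⱼ` that occur are `1` plus a sum of at most `k` powers of `p`, and such a
number is not divisible by `p ^ G` when `G > k`. -/
theorem coeff_extFunctional_mul_X [Fact p.Prime] (ℓ : P p n →ₗ[ZMod p] ZMod p) {k G : ℕ}
    (hG : k < G) {q : MvPolynomial (Fin n) (MvPolynomial (Fin n) K)}
    (hq : q ∈ sumPowSpan p n K k) (j a : Fin n) {m : Fin n →₀ ℕ} (hm : p ^ G ∣ m j) :
    MvPolynomial.coeff m (extFunctional ℓ (MvPolynomial (Fin n) K)
      (q * (MvPolynomial.C (MvPolynomial.X j ^ 1) * MvPolynomial.X a ^ 1))) = 0 := by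
  refine Submodule.span_induction ?_ (by rw [zero_mul, map_zero, MvPolynomial.coeff_zero])
    (fun x y _ _ hx hy => by rw [add_mul, map_add, MvPolynomial.coeff_add, hx, hy, add_zero])
    (fun c x _ hx => by
      rw [smul_mul_assoc, LinearMap.map_smul_of_tower, MvPolynomial.coeff_smul, hx, smul_zero]) hq
  rintro _ ⟨b, e, rfl, he⟩
  rw [MvPolynomial.X_pow_eq_monomial, MvPolynomial.X_pow_eq_monomial,
    MvPolynomial.C_mul_monomial, MvPolynomial.monomial_mul, mul_one, MvPolynomial.monomial_mul,
    mul_one, extFunctional_monomial, mul_comm, ← Algebra.smul_def, MvPolynomial.coeff_smul,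
    MvPolynomial.coeff_monomial, if_neg, smul_zero]
  intro h
  obtain ⟨s, hs, hs'⟩ := he j
  rw [← h, Finsupp.add_apply, Finsupp.single_eq_same, hs', add_comm] at hm
  have := le_card_of_pow_dvd_one_add_sum (Fact.out : p.Prime).two_le hm
  omega

theorem coeff_extFunctional_mul_X_pow (ℓ : P p n →ₗ[ZMod p] ZMod p) {N : ℕ}
    (q : MvPolynomial (Fin n) (MvPolynomial (Fin n) K)) (j a : Fin n) {m : Fin n →₀ ℕ}
    (hm : m j < N) (M : ℕ) :
    MvPolynomial.coeff m (extFunctional ℓ (MvPolynomial (Fin n) K)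
      (q * (MvPolynomial.C (MvPolynomial.X j ^ N) * MvPolynomial.X a ^ M))) = 0 := by
  rw [mul_left_comm, ← MvPolynomial.smul_eq_C_mul, map_smul, smul_eq_mul,
    MvPolynomial.X_pow_eq_monomial, MvPolynomial.coeff_monomial_mul', if_neg]
  intro h
  have := h j
  rw [Finsupp.single_eq_same] at this
  omega

/-- Multilinear expansion in the rows: choosing the summand `sⱼ` in row `j` gives the Moore
determinant with exponents `s`, with the factor `∏ⱼ tⱼ ^ p ^ sⱼ`. -/
theorem det_addPoly (B : ℕ) :
    (Matrix.of fun j a => addPoly p n K B j a).det =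
      ∑ s ∈ Fintype.piFinset fun _ : Fin n => Finset.range (B + 1),
        MvPolynomial.C (MvPolynomial.monomial (Finsupp.equivFunOnFinite.symm fun j => p ^ s j) 1) *
          MvPolynomial.map (algebraMap (ZMod p) (MvPolynomial (Fin n) K)) (mooreMatrix p s).det := by
  classical
  have h1 : (Matrix.of fun j a => addPoly p n K B j a).det = Matrix.detRowAlternating
      fun j => ∑ s ∈ Finset.range (B + 1),
        (MvPolynomial.C (MvPolynomial.X j ^ p ^ s) :
          MvPolynomial (Fin n) (MvPolynomial (Fin n) K)) •
          fun a : Fin n => (MvPolynomial.X a ^ p ^ s :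
            MvPolynomial (Fin n) (MvPolynomial (Fin n) K)) := by
    change Matrix.detRowAlternating _ = _
    congr 1
    funext j a
    simp [addPoly]
  rw [h1]
  erw [MultilinearMap.map_sum_finset]
  refine Finset.sum_congr rfl fun s _ => ?_
  erw [MultilinearMap.map_smul_univ]
  rw [smul_eq_mul]
  congr 1
  · rw [← map_prod, MvPolynomial.monomial_eq, Finsupp.prod_fintype _ _ (by simp), map_one, one_mul]
    rfl
  · rw [RingHom.map_det]
    change Matrix.det _ = _
    congr 1
    ext1 j a
    simp [mooreMatrix]

/-- The `(p - 1)`-st power of the expansion is a sum over `(p - 1)`-tuples of exponent vectors. By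
`eq_of_sum_pow_eq` only the constant tuple `g` contributes to the monomial with exponents `(p - 1) p
^ gⱼ`. -/
theorem coeff_extFunctional_det_pow [Fact p.Prime] (ℓ : P p n →ₗ[ZMod p] ZMod p) {B : ℕ}
    {g : Fin n → ℕ} (hg : ∀ j, g j ≤ B) :
    MvPolynomial.coeff (Finsupp.equivFunOnFinite.symm fun j => (p - 1) * p ^ g j)
      (extFunctional ℓ (MvPolynomial (Fin n) K)
        ((Matrix.of fun j a => addPoly p n K B j a).det ^ (p - 1))) =
      algebraMap (ZMod p) K (ℓ ((mooreMatrix p g).det ^ (p - 1))) := by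
  classical
  have hp := (Fact.out : p.Prime)
  rw [det_addPoly, Finset.sum_pow', map_sum, MvPolynomial.coeff_sum,
    Finset.sum_eq_single fun _ => g]
  · rw [Finset.prod_const, mul_pow, ← MvPolynomial.C_pow, ← map_pow (MvPolynomial.map _), extFunctional_C_mul_map, mul_comm,
      ← Algebra.smul_def, MvPolynomial.coeff_smul, MvPolynomial.monomial_pow, one_pow,
      MvPolynomial.coeff_monomial, if_pos, Algebra.algebraMap_eq_smul_one, Finset.card_univ,
      Fintype.card_fin]
    rw [Finset.card_univ, Fintype.card_fin]
    ext j
    simp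
  · intro x _ hx
    rw [Finset.prod_mul_distrib, ← map_prod, ← map_prod, extFunctional_C_mul_map, mul_comm,
      ← Algebra.smul_def, MvPolynomial.coeff_smul, ← MvPolynomial.monomial_sum_one,
      MvPolynomial.coeff_monomial, if_neg, smul_zero]
    intro h
    refine hx (funext fun k => funext fun j => ?_)
    refine eq_of_sum_pow_eq hp.two_le (x := fun k => x k j) ?_ k
    have := DFunLike.congr_fun h j
    rw [Finsupp.finsetSum_apply] at this
    exact this
  · intro h
    refine absurd ?_ h
    simp only [Fintype.mem_piFinset, Finset.mem_range]
    exact fun _ j => Nat.lt_succ_of_le (hg j)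

end

/-- A space of polynomials that is stable under the reduced powers and contains a nonzero
invariant homogeneous polynomial of positive degree contains the powers
`det (yₐ ^ p ^ gⱼ) ^ (p - 1)` with all `gⱼ` large. -/
theorem exists_mooreMatrix_det_pow_mem [Fact p.Prime] {N : Submodule (ZMod p) (P p n)}
    (hN : ∀ k, ∀ z ∈ N, polyPower p n k z ∈ N) {h : P p n} (hh : h ∈ N) {d : ℕ}
    (hd : h.IsHomogeneous d) (hd0 : 0 < d) (h0 : h ≠ 0)
    (hinv : ∀ g : GL (Fin n) (ZMod p), polyAct (g : Matrix (Fin n) (Fin n) (ZMod p)) h = h) :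
    ∃ G : ℕ, ∀ g : Fin n → ℕ, (∀ j, G ≤ g j) → (mooreMatrix p g).det ^ (p - 1) ∈ N := by
  classical
  have hp := (Fact.out : p.Prime)
  let K := AlgebraicClosure (ZMod p)
  obtain ⟨ι, _, c, α, H⟩ := exists_sum_eq_det_pow (K := K) hd hd0 h0 hinv
  let Wdet : MvPolynomial (Fin n × Fin n) K :=
    (Matrix.of fun j a : Fin n => MvPolynomial.X (j, a)).det
  let S : MvPolynomial (Fin n × Fin n) K :=
    (∑ l, MvPolynomial.C (c l) * MvPolynomial.aeval
      (fun a => ∑ j, MvPolynomial.C (α l j) * MvPolynomial.X (j, a)) h) - Wdet ^ (p - 1)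
  -- The polynomial `S` vanishes at all matrices over `𝔽_p`, so it is a combination of the products
  -- `∏_{c ∈ 𝔽_p} (Xⱼₐ - c) = Xⱼₐ ^ p - Xⱼₐ`.
  obtain ⟨q, -, hq⟩ := MvPolynomial.combinatorial_nullstellensatz_exists_linearCombination
    (fun _ : Fin n × Fin n => Finset.univ.image (algebraMap (ZMod p) K))
    (fun _ => ⟨0, Finset.mem_image.2 ⟨0, Finset.mem_univ _, map_zero _⟩⟩) S (by
      intro x hx
      choose W hW using fun i => Finset.mem_image.1 (hx i)
      have h1 := H (Matrix.of fun j a => W (j, a))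
      rw [map_sub, sub_eq_zero, map_sum, map_pow]
      have h2 : MvPolynomial.eval x Wdet =
          algebraMap (ZMod p) K (Matrix.of fun j a => W (j, a)).det := by
        rw [RingHom.map_det, RingHom.map_det]
        congr 1
        ext1 j a
        simp [hW]
      rw [h2, ← map_pow, ← h1]
      refine Finset.sum_congr rfl fun l _ => ?_
      rw [map_mul, MvPolynomial.eval_C]
      congr 1
      have h3 : (MvPolynomial.eval x).comp (MvPolynomial.aeval (R := ZMod p)
          (fun a : Fin n => ∑ j, MvPolynomial.C (α l j) * MvPolynomial.X (j, a))).toRingHom =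
          (MvPolynomial.aeval (R := ZMod p)
            (fun a : Fin n => ∑ j, α l j * algebraMap (ZMod p) K (W (j, a)))).toRingHom := by
        refine MvPolynomial.ringHom_ext' (RingHom.ext_zmod _ _) fun a => ?_
        simp [hW]
      exact RingHom.congr_fun h3 h)
  choose D hD using fun x => exists_aeval_addPoly_mem_sumPowSpan (p := p) (q x)
  -- This exceeds every `D x` and depends only on `h` and the choices made for it, not on `g`.
  refine ⟨(∑ x, D x) + 1, fun g hg => ?_⟩
  by_contra hmem
  -- If the power of the determinant were not in `N`, a functional would separate it from `N`.
  obtain ⟨ℓ, hℓ, hker⟩ := Submodule.exists_le_ker_of_notMem hmem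
  refine hℓ ?_
  have hℓ' : ∀ z ∈ N, ℓ z = 0 := fun z hz => hker hz
  let B := ∑ j, g j
  have hgB : ∀ j, g j ≤ B := fun j => Finset.single_le_sum (fun _ _ => Nat.zero_le _)
    (Finset.mem_univ j)
  let Θ : MvPolynomial (Fin n × Fin n) K →ₐ[K] MvPolynomial (Fin n) (MvPolynomial (Fin n) K) :=
    MvPolynomial.aeval fun x => addPoly p n K B x.1 x.2
  let m : Fin n →₀ ℕ := Finsupp.equivFunOnFinite.symm fun j => (p - 1) * p ^ g j
  have hdet : Θ Wdet = (Matrix.of fun j a => addPoly p n K B j a).det := by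
    rw [AlgHom.map_det]
    congr 1
    ext1 j a
    simp [Θ]
  have hsum : ∀ l, extFunctional ℓ (MvPolynomial (Fin n) K) (Θ (MvPolynomial.aeval
      (fun a => ∑ j, MvPolynomial.C (α l j) * MvPolynomial.X (j, a)) h)) = 0 := by
    intro l
    rw [← extFunctional_addSubst_linear_eq_zero hN hℓ' B (α l) hh hd hd0]
    congr 1
    have h3 : Θ.toRingHom.comp (MvPolynomial.aeval (R := ZMod p)
        (fun a : Fin n => ∑ j, MvPolynomial.C (α l j) * MvPolynomial.X (j, a))).toRingHom =
        (addSubst p n B fun s => ∑ j, MvPolynomial.C (α l j) *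
          MvPolynomial.X j ^ p ^ s).toRingHom := by
      refine MvPolynomial.ringHom_ext' (RingHom.ext_zmod _ _) fun a => ?_
      simp only [RingHom.comp_apply, AlgHom.toRingHom_eq_coe, RingHom.coe_coe, MvPolynomial.aeval_X, addSubst, map_sum,
        map_mul, Θ, addPoly, Finset.mul_sum, Finset.sum_mul]
      rw [Finset.sum_comm]
      refine Finset.sum_congr rfl fun s _ => Finset.sum_congr rfl fun j _ => ?_
      rw [MvPolynomial.aeval_C, mul_assoc]
      rfl
    exact RingHom.congr_fun h3 h
  have hS : MvPolynomial.coeff m (extFunctional ℓ (MvPolynomial (Fin n) K) (Θ S)) =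
      - algebraMap (ZMod p) K (ℓ ((mooreMatrix p g).det ^ (p - 1))) := by
    rw [map_sub, map_sub, map_sum, map_sum, Finset.sum_eq_zero, zero_sub, MvPolynomial.coeff_neg,
      map_pow, hdet, coeff_extFunctional_det_pow ℓ hgB]
    intro l _
    rw [← MvPolynomial.smul_eq_C_mul, map_smul, LinearMap.map_smul_of_tower, hsum, smul_zero]
  have hS0 : MvPolynomial.coeff m (extFunctional ℓ (MvPolynomial (Fin n) K) (Θ S)) = 0 := by
    rw [hq, Finsupp.linearCombination_apply, Finsupp.sum, map_sum, map_sum, MvPolynomial.coeff_sum]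
    refine Finset.sum_eq_zero fun x _ => ?_
    rw [smul_eq_mul, map_mul, Finset.prod_image fun a _ b _ hab =>
      (algebraMap (ZMod p) K).injective hab, map_prod]
    have h4 : ∀ a : ZMod p, Θ (MvPolynomial.X x - MvPolynomial.C (algebraMap (ZMod p) K a)) =
        addPoly p n K B x.1 x.2 - algebraMap (ZMod p) _ a := by
      intro a
      rw [map_sub, ← MvPolynomial.algebraMap_eq, AlgHom.commutes, ← IsScalarTower.algebraMap_apply]
      simp [Θ]
    simp only [h4]
    -- Both parts of the telescoped difference miss the monomial `m`: `tⱼ ^ p ^ (B + 1)` exceeds its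
    -- exponent `(p - 1) p ^ gⱼ`, while the part with `tⱼ` has exponents not divisible by `p ^ G`.
    rw [prod_sub_algebraMap, addPoly_pow_sub, mul_sub, map_sub, MvPolynomial.coeff_sub,
      coeff_extFunctional_mul_X_pow, coeff_extFunctional_mul_X ℓ (G := (∑ x, D x) + 1) _ (hD x B),
      sub_zero]
    · exact Dvd.dvd.mul_left (pow_dvd_pow p (hg x.1)) _
    · exact Nat.lt_succ_of_le (Finset.single_le_sum (fun _ _ => Nat.zero_le _)
        (Finset.mem_univ x))
    · change (p - 1) * p ^ g x.1 < p ^ (B + 1)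
      calc (p - 1) * p ^ g x.1 ≤ (p - 1) * p ^ B :=
            Nat.mul_le_mul_left _ (Nat.pow_le_pow_right hp.pos (hgB x.1))
        _ < p * p ^ B := Nat.mul_lt_mul_of_pos_right (Nat.sub_lt hp.pos one_pos)
            (Nat.pow_pos hp.pos)
        _ = p ^ (B + 1) := (pow_succ' p B).symm
  rw [hS, neg_eq_zero] at hS0
  exact (algebraMap (ZMod p) K).injective (by rw [hS0, map_zero])

/-! ### Divisibility by linear forms -/

/-- The linear form `∑ᵢ vᵢ yᵢ`. -/
def linForm (v : Fin n → ZMod p) : P p n := ∑ i, v i • MvPolynomial.X i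

theorem linForm_isHomogeneous (v : Fin n → ZMod p) : (linForm v).IsHomogeneous 1 :=
  MvPolynomial.IsHomogeneous.sum _ _ _ fun i _ => by
    rw [MvPolynomial.smul_eq_C_mul]
    exact (MvPolynomial.isHomogeneous_X _ _).C_mul _

theorem coeff_linForm (v : Fin n → ZMod p) (i : Fin n) :
    MvPolynomial.coeff (Finsupp.single i 1) (linForm v) = v i := by
  simp [linForm, MvPolynomial.coeff_sum, MvPolynomial.coeff_X, Finsupp.single_left_inj]

theorem linForm_single (i : Fin n) : linForm (Pi.single i 1 : Fin n → ZMod p) =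
    MvPolynomial.X i := by
  rw [linForm, Finset.sum_eq_single i]
  · simp
  · intro j _ hj
    simp [hj]
  · simp

theorem linForm_ne_zero {v : Fin n → ZMod p} (hv : v ≠ 0) : linForm v ≠ 0 := by
  obtain ⟨i, hi⟩ := Function.ne_iff.1 hv
  intro h
  refine hi ?_
  rw [← coeff_linForm v i, h, MvPolynomial.coeff_zero]
  rfl

theorem linForm_irreducible [Fact p.Prime] {v : Fin n → ZMod p} (hv : v ≠ 0) :
    Irreducible (linForm v) := by
  refine MvPolynomial.irreducible_of_totalDegree_eq_one
    ((linForm_isHomogeneous v).totalDegree (linForm_ne_zero hv)) fun x hx => ?_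
  obtain ⟨i, hi⟩ := Function.ne_iff.1 hv
  have := hx (Finsupp.single i 1)
  rw [coeff_linForm] at this
  rw [isUnit_iff_ne_zero]
  rintro rfl
  exact hi (zero_dvd_iff.1 this)

theorem exists_eq_smul_of_linForm_dvd [Fact p.Prime] {v w : Fin n → ZMod p} (hv : v ≠ 0)
    (hw : w ≠ 0) (h : linForm v ∣ linForm w) : ∃ c : ZMod p, w = c • v := by
  obtain ⟨q, hq⟩ := h
  have hq0 : q ≠ 0 := by
    rintro rfl
    rw [mul_zero] at hq
    exact linForm_ne_zero hw hq
  have hdeg := congrArg MvPolynomial.totalDegree hq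
  rw [MvPolynomial.totalDegree_mul_of_isDomain (linForm_ne_zero hv) hq0,
    (linForm_isHomogeneous v).totalDegree (linForm_ne_zero hv),
    (linForm_isHomogeneous w).totalDegree (linForm_ne_zero hw)] at hdeg
  have hC := MvPolynomial.totalDegree_eq_zero_iff_eq_C.1 (show q.totalDegree = 0 by omega)
  refine ⟨MvPolynomial.coeff 0 q, funext fun i => ?_⟩
  rw [hC, mul_comm] at hq
  rw [← coeff_linForm w i, hq, MvPolynomial.coeff_C_mul, coeff_linForm]
  rfl

/-- Linear forms that are not proportional are non-associated irreducibles, so their powers are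
relatively prime. -/
theorem prod_linForm_pow_dvd [Fact p.Prime] {ι : Type*} [Fintype ι] {V : ι → Fin n → ZMod p}
    (hV : ∀ i, V i ≠ 0) (hV' : ∀ i j, i ≠ j → ∀ c : ZMod p, V j ≠ c • V i) {e : ι → ℕ} {f : P p n}
    (h : ∀ i, linForm (V i) ^ e i ∣ f) : ∏ i, linForm (V i) ^ e i ∣ f := by
  refine Fintype.prod_dvd_of_isRelPrime (fun i j hij => ?_) h
  refine IsRelPrime.pow ?_
  rw [(linForm_irreducible (hV i)).isRelPrime_iff_not_dvd]
  intro hd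
  obtain ⟨c, hc⟩ := exists_eq_smul_of_linForm_dvd (hV i) (hV j) hd
  exact hV' i j hij c hc

theorem prod_linForm_pow_isHomogeneous {ι : Type*} [Fintype ι] (V : ι → Fin n → ZMod p)
    (e : ι → ℕ) : (∏ i, linForm (V i) ^ e i).IsHomogeneous (∑ i, e i) :=
  MvPolynomial.IsHomogeneous.prod _ _ _ fun i _ => by
    simpa only [one_mul] using (linForm_isHomogeneous (V i)).pow (e i)

theorem le_of_dvd_of_isHomogeneous [Fact p.Prime] {q f : P p n} {a b : ℕ} (hq : q.IsHomogeneous a)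
    (hf : f.IsHomogeneous b) (hf0 : f ≠ 0) (h : q ∣ f) : a ≤ b := by
  obtain ⟨u, rfl⟩ := h
  have hq0 := left_ne_zero_of_mul hf0
  have hu0 := right_ne_zero_of_mul hf0
  rw [← hf.totalDegree hf0, MvPolynomial.totalDegree_mul_of_isDomain hq0 hu0, hq.totalDegree hq0]
  exact Nat.le_add_right _ _

theorem eq_smul_of_dvd_of_isHomogeneous [Fact p.Prime] {q f : P p n} {a : ℕ}
    (hq : q.IsHomogeneous a) (hf : f.IsHomogeneous a) (h : q ∣ f) : ∃ c : ZMod p, f = c • q := by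
  obtain ⟨u, rfl⟩ := h
  by_cases hf0 : q * u = 0
  · exact ⟨0, by rw [hf0, zero_smul]⟩
  have hq0 := left_ne_zero_of_mul hf0
  have hu0 := right_ne_zero_of_mul hf0
  have := MvPolynomial.totalDegree_mul_of_isDomain hq0 hu0
  rw [hf.totalDegree hf0, hq.totalDegree hq0] at this
  have hC := MvPolynomial.totalDegree_eq_zero_iff_eq_C.1 (show u.totalDegree = 0 by omega)
  exact ⟨MvPolynomial.coeff 0 u, by rw [MvPolynomial.smul_eq_C_mul, mul_comm, ← hC]⟩

theorem X_pow_dvd_of_le {f : P p n} {k : Fin n} {e : ℕ} (h : ∀ m ∈ f.support, e ≤ m k) :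
    MvPolynomial.X k ^ e ∣ f := by
  rw [MvPolynomial.X_pow_eq_monomial, MvPolynomial.monomial_one_dvd_iff_modMonomial_eq_zero]
  ext m
  rw [MvPolynomial.coeff_zero]
  by_cases hm : Finsupp.single k e ≤ m
  · exact MvPolynomial.coeff_modMonomial_of_le _ hm
  · rw [MvPolynomial.coeff_modMonomial_of_not_le _ hm]
    by_contra h0
    exact hm (Finsupp.single_le_iff.2 (h m (MvPolynomial.mem_support_iff.2 h0)))

/-! ### Column matrices -/

/-- The substitution of `∑ᵢ vᵢ yᵢ` for `yₖ`. -/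
def colMatrix (k : Fin n) (v : Fin n → ZMod p) : Matrix (Fin n) (Fin n) (ZMod p) :=
  Matrix.updateCol 1 k v

theorem colMatrix_det (k : Fin n) (v : Fin n → ZMod p) : (colMatrix k v).det = v k := by
  rw [colMatrix, ← Matrix.cramer_apply, Matrix.cramer_one]
  rfl

theorem act_colMatrix [Fact p.Prime] {k : Fin n} {v : Fin n → ZMod p} (hv : v k ≠ 0) {z : H p n}
    (hz : z ∈ D p n) : act (colMatrix k v) z = z :=
  mem_D.1 hz (Matrix.GeneralLinearGroup.mkOfDetNeZero (colMatrix k v) (by rwa [colMatrix_det]))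

theorem polyAct_X (g : Matrix (Fin n) (Fin n) (ZMod p)) (j : Fin n) :
    polyAct g (MvPolynomial.X j) = linForm fun i => g i j := MvPolynomial.aeval_X _ _

theorem polyAct_colMatrix_X_self (k : Fin n) (v : Fin n → ZMod p) :
    polyAct (colMatrix k v) (MvPolynomial.X k) = linForm v := by
  rw [polyAct_X]
  congr 1
  funext i
  simp [colMatrix]

theorem polyAct_colMatrix_X_of_ne {j k : Fin n} (h : j ≠ k) (v : Fin n → ZMod p) :
    polyAct (colMatrix k v) (MvPolynomial.X j) = MvPolynomial.X j := by
  rw [polyAct_X, ← linForm_single]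
  congr 1
  funext i
  rw [colMatrix, Matrix.updateCol_ne h, Matrix.one_apply, Pi.single_apply]

theorem pderivX_act_colMatrix_self (k : Fin n) (v : Fin n → ZMod p) (z : H p n) :
    pderivX k (act (colMatrix k v) z) = v k • act (colMatrix k v) (pderivX k z) := by
  rw [pderivX_act, Finset.sum_eq_single k]
  · rw [colMatrix, Matrix.updateCol_self]
  · intro j _ hj
    rw [colMatrix, Matrix.updateCol_ne hj, Matrix.one_apply_ne hj.symm, zero_smul]
  · simp

theorem pderivX_act_colMatrix_of_ne {i k : Fin n} (h : i ≠ k) (v : Fin n → ZMod p) (z : H p n) :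
    pderivX i (act (colMatrix k v) z) = act (colMatrix k v) (pderivX i z) +
      v i • act (colMatrix k v) (pderivX k z) := by
  rw [pderivX_act, Finset.sum_eq_add_of_mem i k (Finset.mem_univ _) (Finset.mem_univ _) h]
  · conv_lhs => rw [colMatrix, Matrix.updateCol_self, Matrix.updateCol_ne h, Matrix.one_apply_eq,
      one_smul]
    rfl
  · rintro j _ ⟨hji, hjk⟩
    rw [colMatrix, Matrix.updateCol_ne hjk, Matrix.one_apply_ne hji.symm, zero_smul]

theorem pderivX_pderivList_act_colMatrix {k : Fin n} {S : List (Fin n)} (hk : k ∉ S)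
    (v : Fin n → ZMod p) (z : H p n) :
    pderivX k (pderivList S (act (colMatrix k v) z)) =
      v k • act (colMatrix k v) (pderivX k (pderivList S z)) := by
  induction S with
  | nil => exact pderivX_act_colMatrix_self k v z
  | cons s S ih =>
    rw [List.mem_cons, not_or] at hk
    rw [pderivList_cons, pderivX_comm, ih hk.2, map_smul,
      pderivX_act_colMatrix_of_ne (Ne.symm hk.1), pderivX_pderivX, map_zero, smul_zero, add_zero,
      pderivList_cons, pderivX_comm k s, map_neg, smul_neg]

/-- The substitution adds to each `∂/∂xᵢ` with `i ≠ k` only a multiple of `∂/∂xₖ`, and these terms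
die because `∂/∂xₖ` already occurs in `S` and squares to zero. -/
theorem pderivList_act_colMatrix_of_mem {k : Fin n} {S : List (Fin n)} (hS : S.Nodup) (hk : k ∈ S)
    (v : Fin n → ZMod p) (z : H p n) :
    pderivList S (act (colMatrix k v) z) = v k • act (colMatrix k v) (pderivList S z) := by
  induction S with
  | nil => simp at hk
  | cons s S ih =>
    rw [List.nodup_cons] at hS
    by_cases hsk : s = k
    · subst hsk
      exact pderivX_pderivList_act_colMatrix hS.1 v z
    · have hkS : k ∈ S := (List.mem_cons.1 hk).resolve_left (Ne.symm hsk)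
      rw [pderivList_cons, ih hS.2 hkS, map_smul, pderivX_act_colMatrix_of_ne hsk,
        pderivX_pderivList_of_mem hkS, map_zero, smul_zero, add_zero, pderivList_cons]

theorem pderivList_act_colMatrix_of_notMem {k : Fin n} {S : List (Fin n)} (hk : k ∉ S)
    {v : Fin n → ZMod p} (hv : ∀ s ∈ S, v s = 0) (z : H p n) :
    pderivList S (act (colMatrix k v) z) = act (colMatrix k v) (pderivList S z) := by
  induction S with
  | nil => rfl
  | cons s S ih =>
    rw [List.mem_cons, not_or] at hk
    rw [pderivList_cons, ih hk.2 fun t ht => hv t (List.mem_cons_of_mem _ ht),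
      pderivX_act_colMatrix_of_ne (Ne.symm hk.1), hv s List.mem_cons_self, zero_smul, add_zero,
      pderivList_cons]

/-! ### Divisibility of the coefficients of an invariant -/

section

variable [Fact p.Prime] {z : H p n} {S : List (Fin n)} {k : Fin n} {v : Fin n → ZMod p}

theorem coeffX_eq_smul_polyAct_of_mem (hz : z ∈ D p n) (hS : S.Nodup) (hk : k ∈ S)
    (hv : v k ≠ 0) : coeffX S z = v k • polyAct (colMatrix k v) (coeffX S z) := by
  conv_lhs => rw [← act_colMatrix hv hz]
  rw [coeffX, LinearMap.comp_apply, pderivList_act_colMatrix_of_mem hS hk, map_smul, polyPart_act]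
  rfl

theorem coeffX_eq_polyAct_of_notMem (hz : z ∈ D p n) (hk : k ∉ S) (hv : v k ≠ 0)
    (hvS : ∀ s ∈ S, v s = 0) : coeffX S z = polyAct (colMatrix k v) (coeffX S z) := by
  conv_lhs => rw [← act_colMatrix hv hz]
  rw [coeffX, LinearMap.comp_apply, pderivList_act_colMatrix_of_notMem hk hvS, polyPart_act]
  rfl

theorem coeff_polyAct_colMatrix_single (k : Fin n) (c : ZMod p) (f : P p n) (m : Fin n →₀ ℕ) :
    MvPolynomial.coeff m (polyAct (colMatrix k (Pi.single k c)) f) =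
      c ^ m k * MvPolynomial.coeff m f := by
  have hX : ∀ j, polyAct (colMatrix k (Pi.single k c)) (MvPolynomial.X j : P p n) =
      MvPolynomial.C (if j = k then c else 1) * MvPolynomial.X j := by
    intro j
    split_ifs with h
    · subst h
      rw [polyAct_colMatrix_X_self, linForm, Finset.sum_eq_single j]
      · rw [Pi.single_eq_same, MvPolynomial.smul_eq_C_mul]
      · intro i _ hi
        rw [Pi.single_eq_of_ne hi, zero_smul]
      · simp
    · rw [polyAct_colMatrix_X_of_ne h, map_one, one_mul]
  induction f using MvPolynomial.induction_on' with
  | monomial u a =>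
    have h1 : polyAct (colMatrix k (Pi.single k c)) (MvPolynomial.monomial u a) =
        MvPolynomial.monomial u (c ^ u k * a) := by
      rw [MvPolynomial.monomial_eq, map_mul, Finsupp.prod_fintype _ _ (by simp), map_prod]
      simp only [map_pow, hX, mul_pow, Finset.prod_mul_distrib]
      rw [MvPolynomial.monomial_eq, Finsupp.prod_fintype _ _ (by simp), ← mul_assoc]
      congr 1
      simp only [← map_pow]
      rw [← map_prod, ← MvPolynomial.algebraMap_eq, AlgHom.commutes, ← map_mul, mul_comm]
      congr 2
      simp [ite_pow]
    rw [h1, MvPolynomial.coeff_monomial, MvPolynomial.coeff_monomial]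
    split_ifs with h
    · rw [h]
    · rw [mul_zero]
  | add f g hf hg => rw [map_add, MvPolynomial.coeff_add, hf, hg, MvPolynomial.coeff_add, mul_add]

theorem dvd_of_pow_mul_eq {a : ZMod p} (ha : a ≠ 0) {e : ℕ}
    (h : ∀ c : ZMod p, c ≠ 0 → c ^ e * a = a) : p - 1 ∣ e := by
  have := (FiniteField.forall_pow_eq_one_iff (ZMod p) e).1 fun x => by
    ext
    rw [Units.val_pow_eq_pow_val, Units.val_one]
    exact mul_right_cancel₀ ha (by rw [h x x.ne_zero, one_mul])
  rwa [ZMod.card] at this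

/-- Scaling the `k`-th variables by `c` multiplies the monomial by `c ^ m k`, and `xₖ` contributes
one more factor `c`. So `c ^ (m k + 1) = 1` for every unit `c`. -/
theorem dvd_exponent_of_mem (hz : z ∈ D p n) (hS : S.Nodup) (hk : k ∈ S) {m : Fin n →₀ ℕ}
    (hm : m ∈ (coeffX S z).support) : p - 1 ∣ m k + 1 := by
  refine dvd_of_pow_mul_eq (MvPolynomial.mem_support_iff.1 hm) fun c hc => ?_
  have h := congrArg (MvPolynomial.coeff m)
    (coeffX_eq_smul_polyAct_of_mem hz hS hk (v := Pi.single k c) (by rwa [Pi.single_eq_same]))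
  rw [MvPolynomial.coeff_smul, coeff_polyAct_colMatrix_single, Pi.single_eq_same, smul_eq_mul,
    ← mul_assoc, ← pow_succ'] at h
  exact h.symm

theorem dvd_exponent_of_notMem (hz : z ∈ D p n) (hk : k ∉ S) {m : Fin n →₀ ℕ}
    (hm : m ∈ (coeffX S z).support) : p - 1 ∣ m k := by
  refine dvd_of_pow_mul_eq (MvPolynomial.mem_support_iff.1 hm) fun c hc => ?_
  have hvS : ∀ s ∈ S, (Pi.single k c : Fin n → ZMod p) s = 0 := fun s hs =>
    Pi.single_eq_of_ne (fun h : s = k => hk (h ▸ hs)) _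
  have h := congrArg (MvPolynomial.coeff m) (coeffX_eq_polyAct_of_notMem hz hk
    (v := Pi.single k c) (by rwa [Pi.single_eq_same]) hvS)
  rw [coeff_polyAct_colMatrix_single] at h
  exact h.symm

/-- If `S` is not empty, then the variables outside of `S` divide the coefficient at `S` of an
invariant. -/
theorem X_dvd_coeffX (hz : z ∈ D p n) (hS : S.Nodup) (hS0 : S ≠ []) {b : Fin n} (hb : b ∉ S) :
    MvPolynomial.X b ∣ coeffX S z := by
  cases S with
  | nil => exact absurd rfl hS0
  | cons s S =>
    rw [List.nodup_cons] at hS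
    rw [List.mem_cons, not_or] at hb
    set v : Fin n → ZMod p := Pi.single s 1 + Pi.single b 1
    have hvs : v s = 1 := by simp [v, Ne.symm hb.1]
    have hvb : v b = 1 := by simp [v, hb.1]
    have hvS : ∀ t ∈ S, v t = 0 := by
      intro t ht
      have h1 : t ≠ s := fun h => hS.1 (h ▸ ht)
      have h2 : t ≠ b := fun h => hb.2 (h ▸ ht)
      simp [v, h1, h2]
    set g := colMatrix s v
    -- The substitution `g` replaces the `s`-th variable by the sum of the `s`-th and the `b`-th.
    -- Invariance expresses the coefficient at `s :: S` through differences `g q - q`, which are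
    -- divisible by `y_b` because `g` is the identity modulo `y_b`.
    have h1 : coeffX (b :: S) z = polyAct g (coeffX (b :: S) z + coeffX (s :: S) z) := by
      conv_lhs => rw [← act_colMatrix (k := s) (v := v) (by rw [hvs]; exact one_ne_zero) hz]
      rw [coeffX, LinearMap.comp_apply, pderivList_cons,
        pderivList_act_colMatrix_of_notMem hS.1 hvS, pderivX_act_colMatrix_of_ne hb.1, hvb,
        one_smul, ← map_add, polyPart_act, map_add]
      rfl
    have hmod : ∀ q : P p n, MvPolynomial.X b ∣ polyAct g q - q := by
      let π := Ideal.Quotient.mk (Ideal.span {(MvPolynomial.X b : P p n)})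
      have h2 : π.comp (polyAct g).toRingHom = π := by
        refine MvPolynomial.ringHom_ext' (RingHom.ext_zmod _ _) fun j => ?_
        change π (polyAct g (MvPolynomial.X j)) = π (MvPolynomial.X j)
        by_cases hj : j = s
        · subst hj
          have h3 : linForm v = MvPolynomial.X j + MvPolynomial.X b := by
            rw [← linForm_single, ← linForm_single]
            simp only [linForm, v, Pi.add_apply, add_smul, Finset.sum_add_distrib]
          rw [polyAct_colMatrix_X_self, h3, map_add, add_eq_left,
            Ideal.Quotient.eq_zero_iff_dvd]
        · rw [polyAct_colMatrix_X_of_ne hj]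
      intro q
      rw [← Ideal.Quotient.eq_zero_iff_dvd, map_sub, sub_eq_zero]
      exact RingHom.congr_fun h2 q
    have h2 : coeffX (s :: S) z = -(polyAct g (coeffX (b :: S) z) - coeffX (b :: S) z) -
        (polyAct g (coeffX (s :: S) z) - coeffX (s :: S) z) := by
      rw [map_add] at h1
      linear_combination -h1
    rw [h2]
    exact dvd_sub ((dvd_neg).2 (hmod _)) (hmod _)

/-- The exponents of `y_b` are divisible by `p - 1`, and they are positive by `X_dvd_coeffX`. -/
theorem X_pow_dvd_coeffX (hz : z ∈ D p n) (hS : S.Nodup) (hS0 : S ≠ []) {b : Fin n}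
    (hb : b ∉ S) : MvPolynomial.X b ^ (p - 1) ∣ coeffX S z := by
  refine X_pow_dvd_of_le fun m hm => Nat.le_of_dvd ?_ (dvd_exponent_of_notMem hz hb hm)
  have h := MvPolynomial.X_dvd_iff_modMonomial_eq_zero.1 (X_dvd_coeffX hz hS hS0 hb)
  rw [Nat.pos_iff_ne_zero]
  intro h0
  refine MvPolynomial.mem_support_iff.1 hm ?_
  rw [← MvPolynomial.coeff_modMonomial_of_not_le (s := Finsupp.single b 1), h,
    MvPolynomial.coeff_zero]
  rw [Finsupp.single_le_iff]
  omega

/-- Invariance carries divisibility by a power of a variable to other linear forms. If `v` has a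
nonzero coordinate in `S`, start from such a variable, whose exponents are at least `p - 2` since `p
- 1` divides their successors. Otherwise start from a variable outside `S`, where even the power `p
- 1` divides. -/
theorem linForm_pow_dvd_coeffX (hz : z ∈ D p n) (hS : S.Nodup) (hS0 : S ≠ [])
    (hv : v ≠ 0) : linForm v ^ (p - 2) ∣ coeffX S z := by
  by_cases h : ∃ s ∈ S, v s ≠ 0
  · obtain ⟨s, hs, hvs⟩ := h
    have h1 : MvPolynomial.X s ^ (p - 2) ∣ coeffX S z := X_pow_dvd_of_le fun m hm => by
      have := Nat.le_of_dvd (Nat.succ_pos _) (dvd_exponent_of_mem hz hS hs hm)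
      omega
    rw [coeffX_eq_smul_polyAct_of_mem hz hS hs hvs, MvPolynomial.smul_eq_C_mul,
      ← polyAct_colMatrix_X_self s v, ← map_pow]
    exact Dvd.dvd.mul_left (map_dvd _ h1) _
  · push Not at h
    obtain ⟨k, hk⟩ := Function.ne_iff.1 hv
    have hkS : k ∉ S := fun hkS => hk (h k hkS)
    rw [coeffX_eq_polyAct_of_notMem hz hkS hk h, ← polyAct_colMatrix_X_self k v, ← map_pow]
    exact map_dvd _ ((pow_dvd_pow _ (by omega)).trans (X_pow_dvd_coeffX hz hS hS0 hkS))

end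

/-! ### The bottom degree -/

/-- Representatives of the lines of `𝔽_pⁿ`: the vectors whose last nonzero coordinate is `1`. -/
def lineVec (i : Σ k : Fin n, (Fin k → ZMod p)) : Fin n → ZMod p := fun b =>
  if h : (b : ℕ) < i.1 then i.2 ⟨b, h⟩ else if b = i.1 then 1 else 0

theorem lineVec_self (i : Σ k : Fin n, (Fin k → ZMod p)) : lineVec i i.1 = 1 := by
  simp [lineVec]

theorem lineVec_of_lt {i : Σ k : Fin n, (Fin k → ZMod p)} {b : Fin n} (h : i.1 < b) :
    lineVec i b = 0 := by
  rw [lineVec, dif_neg (by have := Fin.lt_def.1 h; omega), if_neg h.ne']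

theorem lineVec_zero (k : Fin n) :
    lineVec (⟨k, 0⟩ : Σ k : Fin n, (Fin k → ZMod p)) = Pi.single k 1 := by
  funext b
  by_cases h : b = k
  · subst h
    rw [Pi.single_eq_same]
    exact lineVec_self ⟨b, 0⟩
  · rw [Pi.single_eq_of_ne h]
    simp [lineVec, h]

theorem lineVec_ne_zero [Fact p.Prime] (i : Σ k : Fin n, (Fin k → ZMod p)) : lineVec i ≠ 0 :=
  fun h => one_ne_zero ((lineVec_self i).symm.trans (congrFun h i.1))

theorem lineVec_ne_smul [Fact p.Prime] (i j : Σ k : Fin n, (Fin k → ZMod p)) (hij : i ≠ j)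
    (c : ZMod p) : lineVec j ≠ c • lineVec i := by
  intro h
  have h' : ∀ b, lineVec j b = c * lineVec i b := fun b => congrFun h b
  rcases lt_trichotomy i.1 j.1 with hlt | heq | hlt
  · have := h' j.1
    rw [lineVec_self, lineVec_of_lt hlt, mul_zero] at this
    exact one_ne_zero this
  · have hc := h' j.1
    rw [lineVec_self, ← heq, lineVec_self, mul_one] at hc
    refine hij ?_
    obtain ⟨k, a⟩ := i
    obtain ⟨l, b⟩ := j
    obtain rfl : k = l := heq
    congr 1
    funext t
    have := h' ⟨t, t.2.trans k.2⟩
    rw [← hc, one_mul] at this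
    simpa [lineVec] using this.symm
  · have := h' i.1
    rw [lineVec_self, lineVec_of_lt hlt, mul_one] at this
    rw [← this, zero_smul] at h
    exact lineVec_ne_zero j h

/-- The polynomial degree of the bottom class of the extended Dickson algebra. -/
def bottomPolyDegree (p n : ℕ) : ℕ := (p - 2) * ∑ k : Fin n, p ^ (k : ℕ)

theorem card_lines_mul [Fact p.Prime] :
    ∑ _i : (Σ k : Fin n, (Fin k → ZMod p)), (p - 2) = bottomPolyDegree p n := by
  rw [Finset.sum_const, Finset.card_univ, Fintype.card_sigma, smul_eq_mul, mul_comm]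
  simp only [Fintype.card_fun, ZMod.card, Fintype.card_fin]
  rfl

theorem sum_ite_notMem [Fact p.Prime] {S : List (Fin n)} (hS : S.Nodup) :
    ∑ i : (Σ k : Fin n, (Fin k → ZMod p)), (if i.2 = 0 ∧ i.1 ∉ S then 1 else 0) =
      n - S.length := by
  have h1 : ∀ k : Fin n, ∑ c : Fin k → ZMod p, (if c = 0 ∧ k ∉ S then 1 else 0) =
      if k ∉ S then 1 else 0 := by
    intro k
    split_ifs with h
    · simp [h]
    · simp [h]
  rw [Fintype.sum_sigma, Finset.sum_congr rfl fun k _ => h1 k, Finset.sum_boole]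
  have h2 : ({k : Fin n | k ∉ S} : Finset (Fin n)) = S.toFinsetᶜ := by
    ext k
    simp
  rw [h2, Nat.cast_id, Finset.card_compl, Fintype.card_fin, List.toFinset_card_of_nodup hS]

theorem prod_lineVec_dvd_coeffX [Fact p.Prime] {z : H p n} (hz : z ∈ D p n) {S : List (Fin n)}
    (hS : S.Nodup) (hS0 : S ≠ []) :
    ∏ i : (Σ k : Fin n, (Fin k → ZMod p)),
      linForm (lineVec i) ^ ((p - 2) + if i.2 = 0 ∧ i.1 ∉ S then 1 else 0) ∣ coeffX S z := by
  refine prod_linForm_pow_dvd lineVec_ne_zero lineVec_ne_smul fun i => ?_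
  split_ifs with h
  · obtain ⟨k, c⟩ := i
    obtain ⟨rfl : c = 0, hk⟩ := h
    have hp := (Fact.out : p.Prime).two_le
    rw [lineVec_zero, linForm_single, show p - 2 + 1 = p - 1 by omega]
    exact X_pow_dvd_coeffX hz hS hS0 hk
  · exact linForm_pow_dvd_coeffX hz hS hS0 (lineVec_ne_zero i)

/-- Each line of `𝔽_pⁿ` contributes `p - 2` to the degree, and each coordinate line outside `S`
contributes one more. -/
theorem le_degree_coeffX [Fact p.Prime] {z : H p n} (hz : z ∈ D p n) {S : List (Fin n)}
    (hS : S.Nodup) (hS0 : S ≠ []) {j : ℕ} (hj : (coeffX S z).IsHomogeneous j)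
    (h0 : coeffX S z ≠ 0) : bottomPolyDegree p n + (n - S.length) ≤ j := by
  have h := le_of_dvd_of_isHomogeneous (prod_linForm_pow_isHomogeneous _ _) hj h0
    (prod_lineVec_dvd_coeffX hz hS hS0)
  rwa [Finset.sum_add_distrib, card_lines_mul, sum_ite_notMem hS] at h

/-- In the bottom degree the coefficients are multiples of a fixed polynomial. -/
theorem coeffX_eq_smul [Fact p.Prime] {z : H p n} (hz : z ∈ D p n) {S : List (Fin n)}
    (hS : S.Nodup) (hS0 : S ≠ []) (hj : (coeffX S z).IsHomogeneous (bottomPolyDegree p n)) :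
    ∃ c : ZMod p, coeffX S z =
      c • ∏ i : (Σ k : Fin n, (Fin k → ZMod p)), linForm (lineVec i) ^ (p - 2) := by
  refine eq_smul_of_dvd_of_isHomogeneous ?_ hj
    (prod_linForm_pow_dvd lineVec_ne_zero lineVec_ne_smul fun i =>
      linForm_pow_dvd_coeffX hz hS hS0 (lineVec_ne_zero i))
  rw [← card_lines_mul]
  exact prod_linForm_pow_isHomogeneous _ _

/-- The vectors with `k`-th coordinate `1`. -/
def affineVec (k : Fin n) (c : {b : Fin n // b ≠ k} → ZMod p) : Fin n → ZMod p := fun b =>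
  if h : b = k then 1 else c ⟨b, h⟩

theorem affineVec_self (k : Fin n) (c : {b : Fin n // b ≠ k} → ZMod p) : affineVec k c k = 1 := by
  simp [affineVec]

/-- An invariant polynomial of positive degree `j` has `j ≥ (p - 1) pⁿ⁻¹`. -/
theorem le_degree_coeffX_nil [Fact p.Prime] {z : H p n} (hz : z ∈ D p n) {j : ℕ}
    (hj : (coeffX [] z).IsHomogeneous j) (h0 : coeffX [] z ≠ 0) (hj0 : 0 < j) :
    0 < n ∧ (p - 1) * p ^ (n - 1) ≤ j := by
  set f := coeffX [] z with hf
  obtain ⟨m, hm⟩ := MvPolynomial.ne_zero_iff.1 h0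
  obtain ⟨k, hk⟩ : ∃ k, m k ≠ 0 := by
    by_contra! h
    have h1 := hj hm
    rw [show m = 0 from Finsupp.ext h, map_zero] at h1
    omega
  refine ⟨Fin.pos k, ?_⟩
  -- The part of `f` that involves `yₖ`. The rest of `f` is fixed by substitutions for `yₖ`, so `u`
  -- inherits their invariance. As `yₖ ^ (p - 1)` divides `u`, so do the `(p - 1)`-st powers of all
  -- `p ^ (n - 1)` linear forms with `k`-th coefficient `1`.
  set u := f - f.modMonomial (Finsupp.single k 1) with hu
  have hcoeff : ∀ m' : Fin n →₀ ℕ, MvPolynomial.coeff m' u =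
      if m' k = 0 then 0 else MvPolynomial.coeff m' f := by
    intro m'
    rw [hu, MvPolynomial.coeff_sub]
    split_ifs with h
    · rw [MvPolynomial.coeff_modMonomial_of_not_le, sub_self]
      rw [Finsupp.single_le_iff]
      omega
    · rw [MvPolynomial.coeff_modMonomial_of_le, sub_zero]
      rw [Finsupp.single_le_iff]
      omega
  have hu0 : u ≠ 0 := by
    intro h
    have := hcoeff m
    rw [h, MvPolynomial.coeff_zero, if_neg hk] at this
    exact hm this.symm
  have huj : u.IsHomogeneous j := by
    intro m' hm'
    rw [hcoeff] at hm'
    exact hj (fun h => hm' (by rw [h, ite_self]))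
  have hX : MvPolynomial.X k ^ (p - 1) ∣ u := by
    refine X_pow_dvd_of_le fun m' hm' => ?_
    rw [MvPolynomial.mem_support_iff, hcoeff] at hm'
    have h1 : m' k ≠ 0 := fun h => hm' (if_pos h)
    rw [if_neg h1] at hm'
    exact Nat.le_of_dvd (Nat.pos_of_ne_zero h1)
      (dvd_exponent_of_notMem hz (k := k) (S := []) (by simp) (MvPolynomial.mem_support_iff.2 hm'))
  have hfix : ∀ (v : Fin n → ZMod p) (q : P p n), (∀ m' ∈ q.support, m' k = 0) →
      polyAct (colMatrix k v) q = q := by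
    intro v q hq
    rw [polyAct, MvPolynomial.aeval_def, MvPolynomial.eval₂_eq']
    conv_rhs => rw [MvPolynomial.as_sum q]
    refine Finset.sum_congr rfl fun m' hm' => ?_
    rw [MvPolynomial.monomial_eq, Finsupp.prod_fintype _ _ (by simp)]
    refine congrArg₂ _ rfl (Finset.prod_congr rfl fun i _ => ?_)
    by_cases hi : i = k
    · rw [hi, hq m' hm', pow_zero, pow_zero]
    · have := polyAct_colMatrix_X_of_ne hi v
      rw [polyAct, MvPolynomial.aeval_X] at this
      rw [this]
  have hinv : ∀ v : Fin n → ZMod p, v k ≠ 0 → polyAct (colMatrix k v) u = u := by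
    intro v hv
    rw [hu, map_sub, ← coeffX_eq_polyAct_of_notMem hz (by simp) hv (by simp), hfix]
    intro m' hm'
    by_contra h
    refine MvPolynomial.mem_support_iff.1 hm' (MvPolynomial.coeff_modMonomial_of_le _ ?_)
    rw [Finsupp.single_le_iff]
    omega
  have hdvd : ∏ c : ({b : Fin n // b ≠ k} → ZMod p), linForm (affineVec k c) ^ (p - 1) ∣ u := by
    refine prod_linForm_pow_dvd (fun c h => ?_) (fun c c' hcc a h => ?_) fun c => ?_
    · exact one_ne_zero ((affineVec_self k c).symm.trans (congrFun h k))
    · have h1 := congrFun h k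
      rw [Pi.smul_apply, affineVec_self, affineVec_self, smul_eq_mul, mul_one] at h1
      rw [← h1, one_smul] at h
      refine hcc (funext fun b => ?_)
      have h2 := congrFun h b
      rw [affineVec, affineVec, dif_neg b.2, dif_neg b.2] at h2
      exact h2.symm
    · rw [← hinv (affineVec k c) (by rw [affineVec_self]; exact one_ne_zero),
        ← polyAct_colMatrix_X_self k, ← map_pow]
      exact map_dvd _ hX
  have h := le_of_dvd_of_isHomogeneous (prod_linForm_pow_isHomogeneous _ _) huj hu0 hdvd
  rw [Finset.sum_const, Finset.card_univ, Fintype.card_fun, ZMod.card, Fintype.card_subtype_compl,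
    Fintype.card_fin, Fintype.card_subtype_eq, smul_eq_mul, mul_comm] at h
  exact h

theorem bottomPolyDegree_succ (p n : ℕ) :
    bottomPolyDegree p (n + 1) = bottomPolyDegree p n + (p - 2) * p ^ n := by
  simp only [bottomPolyDegree]
  rw [Fin.sum_univ_castSucc, mul_add]
  rfl

/-- This places the polynomial invariants of positive degree strictly above the bottom class, so
that only coefficients at nonempty lists matter there. -/
theorem bottomDegree_lt (hp : 2 ≤ p) (n : ℕ) :
    (n + 1) + 2 * bottomPolyDegree p (n + 1) < 2 * ((p - 1) * p ^ n) := by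
  obtain ⟨q, rfl⟩ := Nat.exists_eq_add_of_le hp
  induction n with
  | zero =>
    rw [bottomPolyDegree_succ]
    simp [bottomPolyDegree]
    omega
  | succ n ih =>
    rw [bottomPolyDegree_succ]
    rw [show 2 + q - 1 = q + 1 by omega] at ih ⊢
    rw [show 2 + q - 2 = q by omega]
    have h1 : 0 < (2 + q) ^ n := by positivity
    have h2 : (2 + q) ^ (n + 1) = (q + 1) * (2 + q) ^ n + (2 + q) ^ n := by ring
    have h3 : (q + 1) * (2 + q) ^ (n + 1) = q * (2 + q) ^ (n + 1) + (2 + q) ^ (n + 1) := by ring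
    omega

/-- Nonzero coefficients of an invariant of degree at most the bottom one. -/
theorem length_eq_of_coeffX_ne_zero [Fact p.Prime] {z : H p n} (hz : z ∈ D p n) {k : ℕ}
    (hzk : z ∈ degreePart p n k) (hk : 0 < k) (hkn : k ≤ n + 2 * bottomPolyDegree p n)
    {S : List (Fin n)} (h0 : coeffX S z ≠ 0) :
    S.length = n ∧ (coeffX S z).IsHomogeneous (bottomPolyDegree p n) ∧ 0 < n := by
  have hS := nodup_of_coeffX_ne_zero h0
  have hlen : S.length ≤ n := by simpa using hS.length_le_card
  obtain ⟨j, hj, hjh⟩ := exists_of_mem_coeffDegree (coeffX_mem_coeffDegree S hzk) h0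
  have hp := (Fact.out : p.Prime).two_le
  by_cases hS0 : S = []
  · subst hS0
    rw [List.length_nil] at hj
    obtain ⟨hn, h⟩ := le_degree_coeffX_nil hz hjh h0 (by omega)
    obtain ⟨m, rfl⟩ : ∃ m, n = m + 1 := ⟨n - 1, by omega⟩
    have := bottomDegree_lt hp m
    rw [Nat.add_sub_cancel] at h
    omega
  · have h := le_degree_coeffX hz hS hS0 hjh h0
    have h1 := List.length_pos_of_ne_nil hS0
    -- A variable missing from `S` lowers the exterior degree by `1` but raises twice the polynomial
    -- degree by at least `2`, so none can be missing.
    have h2 : j = bottomPolyDegree p n := by omega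
    exact ⟨by omega, h2 ▸ hjh, by omega⟩

/-- The extended Dickson algebra is at most one-dimensional in the bottom degree. -/
theorem exists_eq_smul_of_mem_degreePart [Fact p.Prime] {z w : H p n} (hz : z ∈ D p n)
    (hw : w ∈ D p n) {k : ℕ} (hzk : z ∈ degreePart p n k) (hwk : w ∈ degreePart p n k)
    (hk : 0 < k) (hkn : k ≤ n + 2 * bottomPolyDegree p n) (hw0 : w ≠ 0) :
    ∃ c : ZMod p, z = c • w := by
  -- Only the full list of variables, up to order, can carry a nonzero coefficient, so this one
  -- coefficient determines the element.
  have hperm : ∀ {y : H p n}, y ∈ D p n → y ∈ degreePart p n k → ∀ {S : List (Fin n)},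
      coeffX S y ≠ 0 → (List.finRange n).Perm S := by
    intro y hy hyk S h0
    have hS := nodup_of_coeffX_ne_zero h0
    have hl := (length_eq_of_coeffX_ne_zero hy hyk hk hkn h0).1
    refine (List.perm_of_nodup_nodup_toFinset_eq (List.nodup_finRange n) hS ?_)
    rw [List.toFinset_finRange]
    exact ((Finset.card_eq_iff_eq_univ _).1
      (by rw [List.toFinset_card_of_nodup hS, hl, Fintype.card_fin])).symm
  have key : ∀ {y : H p n}, y ∈ D p n → y ∈ degreePart p n k → coeffX (List.finRange n) y = 0 →
      y = 0 := by
    intro y hy hyk h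
    refine eq_zero_of_coeffX_eq_zero fun S => ?_
    by_contra h0
    exact h0 (coeffX_eq_zero_of_perm (hperm hy hyk h0) h)
  have hw1 : coeffX (List.finRange n) w ≠ 0 := fun h => hw0 (key hw hwk h)
  have hn := (length_eq_of_coeffX_ne_zero hw hwk hk hkn hw1).2.2
  have hne : List.finRange n ≠ [] := by
    rw [← List.length_pos_iff, List.length_finRange]
    exact hn
  have hcoeff : ∀ {y : H p n}, y ∈ D p n → y ∈ degreePart p n k → ∃ c : ZMod p,
      coeffX (List.finRange n) y =
        c • ∏ i : (Σ k : Fin n, (Fin k → ZMod p)), linForm (lineVec i) ^ (p - 2) := by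
    intro y hy hyk
    by_cases h0 : coeffX (List.finRange n) y = 0
    · exact ⟨0, by rw [h0, zero_smul]⟩
    · exact coeffX_eq_smul hy (List.nodup_finRange n) hne
        (length_eq_of_coeffX_ne_zero hy hyk hk hkn h0).2.1
  obtain ⟨a, ha⟩ := hcoeff hz hzk
  obtain ⟨b, hb⟩ := hcoeff hw hwk
  have hb0 : b ≠ 0 := by
    rintro rfl
    exact hw1 (by rw [hb, zero_smul])
  refine ⟨a / b, sub_eq_zero.1 (key ?_ ?_ ?_)⟩
  · exact (dicksonSubalgebra p n).sub_mem hz ((dicksonSubalgebra p n).smul_mem hw _)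
  · exact Submodule.sub_mem _ hzk (Submodule.smul_mem _ _ hwk)
  · rw [map_sub, map_smul, ha, hb, smul_smul, div_mul_cancel₀ _ hb0, sub_self]

/-! ### The bottom class -/

/-- The Frobenius fixes the entries of `A`, so the substitution is right multiplication of the Moore
matrix by `A`. -/
theorem polyAct_mooreMatrix_det [Fact p.Prime] (A : Matrix (Fin n) (Fin n) (ZMod p))
    (g : Fin n → ℕ) :
    polyAct A (mooreMatrix p g).det = A.det • (mooreMatrix p g).det := by
  have h : (polyAct A).mapMatrix (mooreMatrix p g) =
      mooreMatrix p g * (algebraMap (ZMod p) (P p n)).mapMatrix A := by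
    refine Matrix.ext fun i j => ?_
    rw [Matrix.mul_apply]
    change polyAct A (MvPolynomial.X j ^ p ^ g i) =
      ∑ l, MvPolynomial.X l ^ p ^ g i * algebraMap (ZMod p) (P p n) (A l j)
    rw [map_pow, polyAct, MvPolynomial.aeval_X, sum_pow_char_pow]
    refine Finset.sum_congr rfl fun l _ => ?_
    rw [smul_pow, ZMod.pow_card_pow, Algebra.smul_def, mul_comm]
  rw [AlgHom.map_det, h, Matrix.det_mul, ← RingHom.map_det, Algebra.smul_def, mul_comm]

/-- The top form `x₁ ⋯ xₙ`. -/
def topForm (p n : ℕ) : E p n :=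
  ExteriorAlgebra.ιMulti (ZMod p) n fun i => Pi.single i 1

theorem topForm_mem (p n : ℕ) : topForm p n ∈ (⋀[ZMod p]^n (Fin n → ZMod p)) :=
  ExteriorAlgebra.ιMulti_range (ZMod p) n ⟨_, rfl⟩

theorem ιMulti_eq_det_smul (v : Fin n → Fin n → ZMod p) :
    ExteriorAlgebra.ιMulti (ZMod p) n v = (Matrix.of v).det • topForm p n := by
  have h : ExteriorAlgebra.ιMulti (ZMod p) n =
      (LinearMap.toSpanSingleton (ZMod p) (E p n) (topForm p n)).compAlternatingMap
        (Matrix.detRowAlternating (R := ZMod p) (n := Fin n)) := by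
    refine Module.Basis.ext_alternating (Pi.basisFun (ZMod p) (Fin n)) fun s hs => ?_
    let σ : Equiv.Perm (Fin n) := Equiv.ofBijective s hs.bijective_of_finite
    have h1 : (fun i => Pi.basisFun (ZMod p) (Fin n) (s i)) =
        (fun i => (Pi.single i 1 : Fin n → ZMod p)) ∘ σ := by
      funext i
      rw [Pi.basisFun_apply]
      rfl
    rw [h1, AlternatingMap.map_perm, AlternatingMap.map_perm]
    congr 1
    rw [LinearMap.compAlternatingMap_apply, LinearMap.toSpanSingleton_apply]
    have h2 : Matrix.detRowAlternating (fun i => (Pi.single i 1 : Fin n → ZMod p)) = 1 := by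
      have : (fun i => (Pi.single i 1 : Fin n → ZMod p)) = (1 : Matrix (Fin n) (Fin n) (ZMod p)) := by
        funext i j
        rw [Matrix.one_apply, Pi.single_apply]
        simp only [eq_comm]
      rw [this]
      exact Matrix.det_one
    rw [h2, one_smul]
    rfl
  rw [h]
  rfl

theorem map_topForm (A : Matrix (Fin n) (Fin n) (ZMod p)) :
    ExteriorAlgebra.map (Matrix.mulVecLin A) (topForm p n) = A.det • topForm p n := by
  rw [topForm, ExteriorAlgebra.map_apply_ιMulti, ιMulti_eq_det_smul, ← Matrix.det_transpose A]
  congr 2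
  funext i j
  simp

theorem exists_functional_topForm (p n : ℕ) :
    ∃ φ : E p n →ₗ[ZMod p] ZMod p, φ (topForm p n) = 1 := by
  refine ⟨ExteriorAlgebra.liftAlternating fun i =>
    if h : i = n then h ▸ (Matrix.detRowAlternating (R := ZMod p) (n := Fin i)) else 0, ?_⟩
  rw [topForm, ExteriorAlgebra.liftAlternating_apply_ιMulti, dif_pos rfl]
  have : (fun i => (Pi.single i 1 : Fin n → ZMod p)) = (1 : Matrix (Fin n) (Fin n) (ZMod p)) := by
    funext i j
    rw [Matrix.one_apply, Pi.single_apply]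
    simp only [eq_comm]
  rw [this]
  exact Matrix.det_one

theorem tensor_topForm_ne_zero {q : P p n} (hq : q ≠ 0) : tensor (topForm p n) q ≠ 0 := by
  obtain ⟨φ, hφ⟩ := exists_functional_topForm p n
  intro h
  have h1 := congrArg ((TensorProduct.lid (ZMod p) (P p n)).toLinearMap ∘ₗ
    TensorProduct.map φ LinearMap.id) (show topForm p n ⊗ₜ[ZMod p] q = 0 from h)
  rw [map_zero, LinearMap.comp_apply, TensorProduct.map_tmul, hφ] at h1
  exact hq (by simpa using h1)

/-- The bottom class of the extended Dickson algebra. -/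
theorem exists_bottomClass (p n : ℕ) [Fact p.Prime] :
    ∃ w ∈ D p n, w ∈ degreePart p n (n + 2 * bottomPolyDegree p n) ∧ w ≠ 0 := by
  have hp := (Fact.out : p.Prime).two_le
  refine ⟨tensor (topForm p n) ((mooreMatrix p fun i : Fin n => (i : ℕ)).det ^ (p - 2)),
    mem_D.2 fun g => ?_, tensor_mem_degreePart rfl (topForm_mem p n) ?_,
    tensor_topForm_ne_zero (pow_ne_zero _ (mooreMatrix_det_ne_zero Fin.val_injective))⟩
  -- The top form contributes one factor `det g` and the Moore determinant contributes `p - 2`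
  -- factors; together `det g ^ (p - 1) = 1`.
  · rw [act_tensor, map_topForm, map_pow, polyAct_mooreMatrix_det, smul_pow, tensor_smul_comm,
      smul_smul, ← pow_succ', show p - 2 + 1 = p - 1 by omega, ZMod.pow_card_sub_one_eq_one,
      one_smul]
    exact ((Matrix.isUnit_iff_isUnit_det _).1 g.isUnit).ne_zero
  · rw [bottomPolyDegree, mul_comm]
    exact (mooreMatrix_det_isHomogeneous _).pow _

/-! ### Endomorphisms of the extended Dickson algebra -/

theorem algebraMap_smul_eq (c : ZMod p) (z : H p n) :
    algebraMap (ZMod p) (SteenrodAlgebra p) c • z = c • z := by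
  rw [smul_eq_steenrodAct, AlgHom.commutes, Module.algebraMap_end_apply]

theorem steenrodAlgebra_smul_comm (a : SteenrodAlgebra p) (c : ZMod p) (z : H p n) :
    a • c • z = c • a • z := by
  rw [smul_eq_steenrodAct, smul_eq_steenrodAct, map_smul]

/-- The Bockstein as an element of the Steenrod algebra. -/
def bocksteinElem (p : ℕ) : SteenrodAlgebra p :=
  ⟨fun m => bockstein p m, Algebra.subset_adjoin (Set.mem_insert _ _)⟩

/-- The reduced powers as elements of the Steenrod algebra. -/
def powerElem (p k : ℕ) : SteenrodAlgebra p :=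
  ⟨fun m => power p m k, Algebra.subset_adjoin (Set.mem_insert_of_mem _ ⟨k, rfl⟩)⟩

/-! ### Eigenspaces of an endomorphism -/

section

variable [Fact p.Prime] (f : D p n →ₗ[SteenrodAlgebra p] D p n)

theorem coe_map_eq_smul {c : ZMod p} {z w : D p n} (h : (z : H p n) = c • (w : H p n)) :
    (f z : H p n) = c • (f w : H p n) := by
  have hz : z = algebraMap (ZMod p) (SteenrodAlgebra p) c • w :=
    Subtype.ext (by rw [h, Submodule.coe_smul, algebraMap_smul_eq])
  rw [hz, map_smul, Submodule.coe_smul, algebraMap_smul_eq]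

/-- The invariants on which `f` is multiplication by `c`. -/
def eigenSubmodule (c : ZMod p) : Submodule (ZMod p) (H p n) where
  carrier := {z | ∃ h : z ∈ D p n, (f ⟨z, h⟩ : H p n) = c • z}
  zero_mem' := ⟨zero_mem _, by
    rw [smul_zero]
    exact congrArg Subtype.val (map_zero f)⟩
  add_mem' := by
    rintro a b ⟨ha, ha'⟩ ⟨hb, hb'⟩
    refine ⟨add_mem ha hb, ?_⟩
    rw [smul_add, ← ha', ← hb', ← Submodule.coe_add, ← map_add]
    rfl
  smul_mem' := by
    rintro a z ⟨h, h'⟩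
    refine ⟨(dicksonSubalgebra p n).smul_mem h a, ?_⟩
    rw [coe_map_eq_smul f (w := ⟨z, h⟩) rfl, h', smul_comm]

variable {f}

theorem smul_mem_eigenSubmodule {c : ZMod p} (a : SteenrodAlgebra p) {z : H p n}
    (hz : z ∈ eigenSubmodule f c) : a • z ∈ eigenSubmodule f c := by
  obtain ⟨h, h'⟩ := hz
  refine ⟨(D p n).smul_mem a h, ?_⟩
  rw [← steenrodAlgebra_smul_comm, ← h', ← Submodule.coe_smul, ← map_smul]
  rfl

/-- The inclusion of the polynomial algebra. -/
def polyInclusion (p n : ℕ) : P p n →ₗ[ZMod p] H p n where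
  toFun := tensor 1
  map_add' := tensor_add_right 1
  map_smul' c := tensor_smul_right c 1

theorem exists_tensor_det_pow_mem {c : ZMod p} {k : ℕ} (hk : 0 < k) {z : H p n}
    (hz : z ∈ degreePart p n k) (hzc : z ∈ eigenSubmodule f c) (h0 : z ≠ 0) :
    ∃ G : ℕ, ∀ g : Fin n → ℕ, (∀ j, G ≤ g j) →
      tensor 1 ((mooreMatrix p g).det ^ (p - 1)) ∈ eigenSubmodule f c := by
  obtain ⟨h, j, hN, hh0, hh, hj⟩ := exists_polynomial_mem (N := eigenSubmodule f c)
    (fun z hz => smul_mem_eigenSubmodule (bocksteinElem p) hz)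
    (fun k z hz => smul_mem_eigenSubmodule (powerElem p k) hz) hk hz hzc h0
  refine exists_mooreMatrix_det_pow_mem (N := (eigenSubmodule f c).comap (polyInclusion p n))
    (fun k z hz => smul_mem_eigenSubmodule (powerElem p k) hz) hN hh hj hh0 fun g => ?_
  refine tensor_one_injective ?_
  have := mem_D.1 hN.1 g
  rwa [act_tensor, map_one] at this

/-- Distinct eigenvalues do not both occur in positive degrees. -/
theorem eigenvalue_unique {c c' : ZMod p} {k k' : ℕ} (hk : 0 < k) (hk' : 0 < k') {z z' : H p n}
    (hz : z ∈ degreePart p n k) (hz' : z' ∈ degreePart p n k') (hzc : z ∈ eigenSubmodule f c)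
    (hzc' : z' ∈ eigenSubmodule f c') (h0 : z ≠ 0) (h0' : z' ≠ 0) : c = c' := by
  obtain ⟨G, hG⟩ := exists_tensor_det_pow_mem hk hz hzc h0
  obtain ⟨G', hG'⟩ := exists_tensor_det_pow_mem hk' hz' hzc' h0'
  -- Exponents large enough for both eigenspaces and distinct, so that the common element is not
  -- zero.
  let g : Fin n → ℕ := fun j => max G G' + j
  have hg : Function.Injective g := fun i j h => Fin.ext (Nat.add_left_cancel h)
  obtain ⟨h1, h2⟩ := hG g fun j => (le_max_left _ _).trans (Nat.le_add_right _ _)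
  obtain ⟨h1', h2'⟩ := hG' g fun j => (le_max_right _ _).trans (Nat.le_add_right _ _)
  rw [h2, ← tensor_smul_right, ← tensor_smul_right] at h2'
  have h3 := tensor_one_injective h2'
  rw [← sub_eq_zero, ← sub_smul] at h3
  exact sub_eq_zero.1 ((smul_eq_zero.1 h3).resolve_right
    (pow_ne_zero _ (mooreMatrix_det_ne_zero hg)))

theorem pos_of_mem_degreePart {z : H p n} (hz : z ∈ D p n) {k : ℕ} (hk : 0 < k)
    (hzk : z ∈ degreePart p n k) (h0 : z ≠ 0) : 0 < n := by
  obtain ⟨S, j, -, hj, hS0, hSj⟩ := exists_coeffX_ne_zero hzk h0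
  cases S with
  | nil =>
    rw [List.length_nil] at hj
    exact (le_degree_coeffX_nil hz hSj hS0 (by omega)).1
  | cons s S => exact Fin.pos s

/-- The bottom class bounds `r`, so degree `r` is one-dimensional and `f` acts on it by a scalar
`c`. A nonzero `z` in the kernel would be an eigenvector with eigenvalue `0` in positive degree,
which forces `c = 0`, against `f y ≠ 0`. -/
theorem injective_on_DDegree {r : ℕ}
    (hf : ∀ z ∈ DDegree p n r, f z ∈ DDegree p n r)
    (hr : IsLeast {k : ℕ | 0 < k ∧ DDegree p n k ≠ ⊥} r) (hfr : ∃ z ∈ DDegree p n r, f z ≠ 0)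
    {k : ℕ} (hk : 0 < k) {z : D p n} (hz : z ∈ DDegree p n k) (hfz : f z = 0) : z = 0 := by
  obtain ⟨y, hy, hfy⟩ := hfr
  have hy0 : (y : H p n) ≠ 0 := by
    intro h
    rw [show y = 0 from Subtype.ext h, map_zero] at hfy
    exact hfy rfl
  have hn := pos_of_mem_degreePart y.2 hr.1.1 hy hy0
  have hle : r ≤ n + 2 * bottomPolyDegree p n := by
    obtain ⟨w, hwD, hw, hw0⟩ := exists_bottomClass p n
    refine hr.2 ⟨by omega, fun h => hw0 ?_⟩
    have hmem : (⟨w, hwD⟩ : D p n) ∈ DDegree p n (n + 2 * bottomPolyDegree p n) := hw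
    rw [h, AddSubgroup.mem_bot] at hmem
    exact congrArg Subtype.val hmem
  obtain ⟨c, hc⟩ := exists_eq_smul_of_mem_degreePart (f y).2 y.2 (hf y hy) hy hr.1.1 hle hy0
  by_contra hz0
  have h0 : (0 : ZMod p) = c := eigenvalue_unique (f := f) hk hr.1.1 hz hy
    ⟨z.2, by rw [zero_smul]; exact congrArg Subtype.val hfz⟩ ⟨y.2, hc⟩
    (fun h => hz0 (Subtype.ext h)) hy0
  rw [← h0, zero_smul] at hc
  exact hfy (Subtype.ext hc)

/-! ### From injectivity in positive degrees to bijectivity -/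

theorem bijOn_DDegree {k : ℕ} (hf : ∀ z ∈ DDegree p n k, f z ∈ DDegree p n k)
    (hinj : ∀ z ∈ DDegree p n k, f z = 0 → z = 0) :
    Set.BijOn f (DDegree p n k) (DDegree p n k) := by
  have hi : Set.InjOn f (DDegree p n k) := fun a ha b hb h =>
    sub_eq_zero.1 (hinj _ (sub_mem ha hb) (by rw [map_sub, h, sub_self]))
  have hm : Set.MapsTo f (DDegree p n k) (DDegree p n k) := hf
  exact ⟨hm, hi, ((DDegree_finite k).injOn_iff_bijOn_of_mapsTo hm).1 hi |>.surjOn⟩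

/-- An element of the kernel is concentrated in degree `0` if `f` is injective in positive
degrees. -/
theorem mem_DDegree_zero_of_map_eq_zero
    (hf : ∀ k : ℕ, ∀ z ∈ DDegree p n k, f z ∈ DDegree p n k)
    (hinj : ∀ k : ℕ, 0 < k → ∀ z ∈ DDegree p n k, f z = 0 → z = 0) {z : D p n} (hz : f z = 0) :
    z ∈ DDegree p n 0 := by
  obtain ⟨s, w, hw, rfl⟩ := exists_eq_sum_DDegree z
  rw [map_sum] at hz
  refine sum_mem fun k hk => ?_
  rcases Nat.eq_zero_or_pos k with rfl | hk0
  · exact hw 0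
  · rw [hinj k hk0 _ (hw k)
      (eq_zero_of_sum_DDegree_eq_zero (z := fun k => f (w k)) (fun k _ => hf k _ (hw k)) hz hk)]
    exact zero_mem _

theorem constantCoeff_polyPart_of_mem_degreePart {k : ℕ} (hk : 0 < k) {z : H p n}
    (hz : z ∈ degreePart p n k) : MvPolynomial.constantCoeff (polyPart z) = 0 := by
  by_cases h0 : polyPart z = 0
  · rw [h0, map_zero]
  · obtain ⟨j, hj, hh⟩ := exists_of_mem_coeffDegree (polyPart_mem_coeffDegree hz) h0
    rw [MvPolynomial.constantCoeff_eq]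
    exact hh.coeff_eq_zero (by rw [map_zero]; omega)

theorem constantCoeff_polyPart_of_mem_DAugmentation {z : D p n} (hz : z ∈ DAugmentation p n) :
    MvPolynomial.constantCoeff (polyPart (z : H p n)) = 0 := by
  let ε : D p n →+ ZMod p := (MvPolynomial.constantCoeff.toAddMonoidHom.comp
    (polyPart (p := p) (n := n)).toAddMonoidHom).comp (D p n).subtype.toAddMonoidHom
  have h : DAugmentation p n ≤ ε.ker :=
    iSup₂_le fun k hk w hw => constantCoeff_polyPart_of_mem_degreePart hk hw
  exact h hz

theorem coe_one_eq_tensor : ((1 : D p n) : H p n) = tensor 1 1 := rfl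

theorem exists_coe_eq_smul_one {z : D p n} (hz : z ∈ DDegree p n 0) :
    ∃ c : ZMod p, (z : H p n) = c • ((1 : D p n) : H p n) :=
  eq_smul_one_of_mem_degreePart_zero hz

/-- The constant coefficient vanishes on the augmentation ideal and recovers `c` from `c • 1`. -/
theorem eq_zero_of_mem_DAugmentation {z : D p n} (hz : z ∈ DAugmentation p n)
    (hz0 : z ∈ DDegree p n 0) : z = 0 := by
  obtain ⟨c, hc⟩ := exists_coe_eq_smul_one hz0
  have h := constantCoeff_polyPart_of_mem_DAugmentation hz
  rw [hc, coe_one_eq_tensor, map_smul, polyPart_tensor, map_one, one_smul,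
    MvPolynomial.constantCoeff_smul, map_one, smul_eq_mul, mul_one] at h
  refine Subtype.ext ?_
  rw [hc, h, zero_smul]
  rfl

theorem DDegree_le_DAugmentation {k : ℕ} (hk : 0 < k) : DDegree p n k ≤ DAugmentation p n :=
  le_iSup₂_of_le k hk le_rfl

theorem D_one_ne_zero : (1 : D p n) ≠ 0 := by
  intro h
  have h1 := congrArg Subtype.val h
  exact one_ne_zero (tensor_one_injective ((h1 : tensor 1 1 = 0).trans (tensor_zero_right 1).symm))

end

end ExtendedDickson

end

theorem theorem4 (p n : ℕ) [Fact p.Prime] (hp : p ≠ 2)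
    (f : ExtendedDickson.D p n →ₗ[ExtendedDickson.SteenrodAlgebra p] ExtendedDickson.D p n)
    (hf : ∀ k : ℕ, ∀ z ∈ ExtendedDickson.DDegree p n k, f z ∈ ExtendedDickson.DDegree p n k)
    (r : ℕ) (hr : IsLeast {k : ℕ | 0 < k ∧ ExtendedDickson.DDegree p n k ≠ ⊥} r)
    (hfr : ∃ z ∈ ExtendedDickson.DDegree p n r, f z ≠ 0) :
    (∀ k : ℕ, 0 < k → Set.BijOn f (ExtendedDickson.DDegree p n k) (ExtendedDickson.DDegree p n k)) ∧
    Set.BijOn f (ExtendedDickson.DAugmentation p n) (ExtendedDickson.DAugmentation p n) ∧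
    (Function.Bijective f ↔ f 1 ≠ 0) := by
  open ExtendedDickson in
  have hinj : ∀ k : ℕ, 0 < k → ∀ z ∈ DDegree p n k, f z = 0 → z = 0 := fun k hk z hz hfz =>
    injective_on_DDegree (hf r) hr hfr hk hz hfz
  have hbij : ∀ k : ℕ, 0 < k → Set.BijOn f (DDegree p n k) (DDegree p n k) := fun k hk =>
    bijOn_DDegree (hf k) (hinj k hk)
  refine ⟨hbij, ⟨?_, ?_, ?_⟩, ?_, ?_⟩
  · have h : DAugmentation p n ≤ (DAugmentation p n).comap f.toAddMonoidHom :=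
      iSup₂_le fun k hk z hz => DDegree_le_DAugmentation hk (hf k z hz)
    exact h
  · intro a ha b hb hab
    have h : f (a - b) = 0 := by rw [map_sub, hab, sub_self]
    exact sub_eq_zero.1 (eq_zero_of_mem_DAugmentation (sub_mem ha hb)
      (mem_DDegree_zero_of_map_eq_zero hf hinj h))
  · have h : DAugmentation p n ≤ (DAugmentation p n).map f.toAddMonoidHom :=
      iSup₂_le fun k hk z hz => by
        obtain ⟨y, hy, rfl⟩ := (hbij k hk).surjOn hz
        exact ⟨y, DDegree_le_DAugmentation hk hy, rfl⟩
    exact h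
  · intro h h1
    exact D_one_ne_zero (h.injective (h1.trans (map_zero f).symm))
  · intro h1
    -- Elements of degree `0` are multiples `c • 1`, and `f (c • 1) = c • f 1`.
    have hinj0 : ∀ z ∈ DDegree p n 0, f z = 0 → z = 0 := by
      intro z hz hfz
      obtain ⟨c, hc⟩ := exists_coe_eq_smul_one hz
      have h := coe_map_eq_smul f hc
      rw [hfz] at h
      have hc0 := (smul_eq_zero.1 h.symm).resolve_right fun h => h1 (Subtype.ext h)
      refine Subtype.ext ?_
      rw [hc, hc0, zero_smul]
      rfl
    refine ⟨fun a b hab => ?_, fun z => ?_⟩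
    · have h : f (a - b) = 0 := by rw [map_sub, hab, sub_self]
      exact sub_eq_zero.1 (hinj0 _ (mem_DDegree_zero_of_map_eq_zero hf hinj h) h)
    · obtain ⟨s, w, hw, rfl⟩ := exists_eq_sum_DDegree z
      have hsurj : ∀ k, ∃ y, f y = w k := by
        intro k
        have hk : Set.BijOn f (DDegree p n k) (DDegree p n k) := by
          rcases Nat.eq_zero_or_pos k with rfl | hk0
          · exact bijOn_DDegree (hf 0) hinj0
          · exact hbij k hk0
        obtain ⟨y, -, hy⟩ := hk.surjOn (hw k)
        exact ⟨y, hy⟩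
      choose y hy using hsurj
      exact ⟨∑ k ∈ s, y k, by rw [map_sum, Finset.sum_congr rfl fun k _ => hy k]⟩
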